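/- Let $p$ be an odd prime, $k$ an algebraically closed field of characteristic $p$, $W=W(k)$, $W_{\mathbb Q}=\mathrm{Frac}(W)$, and $\sigma$ the Frobenius. Let $N$ be the isocrystal of a supersingular $p$-divisible group of height $4$ and dimension $2$ over $k$: it has a $W_{\mathbb Q}$-basis $e_1,\dots,e_4$ with $Fe_1=e_2$, $Fe_2=pe_1$, $Fe_3=e_4$, $Fe_4=pe_3$. Let $M\subset N$ be a Dieudonné lattice (a $W$-lattice with $pM\subset F^{-1}(pM)\subset M$) and let $\omega$ be a generator of $\bigwedge^4_W M$. On $V=\bigwedge^2_{W_{\mathbb Q}}N$ let $[x,y]\,\omega=x\wedge y$, and let $\Phi$ be the $\sigma$-semilinear operator with $\Phi(a\wedge b)=p^{-1}\,Fa\wedge Fb$. Let $V^\Phi=\{x\in V:\Phi x=x\}$, a $\mathbb Q_p$-vector space. A vertex lattice is a $\mathbb Z_p$-lattice $\Lambda\subset V^\Phi$ with $p\Lambda\subset\Lambda^\vee\subset\Lambda$, where $\Lambda^\vee=\{x\in V^\Phi:[x,y]\in W\text{ for all }y\in\Lambda\}$; its type is $\dim_{\mathbb F_p}(\Lambda/\Lambda^\vee)$.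 Let $\Lambda$ be a vertex lattice of type $4$. Put $\Omega_0=\Lambda/\Lambda^\vee$ and $\Omega=\Omega_0\otimes_{\mathbb F_p}k$, with the $k$-bilinear form $[\cdot,\cdot]_\Lambda$ that extends $([x],[y])\mapsto p[x,y]\bmod p$ and with the Frobenius operator $\Phi(x\otimes a)=x\otimes a^p$. For a field $k'\supseteq k$ and a subspace $\mathcal L\subset\Omega\otimes_k k'$, let $\overline\Phi(\mathcal L)$ be the $k'$-subspace generated by $\Phi(\mathcal L)$. Let $\mathrm{OGr}(\Omega)(2)$ be the $k$-scheme that represents the functor of totally isotropic local direct summands of rank $2$ of $\Omega$, and let $X_\Lambda$ be its reduced closed subscheme with $k'$-points $$X_\Lambda(k')=\{\mathcal L\in\mathrm{OGr}(\Omega)(2)(k') : \dim_{k'}(\mathcal L+\overline\Phi(\mathcal L))=3\}\qquad\text{for all fields }k'\supseteq k.$$ Flags $\mathcal L_1\subset\mathcal L_2$ of totally isotropic subspaces of dimensions $1$ and $2$ fall into exactly two components, two flags being in the same component if and only if an orthogonal transformation of determinant $1$ carries the first to the second. Let $X_\Lambda^{+}$ and $X_\Lambda^{-}$ be the two parts of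 $X_\Lambda$ on which the flag $\mathcal L\cap\overline\Phi(\mathcal L)\subset\mathcal L$ lies in the one or the other component. Then the scheme $\mathrm{OGr}(\Omega)(2)$ exists, the points $\mathcal L$ with $\dim(\mathcal L+\overline\Phi(\mathcal L))=3$ form a closed subset of it, $X_\Lambda$ is the disjoint union of its open and closed subschemes $X_\Lambda^{+}$ and $X_\Lambda^{-}$, and each of $X_\Lambda^{+}$ and $X_\Lambda^{-}$ is isomorphic to $\mathbb P^1_k$ as a scheme over $k$. -/

import Mathlib

open scoped TensorProduct
open CategoryTheory AlgebraicGeometry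

universe u v

noncomputable section

namespace GLFour

/-! ### Extension of scalars from `𝔽_p` to `k` -/

section Extension

variable {p : ℕ} [Fact p.Prime] {k : Type u} [Field k] [CharP k p] [Algebra (ZMod p) k]
  {U : Type*} [AddCommGroup U] [Module (ZMod p) U]

/-- A biadditive `k`-valued form on an `𝔽_p`-vector space, as an `𝔽_p`-bilinear map. -/
def zmodBilin (f : U →+ U →+ k) : U →ₗ[ZMod p] U →ₗ[ZMod p] k :=
  AddMonoidHom.toZModLinearMap p
    (AddMonoidHom.mk' (fun x => AddMonoidHom.toZModLinearMap p (f x))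
      (fun x x' => by ext y; simp))

/-- The `k`-bilinear extension to `k ⊗ U` of a `k`-valued form on `U`. -/
def extForm (f : U →+ U →+ k) : LinearMap.BilinForm k (k ⊗[ZMod p] U) :=
  (LinearMap.BilinMap.baseChange k (zmodBilin (p := p) f)).compr₂
    (Algebra.TensorProduct.lmul'' (ZMod p) (S := k)).toLinearMap

/-- The defining property of the extended form. -/
theorem extForm_tmul (f : U →+ U →+ k) (a b : k) (x y : U) :
    extForm (p := p) f (a ⊗ₜ x) (b ⊗ₜ y) = a * b * f x y := by
  have h : extForm (p := p) f (a ⊗ₜ x) (b ⊗ₜ y) =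
      Algebra.TensorProduct.lmul'' (ZMod p) (S := k) ((a * b) ⊗ₜ[ZMod p] f x y) := by
    simp [extForm, zmodBilin]
  rw [h]
  exact Algebra.TensorProduct.lmul'_apply_tmul (R := ZMod p) (a * b) (f x y)

variable (k U) in
/-- Frobenius on `k ⊗ U`, i.e. `a ⊗ x ↦ a ^ p ⊗ x`. -/
def extFrob : k ⊗[ZMod p] U →ₛₗ[frobenius k p] k ⊗[ZMod p] U where
  toFun := TensorProduct.map
    (AddMonoidHom.toZModLinearMap p (frobenius k p).toAddMonoidHom) LinearMap.id
  map_add' x y := map_add _ x y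
  map_smul' c x := by
    induction x using TensorProduct.induction_on with
    | zero => simp
    | tmul a x => simp [TensorProduct.smul_tmul', frobenius_def, mul_pow]
    | add x y hx hy => rw [smul_add, map_add, map_add, hx, hy, smul_add]

theorem extFrob_tmul (a : k) (x : U) :
    extFrob (p := p) k U (a ⊗ₜ x) = (a ^ p) ⊗ₜ x := rfl

end Extension

/-! ### The isocrystal `N` and the Dieudonné lattice `M` -/

section Isocrystal

variable (p : ℕ) [Fact p.Prime] (k : Type u) [Field k] [IsAlgClosed k] [CharP k p]

/-- `W_ℚ`, the fraction field of the ring `W = W(k)` of `p`-typical Witt vectors. -/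
abbrev WQ : Type u := FractionRing (WittVector p k)

/-- The Frobenius automorphism `σ` of `W_ℚ`. -/
abbrev sigma : WQ p k →+* WQ p k := WittVector.FractionRing.frobeniusRingHom p k

variable (N : Type v) [AddCommGroup N] [WittVector.Isocrystal p k N]

/-- The Frobenius operator `F` of an isocrystal. -/
abbrev frobF : N →ₛₗ[sigma p k] N :=
  (WittVector.Isocrystal.frobenius p k : N ≃ₛₗ[sigma p k] N).toLinearMap

/-- `N` is (up to isomorphism) the isocrystal of a supersingular `p`-divisible group of height 4
and dimension 2, that is, a sum of two copies of the simple isocrystal of slope `1/2`. -/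
def IsSupersingular : Prop :=
  ∃ e : Module.Basis (Fin 4) (WQ p k) N,
    frobF p k N (e 0) = e 1 ∧ frobF p k N (e 1) = (p : WQ p k) • e 0 ∧
    frobF p k N (e 2) = e 3 ∧ frobF p k N (e 3) = (p : WQ p k) • e 2

variable {N} in
/-- Dieudonné lattices: `W`-lattices `M ⊆ N` with `p M ⊆ F⁻¹(p M) ⊆ M`. (The further condition
that `F(F⁻¹(M))` generates `M` is automatic, as `F` is bijective on `N`.) -/
structure IsDieudonneLattice [Module (WittVector p k) N] [IsScalarTower (WittVector p k) (WQ p k) N]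
    (M : Submodule (WittVector p k) N) : Prop where
  fg : M.FG
  span_eq_top : Submodule.span (WQ p k) (M : Set N) = ⊤
  p_smul_mem : ∀ x ∈ M, ∃ y ∈ M, frobF p k N ((p : WQ p k) • x) = (p : WQ p k) • y
  mem_of_frob : ∀ x : N, (∃ y ∈ M, frobF p k N x = (p : WQ p k) • y) → x ∈ M

variable {N} in
/-- `ω` generates the free rank one `W`-module `⋀⁴ M`, i.e. it is `m₁ ∧ m₂ ∧ m₃ ∧ m₄` for some
`W`-basis of `M`. -/
def IsVolumeGenerator [Module (WittVector p k) N] (M : Submodule (WittVector p k) N)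
    (ω : ⋀[WQ p k]^4 N) : Prop :=
  ∃ m : Module.Basis (Fin 4) (WittVector p k) M,
    ω = exteriorPower.ιMulti (WQ p k) 4 (fun i => (m i : N))

/-! ### The space `V = ⋀² N` with its pairing and its operator `Φ` -/

/-- `V = ⋀² N` over `W_ℚ`. -/
def BiVec : Type (max u v) := ⋀[WQ p k]^2 N

instance : AddCommGroup (BiVec p k N) := inferInstanceAs (AddCommGroup (⋀[WQ p k]^2 N))

instance : Module (WQ p k) (BiVec p k N) := inferInstanceAs (Module (WQ p k) (⋀[WQ p k]^2 N))

/-- `V` is by definition `⋀² N`. -/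
def BiVec.equiv : BiVec p k N ≃ₗ[WQ p k] ⋀[WQ p k]^2 N := LinearEquiv.refl _ _

/-- The alternating map `(a, b) ↦ a ∧ b` from `N × N` to `V`. -/
def BiVec.mk : N [⋀^Fin 2]→ₗ[WQ p k] BiVec p k N :=
  (BiVec.equiv p k N).symm.toLinearMap.compAlternatingMap (exteriorPower.ιMulti (WQ p k) 2)

/-- The linear map out of `V` given by an alternating map. -/
def BiVec.lift {P : Type*} [AddCommGroup P] [Module (WQ p k) P] (f : N [⋀^Fin 2]→ₗ[WQ p k] P) :
    BiVec p k N →ₗ[WQ p k] P :=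
  (exteriorPower.alternatingMapLinearEquiv f).comp (BiVec.equiv p k N).toLinearMap

/-- The wedge product `V × V → ⋀⁴ N`. -/
def wedge : BiVec p k N →ₗ[WQ p k] BiVec p k N →ₗ[WQ p k] ⋀[WQ p k]^4 N :=
  LinearMap.mk₂ (WQ p k)
    (fun x y => ⟨(BiVec.equiv p k N x : ExteriorAlgebra (WQ p k) N) * BiVec.equiv p k N y,
      SetLike.mul_mem_graded (A := fun i : ℕ => ⋀[WQ p k]^i N)
        (BiVec.equiv p k N x).2 (BiVec.equiv p k N y).2⟩)
    (fun x x' y => Subtype.ext (by simp [add_mul]))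
    (fun c x y => Subtype.ext (by simp))
    (fun x y y' => Subtype.ext (by simp [mul_add]))
    (fun c x y => Subtype.ext (by simp))

variable {N}

open Classical in
/-- The coordinate functional on the line `⋀⁴ N` given by a generator `ω`: the linear form with
value `1` at `ω`. -/
def coordOf (ω : ⋀[WQ p k]^4 N) : Module.Dual (WQ p k) (⋀[WQ p k]^4 N) :=
  if h : ∃ f : Module.Dual (WQ p k) (⋀[WQ p k]^4 N), f ω = 1 then h.choose else 0

/-- The pairing `[x, y]` on `V`, with `[x, y] ω = x ∧ y`. -/
def pairing (ω : ⋀[WQ p k]^4 N) : LinearMap.BilinForm (WQ p k) (BiVec p k N) :=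
  (wedge p k N).compr₂ (coordOf p k ω)

/-- The defining property of the pairing. -/
theorem pairing_smul (hN : Module.finrank (WQ p k) N = 4) (ω : ⋀[WQ p k]^4 N) (hω : ω ≠ 0)
    (x y : BiVec p k N) : pairing p k ω x y • ω = wedge p k N x y := by
  have hfin : Module.Finite (WQ p k) N := Module.finite_of_finrank_pos (by omega)
  have h1 : Module.finrank (WQ p k) (⋀[WQ p k]^4 N) = 1 := by
    rw [exteriorPower.finrank_eq, hN]; rfl
  obtain ⟨c, hc⟩ := (finrank_eq_one_iff_of_nonzero' ω hω).1 h1 (wedge p k N x y)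
  have hex : ∃ f : Module.Dual (WQ p k) (⋀[WQ p k]^4 N), f ω = 1 := by
    obtain ⟨f, hf⟩ := Module.Projective.exists_dual_ne_zero (WQ p k) hω
    exact ⟨(f ω)⁻¹ • f, by simp [hf]⟩
  have hω1 : coordOf p k ω ω = 1 := by
    rw [coordOf, dif_pos hex]; exact hex.choose_spec
  have : pairing p k ω x y = c := by
    simp [pairing, ← hc, hω1]
  rw [this, hc]

theorem BiVec.hom_ext {P : Type*} [AddCommGroup P] [Module (WQ p k) P]
    {f g : BiVec p k N →ₗ[WQ p k] P}
    (h : ∀ m, f (BiVec.mk p k N m) = g (BiVec.mk p k N m)) : f = g := by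
  have : f.comp (BiVec.equiv p k N).symm.toLinearMap =
      g.comp (BiVec.equiv p k N).symm.toLinearMap :=
    exteriorPower.linearMap_ext (AlternatingMap.ext h)
  exact LinearMap.ext fun x => congrArg (fun F => F (BiVec.equiv p k N x)) this

theorem wedge_comm (x y : BiVec p k N) : wedge p k N x y = wedge p k N y x := by
  have h : wedge p k N = (wedge p k N).flip := by
    refine BiVec.hom_ext p k fun a => BiVec.hom_ext p k fun b => ?_
    have sw : ∀ u v : N, ExteriorAlgebra.ι (WQ p k) u * ExteriorAlgebra.ι (WQ p k) v =
        -(ExteriorAlgebra.ι (WQ p k) v * ExteriorAlgebra.ι (WQ p k) u) := fun u v =>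
      eq_neg_of_add_eq_zero_left (ExteriorAlgebra.ι_add_mul_swap u v)
    have hv : ∀ m, ((BiVec.equiv p k N (BiVec.mk p k N m) : ⋀[WQ p k]^2 N) :
        ExteriorAlgebra (WQ p k) N) =
        ExteriorAlgebra.ι (WQ p k) (m 0) * ExteriorAlgebra.ι (WQ p k) (m 1) := fun m => by
      have h0 : ((BiVec.equiv p k N (BiVec.mk p k N m) : ⋀[WQ p k]^2 N) :
        ExteriorAlgebra (WQ p k) N) = ExteriorAlgebra.ιMulti (WQ p k) 2 m := rfl
      rw [h0, ExteriorAlgebra.ιMulti_apply]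
      simp [List.ofFn_succ]
    apply Subtype.ext
    simp only [wedge, LinearMap.mk₂_apply, LinearMap.flip_apply, hv]
    generalize hA : ExteriorAlgebra.ι (WQ p k) (a 0) = A
    generalize hB : ExteriorAlgebra.ι (WQ p k) (a 1) = B
    generalize hC : ExteriorAlgebra.ι (WQ p k) (b 0) = C
    generalize hD : ExteriorAlgebra.ι (WQ p k) (b 1) = D
    have h1 : B * C = -(C * B) := by rw [← hB, ← hC, sw]
    have h2 : B * D = -(D * B) := by rw [← hB, ← hD, sw]
    have h3 : A * C = -(C * A) := by rw [← hA, ← hC, sw]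
    have h4 : A * D = -(D * A) := by rw [← hA, ← hD, sw]
    calc A * B * (C * D) = A * (B * C) * D := by simp only [mul_assoc]
      _ = -(A * C * (B * D)) := by rw [h1]; simp only [mul_neg, neg_mul, mul_assoc]
      _ = A * C * (D * B) := by rw [h2]; simp only [mul_neg, neg_neg]
      _ = -(C * (A * D) * B) := by rw [h3]; simp only [neg_mul, mul_assoc]
      _ = C * D * (A * B) := by rw [h4]; simp only [mul_neg, neg_mul, neg_neg, mul_assoc]
  exact congrArg (fun f => f x y) h

theorem pairing_comm (ω : ⋀[WQ p k]^4 N) (x y : BiVec p k N) :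
    pairing p k ω x y = pairing p k ω y x := by
  simp only [pairing, LinearMap.compr₂_apply]
  rw [wedge_comm]

variable (N) in
/-- `V` with `W_ℚ` acting through `σ`. -/
def Twist : Type (max u v) := BiVec p k N

instance : AddCommGroup (Twist p k N) := inferInstanceAs (AddCommGroup (BiVec p k N))

instance : Module (WQ p k) (Twist p k N) := Module.compHom (BiVec p k N) (sigma p k)

theorem frobF_update (m : Fin 2 → N) (i : Fin 2) (z : N) :
    (fun j => frobF p k N (Function.update m i z j)) =
      Function.update (fun j => frobF p k N (m j)) i (frobF p k N z) := by
  funext j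
  by_cases h : j = i
  · subst h; simp
  · simp [h]

variable (N) in
/-- The alternating map `(a, b) ↦ p⁻¹ (F a ∧ F b)`, linear over `W_ℚ` for the twisted structure. -/
def phiAlt : N [⋀^Fin 2]→ₗ[WQ p k] Twist p k N where
  toFun m := ((p : WQ p k)⁻¹ • BiVec.mk p k N (fun i => frobF p k N (m i)) : BiVec p k N)
  map_update_add' {inst} m i x y := by
    obtain rfl : inst = instDecidableEqFin 2 := Subsingleton.elim _ _
    rw [frobF_update, frobF_update, frobF_update, map_add, AlternatingMap.map_update_add]
    exact smul_add (p : WQ p k)⁻¹ (_ : BiVec p k N) _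
  map_update_smul' {inst} m i c x := by
    obtain rfl : inst = instDecidableEqFin 2 := Subsingleton.elim _ _
    rw [frobF_update, frobF_update, map_smulₛₗ, AlternatingMap.map_update_smul]
    exact smul_comm (p : WQ p k)⁻¹ (sigma p k c) (_ : BiVec p k N)
  map_eq_zero_of_eq' m i j h hij := by
    have : BiVec.mk p k N (fun i => frobF p k N (m i)) = 0 :=
      AlternatingMap.map_eq_zero_of_eq _ _ (by simp only [h]) hij
    rw [this]
    exact smul_zero (A := BiVec p k N) _

variable (N) in
/-- The `σ`-semilinear operator `Φ` of `V`, with `Φ(a ∧ b) = p⁻¹ (F a ∧ F b)`. -/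
def phi : BiVec p k N →ₛₗ[sigma p k] BiVec p k N where
  toFun := BiVec.lift p k N (phiAlt p k N)
  map_add' x y := map_add (BiVec.lift p k N (phiAlt p k N)) x y
  map_smul' c x := map_smul (BiVec.lift p k N (phiAlt p k N)) c x

/-- The defining property of `Φ`. -/
theorem phi_mk (m : Fin 2 → N) : phi p k N (BiVec.mk p k N m) =
    (p : WQ p k)⁻¹ • BiVec.mk p k N (fun i => frobF p k N (m i)) :=
  exteriorPower.alternatingMapLinearEquiv_apply_ιMulti (phiAlt p k N) m

/-! ### Vertex lattices in `V^Φ` -/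

/-- The inclusion `ℤ_p = W(𝔽_p) → W(k)`. -/
def zpToW : ℤ_[p] →+* WittVector p k :=
  (WittVector.map (ZMod.castHom (dvd_refl p) k)).comp (WittVector.equiv p).symm.toRingHom

/-- The inclusion `ℤ_p → W_ℚ`. -/
def zpToWQ : ℤ_[p] →+* WQ p k := (algebraMap (WittVector p k) (WQ p k)).comp (zpToW p k)

/-- `V` as a `ℤ_p`-module. -/
instance : Module ℤ_[p] (BiVec p k N) := Module.compHom (BiVec p k N) (zpToWQ p k)

theorem zp_smul_def (c : ℤ_[p]) (x : BiVec p k N) : c • x = zpToWQ p k c • x := rfl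

theorem frobenius_zpToW (c : ℤ_[p]) :
    WittVector.frobenius (zpToW p k c) = zpToW p k c := by
  have h : ∀ x : WittVector p (ZMod p),
      WittVector.frobenius (WittVector.map (ZMod.castHom (dvd_refl p) k) x) =
        WittVector.map (ZMod.castHom (dvd_refl p) k) x := fun x => by
    ext n
    rw [WittVector.coeff_frobenius_charP, WittVector.map_coeff, ← map_pow, ZMod.pow_card]
  exact h _

theorem sigma_zpToWQ (c : ℤ_[p]) : sigma p k (zpToWQ p k c) = zpToWQ p k c := by
  have h2 : ∀ w : WittVector p k, sigma p k (algebraMap _ (WQ p k) w) =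
      algebraMap _ (WQ p k) (WittVector.frobenius w) := fun w =>
    IsFractionRing.ringEquivOfRingEquiv_algebraMap _ w
  simp only [zpToWQ, RingHom.comp_apply]
  rw [h2, frobenius_zpToW]

variable (N) in
/-- The `Φ`-fixed vectors `V^Φ`, as a `ℤ_p`-submodule of `V` (it is a `ℚ_p`-vector space). -/
def fixedVectors : Submodule ℤ_[p] (BiVec p k N) where
  carrier := {x | phi p k N x = x}
  add_mem' {x y} hx hy := by
    simp only [Set.mem_ofPred_eq] at *
    rw [map_add, hx, hy]
  zero_mem' := map_zero _
  smul_mem' c x hx := by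
    simp only [Set.mem_ofPred_eq] at *
    rw [zp_smul_def, map_smulₛₗ, hx, sigma_zpToWQ]

/-- The ring `W` inside `W_ℚ`. -/
def integers : Subring (WQ p k) := (algebraMap (WittVector p k) (WQ p k)).range

theorem algebraMap_W_injective : Function.Injective (algebraMap (WittVector p k) (WQ p k)) :=
  IsFractionRing.injective _ _

/-- Reduction modulo `p`, `W → W / p W = k`. -/
def reduction : integers p k →+* k :=
  WittVector.constantCoeff.comp
    (RingEquiv.ofBijective (algebraMap (WittVector p k) (WQ p k)).rangeRestrict
      ⟨fun _ _ h => algebraMap_W_injective p k (congrArg Subtype.val h),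
        RingHom.rangeRestrict_surjective _⟩).symm.toRingHom

theorem reduction_p_mul (c : WQ p k) (hc : c ∈ integers p k)
    (h : (p : WQ p k) * c ∈ integers p k) : reduction p k ⟨(p : WQ p k) * c, h⟩ = 0 := by
  have : (⟨(p : WQ p k) * c, h⟩ : integers p k) = (p : integers p k) * ⟨c, hc⟩ :=
    Subtype.ext (by simp)
  rw [this, map_mul, map_natCast, CharP.cast_eq_zero, zero_mul]

/-- The dual lattice `Λ^∨ = {x ∈ V^Φ : [x, y] is integral for all y ∈ Λ}`, where integral
means in `W`. If `ω` is fixed by `p⁻² ⋀⁴ F`, then the pairing is `ℚ_p`-valued on `V^Φ`, and integral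
means in `ℤ_p = ℚ_p ∩ W`. A general generator `ω` is a unit of `W` times one that is fixed, so the
dual lattice is the same for all choices. -/
def dual (ω : ⋀[WQ p k]^4 N) (Λ : Submodule ℤ_[p] (BiVec p k N)) :
    Submodule ℤ_[p] (BiVec p k N) where
  carrier := {x | x ∈ fixedVectors p k N ∧ ∀ y ∈ Λ, pairing p k ω x y ∈ integers p k}
  add_mem' {x x'} hx hx' := ⟨add_mem hx.1 hx'.1, fun y hy => by
    rw [map_add, LinearMap.add_apply]; exact add_mem (hx.2 y hy) (hx'.2 y hy)⟩
  zero_mem' := ⟨zero_mem _, fun y hy => by simp⟩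
  smul_mem' c x hx := ⟨Submodule.smul_mem _ c hx.1, fun y hy => by
    rw [zp_smul_def, map_smul, LinearMap.smul_apply, smul_eq_mul]
    exact mul_mem ⟨zpToW p k c, rfl⟩ (hx.2 y hy)⟩

/-- Vertex lattices: `ℤ_p`-lattices `Λ ⊆ V^Φ` with `p Λ ⊆ Λ^∨ ⊆ Λ`. -/
structure VertexLattice (ω : ⋀[WQ p k]^4 N) where
  carrier : Submodule ℤ_[p] (BiVec p k N)
  le_fixedVectors : carrier ≤ fixedVectors p k N
  fg : carrier.FG
  /-- `Λ` spans `V^Φ` over `ℚ_p`. -/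
  spanning : ∀ x ∈ fixedVectors p k N, ∃ n : ℕ, (p : ℤ_[p]) ^ n • x ∈ carrier
  p_smul_mem_dual : ∀ x ∈ carrier, (p : ℤ_[p]) • x ∈ dual p k ω carrier
  dual_le : dual p k ω carrier ≤ carrier

variable {p k} {ω : ⋀[WQ p k]^4 N}

/-- `Ω₀ = Λ / Λ^∨`. -/
def Omega0 (Λ : VertexLattice p k ω) : Type (max u v) :=
  Λ.carrier ⧸ (dual p k ω Λ.carrier).submoduleOf Λ.carrier

instance (Λ : VertexLattice p k ω) : AddCommGroup (Omega0 Λ) :=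
  inferInstanceAs (AddCommGroup (Λ.carrier ⧸ (dual p k ω Λ.carrier).submoduleOf Λ.carrier))

/-- The quotient map `Λ → Ω₀`. -/
def Omega0.mk (Λ : VertexLattice p k ω) : Λ.carrier →+ Omega0 Λ :=
  ((dual p k ω Λ.carrier).submoduleOf Λ.carrier).mkQ.toAddMonoidHom

theorem Omega0.mk_surjective (Λ : VertexLattice p k ω) : Function.Surjective (Omega0.mk Λ) :=
  Submodule.mkQ_surjective _

theorem Omega0.mk_eq_zero (Λ : VertexLattice p k ω) (x : Λ.carrier) :
    Omega0.mk Λ x = 0 ↔ (x : BiVec p k N) ∈ dual p k ω Λ.carrier :=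
  Submodule.Quotient.mk_eq_zero _

/-- Additive maps out of `Ω₀`. -/
def Omega0.lift {P : Type*} [AddCommGroup P] (Λ : VertexLattice p k ω) (f : Λ.carrier →+ P)
    (hf : ∀ x : Λ.carrier, (x : BiVec p k N) ∈ dual p k ω Λ.carrier → f x = 0) : Omega0 Λ →+ P :=
  QuotientAddGroup.lift ((dual p k ω Λ.carrier).submoduleOf Λ.carrier).toAddSubgroup f hf

theorem Omega0.lift_mk {P : Type*} [AddCommGroup P] (Λ : VertexLattice p k ω)
    (f : Λ.carrier →+ P)
    (hf : ∀ x : Λ.carrier, (x : BiVec p k N) ∈ dual p k ω Λ.carrier → f x = 0) (x : Λ.carrier) :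
    Omega0.lift Λ f hf (Omega0.mk Λ x) = f x := rfl

theorem p_nsmul_Omega0 (Λ : VertexLattice p k ω) (x : Omega0 Λ) : p • x = 0 := by
  obtain ⟨x, rfl⟩ := Omega0.mk_surjective Λ x
  rw [← map_nsmul, Omega0.mk_eq_zero]
  have := Λ.p_smul_mem_dual x x.2
  rw [Nat.cast_smul_eq_nsmul] at this
  exact this

/-- `Ω₀` as a vector space over `𝔽_p`. -/
instance (Λ : VertexLattice p k ω) : Module (ZMod p) (Omega0 Λ) :=
  AddCommGroup.zmodModule (p_nsmul_Omega0 Λ)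

/-- The type of a vertex lattice, `dim_{𝔽_p} (Λ / Λ^∨)`. -/
def VertexLattice.type (Λ : VertexLattice p k ω) : ℕ := Module.finrank (ZMod p) (Omega0 Λ)

theorem p_mul_pairing_mem (Λ : VertexLattice p k ω) (x y : Λ.carrier) :
    (p : WQ p k) * pairing p k ω x y ∈ integers p k := by
  have := (Λ.p_smul_mem_dual x x.2).2 y y.2
  rwa [zp_smul_def, map_natCast, map_smul, LinearMap.smul_apply, smul_eq_mul] at this

/-- The map `(x, y) ↦ p [x, y] mod p` on `Λ`. -/
def preForm (Λ : VertexLattice p k ω) : Λ.carrier →+ Λ.carrier →+ k :=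
  AddMonoidHom.mk' (fun x => AddMonoidHom.mk'
      (fun y => reduction p k ⟨(p : WQ p k) * pairing p k ω x y, p_mul_pairing_mem Λ x y⟩)
      (fun y y' => by
        rw [← map_add]; congr 1; apply Subtype.ext; simp [mul_add]))
    (fun x x' => by
      ext y
      simp only [AddMonoidHom.mk'_apply, AddMonoidHom.add_apply]
      rw [← map_add]; congr 1; apply Subtype.ext; simp [mul_add])

/-- The form `[[x], [y]]_Λ = p [x, y] mod p` on `Ω₀`. -/
def form0 (Λ : VertexLattice p k ω) : Omega0 Λ →+ Omega0 Λ →+ k :=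
  Omega0.lift Λ
    (AddMonoidHom.mk' (fun x => Omega0.lift Λ (preForm Λ x) (fun y hy => by
        refine reduction_p_mul p k _ ?_ _
        rw [pairing_comm]
        exact hy.2 x x.2))
      (fun x x' => by
        refine AddMonoidHom.ext fun y => ?_
        obtain ⟨y, rfl⟩ := Omega0.mk_surjective Λ y
        simp only [Omega0.lift_mk, map_add]
        rfl))
    (fun x hx => by
      refine AddMonoidHom.ext fun y => ?_
      obtain ⟨y, rfl⟩ := Omega0.mk_surjective Λ y
      exact reduction_p_mul p k _ (hx.2 y y.2) _)

theorem form0_mk (Λ : VertexLattice p k ω) (x y : Λ.carrier) :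
    form0 Λ (Omega0.mk Λ x) (Omega0.mk Λ y) =
      reduction p k ⟨(p : WQ p k) * pairing p k ω x y, p_mul_pairing_mem Λ x y⟩ := rfl

variable [Algebra (ZMod p) k]

/-- `Ω = Ω₀ ⊗ k` over `𝔽_p`. -/
abbrev Omega (Λ : VertexLattice p k ω) : Type (max u v) := k ⊗[ZMod p] Omega0 Λ

/-- The `k`-bilinear form `[·, ·]_Λ` on `Ω`. -/
def form (Λ : VertexLattice p k ω) : LinearMap.BilinForm k (Omega Λ) :=
  extForm (p := p) (form0 Λ)

/-- The Frobenius operator `Φ` on `Ω`. -/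
def frobOmega (Λ : VertexLattice p k ω) : Omega Λ →ₛₗ[frobenius k p] Omega Λ :=
  extFrob (p := p) k (Omega0 Λ)

end Isocrystal

/-! ### Orthogonal Grassmannians and the Deligne–Lusztig variety -/

section Grassmannian

variable {k : Type u} [Field k] {Om : Type v} [AddCommGroup Om] [Module k Om]

/-- `R`-points of the orthogonal Grassmannian `OGr(Ω)(r)`: totally isotropic direct summands of
rank `r` of `R ⊗ Ω`. -/
structure IsIsotropicSummand (B : LinearMap.BilinForm k Om) (r : ℕ) (R : Type u) [CommRing R]
    [Algebra k R] (L : Submodule R (R ⊗[k] Om)) : Prop where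
  isotropic : ∀ x ∈ L, ∀ y ∈ L, B.baseChange R x y = 0
  summand : ∃ C : Submodule R (R ⊗[k] Om), IsCompl L C
  rank : ∀ q : PrimeSpectrum R, Module.rankAtStalk (R := R) L q = r

/-- The submodule of `S ⊗ Ω` generated by the image of a submodule of `R ⊗ Ω`. -/
def extend {R S : Type u} [CommRing R] [Algebra k R] [CommRing S] [Algebra k S] (f : R →ₐ[k] S)
    (L : Submodule R (R ⊗[k] Om)) : Submodule S (S ⊗[k] Om) :=
  Submodule.span S (TensorProduct.map f.toLinearMap (LinearMap.id : Om →ₗ[k] Om) '' L)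

/-- `Spec R` as a `k`-scheme. -/
def specOver (k : Type u) [Field k] (R : Type u) [CommRing R] [Algebra k R] :
    Over (Spec (CommRingCat.of k)) :=
  Over.mk (Spec.map (CommRingCat.ofHom (algebraMap k R)))

/-- `Spec` of a homomorphism of `k`-algebras. -/
def specOverMap {R S : Type u} [CommRing R] [Algebra k R] [CommRing S] [Algebra k S]
    (f : R →ₐ[k] S) : specOver k S ⟶ specOver k R :=
  Over.homMk (Spec.map (CommRingCat.ofHom f.toRingHom)) (by
    simp only [specOver, Over.mk_hom, ← Spec.map_comp, ← CommRingCat.ofHom_comp]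
    congr 2
    exact f.comp_algebraMap)

/-- The orthogonal Grassmannian `OGr(Ω)(r)`: a `k`-scheme whose `R`-points are, functorially in the
`k`-algebra `R`, the totally isotropic rank `r` direct summands of `R ⊗ Ω`. (Since both sides are
Zariski sheaves, this determines the points with values in all `k`-schemes, and it determines the
scheme up to unique isomorphism.) -/
structure OrthogonalGrassmannian (B : LinearMap.BilinForm k Om) (r : ℕ) where
  X : Over (Spec (CommRingCat.of k))
  points : ∀ (R : Type u) [CommRing R] [Algebra k R],
    (specOver k R ⟶ X) ≃ {L : Submodule R (R ⊗[k] Om) // IsIsotropicSummand B r R L}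
  points_comp : ∀ (R S : Type u) [CommRing R] [Algebra k R] [CommRing S] [Algebra k S]
    (f : R →ₐ[k] S) (g : specOver k R ⟶ X),
    (points S (specOverMap f ≫ g)).1 = extend f (points R g).1

variable (p : ℕ) [Fact p.Prime] [CharP k p]

/-- The Frobenius operator `a ⊗ x ↦ a ^ p ⊗ Φ x` of `k' ⊗ Ω`. -/
def frobExt (Φ : Om →ₛₗ[frobenius k p] Om) (k' : Type u) [Field k'] [Algebra k k'] :
    k' ⊗[k] Om →+ k' ⊗[k] Om :=
  haveI : CharP k' p := charP_of_injective_algebraMap (algebraMap k k').injective p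
  TensorProduct.liftAddHom
    (AddMonoidHom.mk' (fun a => AddMonoidHom.mk' (fun x => (a ^ p) ⊗ₜ[k] Φ x)
        (fun x y => by rw [map_add, TensorProduct.tmul_add]))
      (fun a b => by ext x; simp [add_pow_char, TensorProduct.add_tmul]))
    (fun c a x => by
      simp [Algebra.smul_def, mul_pow, TensorProduct.tmul_smul, TensorProduct.smul_tmul',
        frobenius_def])

theorem frobExt_tmul (Φ : Om →ₛₗ[frobenius k p] Om) (k' : Type u) [Field k'] [Algebra k k']
    (a : k') (x : Om) : frobExt p Φ k' (a ⊗ₜ x) = (a ^ p) ⊗ₜ Φ x := rfl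

/-- The subspace `Φ̄(L)` generated by `Φ(L)`. -/
def phiBar (Φ : Om →ₛₗ[frobenius k p] Om) (k' : Type u) [Field k'] [Algebra k k']
    (L : Submodule k' (k' ⊗[k] Om)) : Submodule k' (k' ⊗[k] Om) :=
  Submodule.span k' (frobExt p Φ k' '' L)

variable (B : LinearMap.BilinForm k Om) (Φ : Om →ₛₗ[frobenius k p] Om) (d : ℕ)

/-- Flags `ℓ ⊂ P` of totally isotropic subspaces of `Ω` of dimensions `d - 1` and `d`. -/
structure IsotropicFlag where
  small : Submodule k Om
  big : Submodule k Om
  small_le : small ≤ big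
  finrank_small : Module.finrank k small = d - 1
  finrank_big : Module.finrank k big = d
  isotropic : ∀ x ∈ big, ∀ y ∈ big, B x y = 0

variable {d} in
/-- `g` is an orthogonal transformation of determinant `1` of `k' ⊗ Ω`. -/
def IsSpecialOrthogonal (k' : Type u) [Field k'] [Algebra k k']
    (g : (k' ⊗[k] Om) ≃ₗ[k'] (k' ⊗[k] Om)) : Prop :=
  (∀ x y, B.baseChange k' (g x) (g y) = B.baseChange k' x y) ∧
    LinearMap.det (g : (k' ⊗[k] Om) →ₗ[k'] (k' ⊗[k] Om)) = 1

variable {B d} in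
/-- Over the field `k'`, the flag `F` is carried to the flag `ℓ ⊂ P` by an orthogonal
transformation of determinant `1`. -/
def IsotropicFlag.CarriedTo (F : IsotropicFlag B d) (k' : Type u) [Field k'] [Algebra k k']
    (l P : Submodule k' (k' ⊗[k] Om)) : Prop :=
  ∃ g : (k' ⊗[k] Om) ≃ₗ[k'] (k' ⊗[k] Om), IsSpecialOrthogonal B k' g ∧
    (F.small.baseChange k').map (g : (k' ⊗[k] Om) →ₗ[k'] (k' ⊗[k] Om)) = l ∧
    (F.big.baseChange k').map (g : (k' ⊗[k] Om) →ₗ[k'] (k' ⊗[k] Om)) = P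

/-- The set of components of `OGr(Ω)(d - 1, d)`: two flags are in the same component if and only if
an orthogonal transformation of determinant `1` carries the first to the second. -/
def FlagComponent : Type _ :=
  Quot (fun F G : IsotropicFlag B d =>
    F.CarriedTo k (G.small.baseChange k) (G.big.baseChange k))

/-- The Deligne–Lusztig condition `dim (L + Φ̄ L) = d + 1`. -/
def DLCondition (k' : Type u) [Field k'] [Algebra k k'] (L : Submodule k' (k' ⊗[k] Om)) : Prop :=
  Module.finrank k' (L ⊔ phiBar p Φ k' L : Submodule k' (k' ⊗[k] Om)) = d + 1

variable {B d}

/-- The points of `OGr(Ω)(d)` underlying `X_Λ`: those that lie under a `k'`-point `L`, for some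
field `k'` over `k`, with `dim (L + Φ̄ L) = d + 1`. -/
def dlLocus (Y : OrthogonalGrassmannian B d) : Set Y.X.left :=
  {z | ∃ (k' : Type u) (_ : Field k') (_ : Algebra k k') (x : specOver k k' ⟶ Y.X),
    z ∈ Set.range x.left ∧ DLCondition p Φ d k' (Y.points k' x).1}

/-- The points underlying the part of `X_Λ` that belongs to a component `c` of `OGr(Ω)(d - 1, d)`:
those `L` for which the flag `L ∩ Φ̄ L ⊂ L` lies in `c`. -/
def dlComponentLocus (Y : OrthogonalGrassmannian B d) (c : FlagComponent B d) : Set Y.X.left :=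
  {z | ∃ (k' : Type u) (_ : Field k') (_ : Algebra k k') (x : specOver k k' ⟶ Y.X),
    z ∈ Set.range x.left ∧ DLCondition p Φ d k' (Y.points k' x).1 ∧
    ∃ F : IsotropicFlag B d, Quot.mk _ F = c ∧
      F.CarriedTo k' ((Y.points k' x).1 ⊓ phiBar p Φ k' (Y.points k' x).1) (Y.points k' x).1}

/-- The reduced closed subscheme of a `k`-scheme on (the closure of) a set of points. -/
def reducedOn (X : Over (Spec (CommRingCat.of k))) (Z : Set X.left) :
    Over (Spec (CommRingCat.of k)) :=
  Over.mk ((Scheme.IdealSheafData.vanishingIdeal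
    (⟨closure Z, isClosed_closure⟩ : TopologicalSpace.Closeds X.left)).subschemeι ≫ X.hom)

/-- The part `X_Λ^c` of `X_Λ` that belongs to the component `c`, as a reduced closed subscheme of
`OGr(Ω)(d)`. (An open and closed subscheme of the reduced scheme `X_Λ` is reduced, so it is the
reduced closed subscheme on its underlying set.) -/
def dlComponent (Y : OrthogonalGrassmannian B d) (c : FlagComponent B d) :
    Over (Spec (CommRingCat.of k)) :=
  reducedOn Y.X (dlComponentLocus p Φ Y c)

attribute [local instance] MvPolynomial.gradedAlgebra in
/-- The projective line over `k`. -/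
def projectiveLine (k : Type u) [Field k] : Over (Spec (CommRingCat.of k)) :=
  Over.mk (Proj.toSpecZero (MvPolynomial.homogeneousSubmodule (Fin 2) k) ≫
    Spec.map (CommRingCat.ofHom
      (algebraMap k (MvPolynomial.homogeneousSubmodule (Fin 2) k 0))))

end Grassmannian

end GLFour
end

/-! Over `k` the form on `Ω` is, up to a scalar, the polar form of the determinant on two by two
matrices. Its isotropic planes are therefore the lines on the quadric surface `P¹ × P¹`: there are
two rulings, each parametrised by a projective line. The arithmetic input is that Frobenius
exchanges the two rulings. Then `L` and `Φ̄ L` lie in opposite rulings for every isotropic plane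
`L`, two lines of opposite rulings meet in exactly one point, and `dim (L + Φ̄ L) = 3` holds without
exception. So `X_Λ` is the whole of `OGr(Ω)(2)`, the component of the flag `L ∩ Φ̄ L ⊂ L` records
only the ruling of `L`, and the two parts are the two projective lines
(`deligneLusztig_hyperbolic`).

Frobenius exchanges the rulings because `Ω₀` contains no isotropic plane over `𝔽_p`
(`IsSupersingularBasis.exists_zmodForm`). In coordinates with respect to the `e_i ∧ e_j`, the
quadratic form on `V^Φ` is, up to a scalar, `x₀ x₁ + f σ(f) - p d σ(d)`. The last two terms have no
nontrivial zero, since `t σ(t)` has even valuation (`mul_sigma_ne_p`), so `V^Φ` contains no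
isotropic plane (`IsSupersingularBasis.eq_smul_or_eq_smul`). An isotropic plane of `Ω₀` would lift
to one by Hensel's lemma (`exists_isotropic_pair_lift`). Hence `Ω₀` is a hyperbolic plane plus an
anisotropic plane; the isotropic lines of the latter are defined only after adjoining a square root
`δ` of a nonsquare, and Frobenius interchanges them because `δ ^ p = -δ`
(`exists_hyperbolic_basis`).

The identification of schemes goes through functors of points. The functor of isotropic planes and
that of `P¹ ⊔ P¹` are Zariski sheaves on `k`-algebras, each covered by four affine lines. The gluing
relation `ChartRel` is the same for both, so they are isomorphic (`ChartedSheaf.exists_equiv`), and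
natural bijections of points are isomorphisms of schemes (`exists_iso_of_points`). That an isotropic
summand of rank two lies locally in a chart follows from a Plücker relation and the invertibility of
`2` (`isIsotropicPlane_iff`). For flags, the maps `X ↦ A X Bᵀ` act transitively within a ruling, and
a determinant computation separates the rulings (`flagCarried_iff`). -/

noncomputable section

namespace GLFour

/-! ### Zariski sheaves on `k`-algebras that are covered by affine lines -/

section ChartedSheaf

universe w w'

variable {k : Type u} [Field k]

/-- The localization map `R → R_f` as a homomorphism of `k`-algebras. -/
abbrev locHom (k : Type u) [Field k] {R : Type u} [CommRing R] [Algebra k R] (f : R) :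
    R →ₐ[k] Localization.Away f :=
  IsScalarTower.toAlgHom k R (Localization.Away f)

theorem isUnit_locHom {R : Type u} [CommRing R] [Algebra k R] (f : R) :
    IsUnit (locHom k f f) :=
  IsLocalization.Away.algebraMap_isUnit f

theorem exists_comp_locHom_eq {R S : Type u} [CommRing R] [Algebra k R] [CommRing S] [Algebra k S]
    (φ : R →ₐ[k] S) (f : R) (h : IsUnit (φ f)) :
    ∃ ψ : Localization.Away f →ₐ[k] S, ψ.comp (locHom k f) = φ := by
  refine ⟨IsLocalization.liftAlgHom (M := Submonoid.powers f) (f := φ) ?_, ?_⟩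
  · rintro ⟨_, n, rfl⟩
    simpa using h.pow n
  · ext x
    simp

/-- A Zariski sheaf on the category of `k`-algebras that is covered by a family of affine lines. -/
structure ChartedSheaf (k : Type u) [Field k] (ι : Type) where
  obj : ∀ (R : Type u) [CommRing R] [Algebra k R], Type w
  map : ∀ {R S : Type u} [CommRing R] [Algebra k R] [CommRing S] [Algebra k S],
    (R →ₐ[k] S) → obj R → obj S
  map_comp : ∀ {R S T : Type u} [CommRing R] [Algebra k R] [CommRing S] [Algebra k S]
    [CommRing T] [Algebra k T] (φ : R →ₐ[k] S) (ψ : S →ₐ[k] T) (x : obj R),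
    map (ψ.comp φ) x = map ψ (map φ x)
  eq_of_locally : ∀ {R : Type u} [CommRing R] [Algebra k R] (s : Set R), Ideal.span s = ⊤ →
    ∀ x y : obj R, (∀ f ∈ s, map (locHom k f) x = map (locHom k f) y) → x = y
  exists_glue : ∀ {R : Type u} [CommRing R] [Algebra k R] (s : Set R), s.Finite → Ideal.span s = ⊤ →
    ∀ x : (∀ f : s, obj (Localization.Away f.1)),
    (∀ (f g : s) (S : Type u) [CommRing S] [Algebra k S] (a : Localization.Away f.1 →ₐ[k] S)
      (b : Localization.Away g.1 →ₐ[k] S), a.comp (locHom k f.1) = b.comp (locHom k g.1) →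
      map a (x f) = map b (x g)) →
    ∃ y : obj R, ∀ f : s, map (locHom k f.1) y = x f
  chart : ∀ {R : Type u} [CommRing R] [Algebra k R], ι → R → obj R
  map_chart : ∀ {R S : Type u} [CommRing R] [Algebra k R] [CommRing S] [Algebra k S]
    (φ : R →ₐ[k] S) (i : ι) (t : R), map φ (chart i t) = chart i (φ t)
  exists_chart : ∀ {R : Type u} [CommRing R] [Algebra k R] (x : obj R) (q : Ideal R), q.IsPrime →
    ∃ f ∉ q, ∃ (i : ι) (t : Localization.Away f), map (locHom k f) x = chart i t

namespace ChartedSheaf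

variable {ι : Type} (H : ChartedSheaf.{u, w} k ι) (H' : ChartedSheaf.{u, w'} k ι)

/-- Two sections are matched if they are locally given by the same points of the charts. -/
def Matched {R : Type u} [CommRing R] [Algebra k R] (x : H.obj R) (y : H'.obj R) : Prop :=
  ∃ s : Set R, Ideal.span s = ⊤ ∧ ∀ f ∈ s, ∀ (S : Type u) [CommRing S] [Algebra k S]
    (φ : R →ₐ[k] S), IsUnit (φ f) → ∃ (i : ι) (t : S),
      H.map φ x = H.chart i t ∧ H'.map φ y = H'.chart i t

variable {H H'}

theorem Matched.symm {R : Type u} [CommRing R] [Algebra k R] {x : H.obj R} {y : H'.obj R}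
    (h : Matched H H' x y) : Matched H' H y x := by
  obtain ⟨s, hs, h⟩ := h
  refine ⟨s, hs, fun f hf S _ _ φ hφ => ?_⟩
  obtain ⟨i, t, h1, h2⟩ := h f hf S φ hφ
  exact ⟨i, t, h2, h1⟩

/-- Base change is immediate because the local condition is imposed on all homomorphisms that invert
`f`, not on the localization alone: a homomorphism that inverts `φ f` composes with `φ` to one that
inverts `f`. -/
theorem Matched.map {R S : Type u} [CommRing R] [Algebra k R] [CommRing S] [Algebra k S]
    {x : H.obj R} {y : H'.obj R} (h : Matched H H' x y) (φ : R →ₐ[k] S) :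
    Matched H H' (H.map φ x) (H'.map φ y) := by
  obtain ⟨s, hs, h⟩ := h
  refine ⟨φ '' s, ?_, ?_⟩
  · have := congrArg (Ideal.map φ) hs
    rwa [Ideal.map_span, Ideal.map_top] at this
  · rintro _ ⟨f, hf, rfl⟩ T _ _ ψ hψ
    obtain ⟨i, t, h1, h2⟩ := h f hf T (ψ.comp φ) hψ
    exact ⟨i, t, by rw [← H.map_comp, h1], by rw [← H'.map_comp, h2]⟩

theorem matched_chart {R : Type u} [CommRing R] [Algebra k R] (i : ι) (t : R) :
    Matched H H' (H.chart i t) (H'.chart i t) :=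
  ⟨{1}, by simp, fun _ _ _ _ _ φ _ => ⟨i, φ t, H.map_chart φ i t, H'.map_chart φ i t⟩⟩

/-- On the common refinement by products `f * g`, both sections of `H'` are chart points whose
counterparts in `H` agree with `x`, so the gluing implication makes them equal. -/
theorem Matched.unique
    (hker : ∀ (R : Type u) [CommRing R] [Algebra k R] (i j : ι) (t s : R),
      H.chart i t = H.chart j s → H'.chart i t = H'.chart j s)
    {R : Type u} [CommRing R] [Algebra k R] {x : H.obj R} {y y' : H'.obj R}
    (h : Matched H H' x y) (h' : Matched H H' x y') : y = y' := by
  obtain ⟨s, hs, h⟩ := h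
  obtain ⟨s', hs', h'⟩ := h'
  refine H'.eq_of_locally {r | ∃ f ∈ s, ∃ g ∈ s', r = f * g} ?_ _ _ ?_
  · rw [← Ideal.one_eq_top, ← mul_one (1 : Ideal R)]
    nth_rw 1 [Ideal.one_eq_top, Ideal.one_eq_top, ← hs, ← hs', Ideal.span_mul_span]
    congr 1
    ext r
    simp [Set.mem_mul, eq_comm]
  · rintro _ ⟨f, hf, g, hg, rfl⟩
    have hu := isUnit_locHom (k := k) (f * g)
    rw [map_mul] at hu
    obtain ⟨i, t, h1, h2⟩ := h f hf _ (locHom k (f * g)) (isUnit_of_mul_isUnit_left hu)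
    obtain ⟨j, r, h3, h4⟩ := h' g hg _ (locHom k (f * g)) (isUnit_of_mul_isUnit_right hu)
    rw [h2, h4]
    exact hker _ _ _ _ _ (h1.symm.trans h3)

/-- The local chart coordinates of `x` are fed into the charts of `H'`. On overlaps they describe
the same section of `H`, and `hker` turns this into the gluing condition for `H'`. Since gluing is
only available for finite covers, a finite subcover is taken first. -/
theorem exists_matched
    (hker : ∀ (R : Type u) [CommRing R] [Algebra k R] (i j : ι) (t s : R),
      H.chart i t = H.chart j s → H'.chart i t = H'.chart j s)
    {R : Type u} [CommRing R] [Algebra k R] (x : H.obj R) : ∃ y : H'.obj R, Matched H H' x y := by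
  let s₀ : Set R := {f | ∃ (i : ι) (t : Localization.Away f), H.map (locHom k f) x = H.chart i t}
  have hs₀ : Ideal.span s₀ = ⊤ := by
    by_contra hne
    obtain ⟨m, hm, hle⟩ := Ideal.exists_le_maximal _ hne
    obtain ⟨f, hf, i, t, h⟩ := H.exists_chart x m hm.isPrime
    exact hf (hle (Ideal.subset_span ⟨i, t, h⟩))
  obtain ⟨s, hfin, hss, hs⟩ : ∃ s : Set R, s.Finite ∧ s ⊆ s₀ ∧ Ideal.span s = ⊤ := by
    obtain ⟨s, hss, hs⟩ := (Ideal.span_eq_top_iff_finite s₀).1 hs₀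
    exact ⟨s, s.finite_toSet, hss, hs⟩
  choose i t hit using fun f : s => hss f.2
  obtain ⟨y, hy⟩ := H'.exists_glue s hfin hs (fun f => H'.chart (i f) (t f)) (by
    intro f g S _ _ a b hab
    rw [H'.map_chart, H'.map_chart]
    apply hker
    rw [← H.map_chart, ← H.map_chart, ← hit, ← hit, ← H.map_comp, ← H.map_comp, hab])
  refine ⟨y, s, hs, fun f hf S _ _ φ hφ => ?_⟩
  obtain ⟨ψ, rfl⟩ := exists_comp_locHom_eq φ f hφ
  refine ⟨i ⟨f, hf⟩, ψ (t ⟨f, hf⟩), ?_, ?_⟩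
  · rw [H.map_comp, ← H.map_chart, ← hit]
  · rw [H'.map_comp, ← H'.map_chart, ← hy]

variable (H H') in
/-- Two sheaves are isomorphic if their charts are glued in the same way. -/
theorem exists_equiv
    (hker : ∀ (R : Type u) [CommRing R] [Algebra k R] (i j : ι) (t s : R),
      H.chart i t = H.chart j s ↔ H'.chart i t = H'.chart j s) :
    ∃ e : ∀ (R : Type u) [CommRing R] [Algebra k R], H.obj R ≃ H'.obj R,
      (∀ (R S : Type u) [CommRing R] [Algebra k R] [CommRing S] [Algebra k S] (φ : R →ₐ[k] S)
        (x : H.obj R), e S (H.map φ x) = H'.map φ (e R x)) ∧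
      ∀ (R : Type u) [CommRing R] [Algebra k R] (i : ι) (t : R),
        e R (H.chart i t) = H'.chart i t := by
  have k1 := fun (R : Type u) [CommRing R] [Algebra k R] (i j : ι) (t s : R) =>
    (hker R i j t s).1
  have k2 := fun (R : Type u) [CommRing R] [Algebra k R] (i j : ι) (t s : R) =>
    (hker R i j t s).2
  choose F hF using fun (R : Type u) [CommRing R] [Algebra k R] (x : H.obj R) =>
    exists_matched k1 x
  choose G hG using fun (R : Type u) [CommRing R] [Algebra k R] (x : H'.obj R) =>
    exists_matched k2 x
  refine ⟨fun R _ _ => ⟨F R, G R, fun x => (hG R _).unique k2 (hF R x).symm,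
    fun y => (hF R _).unique k1 (hG R y).symm⟩, fun R S _ _ _ _ φ x => ?_, fun R _ _ i t => ?_⟩
  · exact (hF S _).unique k1 ((hF R x).map φ)
  · exact (hF R _).unique k1 (matched_chart i t)

end ChartedSheaf

end ChartedSheaf

/-! ### Points of `k`-schemes with values in `k`-algebras -/

section AffinePoints

variable {k : Type u} [Field k]

theorem specOverMap_comp {R S T : Type u} [CommRing R] [Algebra k R] [CommRing S] [Algebra k S]
    [CommRing T] [Algebra k T] (φ : R →ₐ[k] S) (ψ : S →ₐ[k] T) :
    specOverMap (ψ.comp φ) = specOverMap ψ ≫ specOverMap φ := by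
  ext1
  exact Spec.map_comp (CommRingCat.ofHom φ.toRingHom) (CommRingCat.ofHom ψ.toRingHom)

theorem exists_specOverMap_eq {R S : Type u} [CommRing R] [Algebra k R] [CommRing S] [Algebra k S]
    (g : specOver k S ⟶ specOver k R) : ∃ φ : R →ₐ[k] S, g = specOverMap φ := by
  let h : CommRingCat.of R ⟶ CommRingCat.of S := Spec.preimage g.left
  have hg : Spec.map h = g.left := Spec.map_preimage g.left
  have hw : CommRingCat.ofHom (algebraMap k R) ≫ h = CommRingCat.ofHom (algebraMap k S) := by
    apply Spec.map_injective
    rw [Spec.map_comp, hg]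
    exact Over.w g
  refine ⟨⟨h.hom, fun r => congrArg (fun f => f.hom r) hw⟩, ?_⟩
  ext1
  exact hg.symm

theorem specOverMap_injective {R S : Type u} [CommRing R] [Algebra k R] [CommRing S] [Algebra k S]
    {φ ψ : R →ₐ[k] S} (h : specOverMap φ = specOverMap ψ) : φ = ψ := by
  have h1 : Spec.map (CommRingCat.ofHom φ.toRingHom) = Spec.map (CommRingCat.ofHom ψ.toRingHom) :=
    congrArg (fun g => g.left) h
  ext x
  exact congrArg (fun f => f.hom x) (Spec.map_injective h1)

/-- This turns the affine opens of a `k`-scheme into points with values in `k`-algebras: the algebra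
structure is read off from the structure morphism. -/
theorem exists_specOver_left_eq (Z : Over (Spec (CommRingCat.of k))) (A : CommRingCat.{u})
    (h : Spec A ⟶ Z.left) :
    ∃ (_ : Algebra k A) (g : specOver k A ⟶ Z), g.left = h := by
  let f : CommRingCat.of k ⟶ A := Spec.preimage (h ≫ Z.hom)
  let _ : Algebra k A := f.hom.toAlgebra
  exact ⟨inferInstance, Over.homMk h (Spec.map_preimage (h ≫ Z.hom)).symm, rfl⟩

theorem hom_ext_of_points {Z X : Over (Spec (CommRingCat.of k))} {a b : Z ⟶ X}
    (h : ∀ (R : Type u) [CommRing R] [Algebra k R] (g : specOver k R ⟶ Z), g ≫ a = g ≫ b) :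
    a = b := by
  ext1
  refine Z.left.affineOpenCover.openCover.hom_ext _ _ fun j => ?_
  obtain ⟨_, g, hg⟩ := exists_specOver_left_eq Z _ (Z.left.affineOpenCover.f j)
  have := congrArg (fun f => f.left) (h _ g)
  rw [Over.comp_left, Over.comp_left, hg] at this
  exact this

/-- A natural transformation on points with values in `k`-algebras is a morphism of schemes. -/
theorem exists_hom_of_points {X X' : Over (Spec (CommRingCat.of k))}
    (F : ∀ (R : Type u) [CommRing R] [Algebra k R], (specOver k R ⟶ X) → (specOver k R ⟶ X'))
    (hF : ∀ (R S : Type u) [CommRing R] [Algebra k R] [CommRing S] [Algebra k S] (φ : R →ₐ[k] S)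
      (x : specOver k R ⟶ X), F S (specOverMap φ ≫ x) = specOverMap φ ≫ F R x) :
    ∃ θ : X ⟶ X', ∀ (R : Type u) [CommRing R] [Algebra k R] (x : specOver k R ⟶ X),
      x ≫ θ = F R x := by
  have hF' : ∀ (R S : Type u) [CommRing R] [Algebra k R] [CommRing S] [Algebra k S]
      (φ : specOver k S ⟶ specOver k R) (x : specOver k R ⟶ X), F S (φ ≫ x) = φ ≫ F R x := by
    intro R S _ _ _ _ φ x
    obtain ⟨φ, rfl⟩ := exists_specOverMap_eq φ
    exact hF R S φ x
  let U := X.left.affineOpenCover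
  choose alg g hg using fun j => exists_specOver_left_eq X _ (U.f j)
  have hcompat : ∀ i j : U.I₀, Limits.pullback.fst (U.openCover.f i) (U.openCover.f j) ≫
      (F _ (g i)).left = Limits.pullback.snd (U.openCover.f i) (U.openCover.f j) ≫
      (F _ (g j)).left := by
    intro i j
    let Z : Over (Spec (CommRingCat.of k)) := Over.mk
      (Limits.pullback.fst (U.openCover.f i) (U.openCover.f j) ≫ (specOver k (U.X i)).hom)
    let a : Z ⟶ specOver k (U.X i) :=
      Over.homMk (Limits.pullback.fst (U.openCover.f i) (U.openCover.f j)) rfl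
    have hi := Over.w (g i)
    have hj := Over.w (g j)
    rw [hg] at hi hj
    let b : Z ⟶ specOver k (U.X j) :=
      Over.homMk (Limits.pullback.snd (U.openCover.f i) (U.openCover.f j)) (by
        simp only [Z, Over.mk_hom]
        rw [← hi, ← hj]
        exact (Limits.pullback.condition_assoc _).symm)
    have hab : a ≫ g i = b ≫ g j := by
      ext1
      simp only [Over.comp_left, hg]
      exact Limits.pullback.condition
    -- The overlap of two affine opens need not be affine, so the equality is tested on its points
    -- with values in algebras, where naturality of `F` applies.
    have : a ≫ F _ (g i) = b ≫ F _ (g j) := by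
      refine hom_ext_of_points fun R _ _ z => ?_
      rw [← Category.assoc, ← Category.assoc, ← hF', ← hF', Category.assoc, Category.assoc, hab]
    exact congrArg (fun f => f.left) this
  let θ₀ : X.left ⟶ X'.left := U.openCover.glueMorphisms (fun (j : U.I₀) => (F _ (g j)).left) hcompat
  have hθ₀ : ∀ j, U.f j ≫ θ₀ = (F _ (g j)).left := fun j =>
    U.openCover.ι_glueMorphisms _ hcompat j
  let θ : X ⟶ X' := Over.homMk θ₀ (by
    refine U.openCover.hom_ext _ _ fun (j : U.I₀) => ?_
    change U.f j ≫ _ = U.f j ≫ _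
    rw [← Category.assoc, hθ₀, ← hg]
    exact (Over.w (F _ (g j))).trans (Over.w (g j)).symm)
  have hθ : ∀ j, g j ≫ θ = F _ (g j) := fun j => by
    ext1
    simp only [Over.comp_left, hg]
    exact hθ₀ j
  refine ⟨θ, fun R _ _ x => ?_⟩
  ext1
  let V : (specOver k R).left.OpenCover := U.openCover.pullback₁ x.left
  refine V.hom_ext _ _ fun (j : U.I₀) => ?_
  let Z : Over (Spec (CommRingCat.of k)) := Over.mk
    (Limits.pullback.fst x.left (U.f j) ≫ (specOver k R).hom)
  let a : Z ⟶ specOver k R := Over.homMk (Limits.pullback.fst x.left (U.f j)) rfl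
  have hj := Over.w (g j)
  rw [hg] at hj
  let b : Z ⟶ specOver k (U.X j) := Over.homMk (Limits.pullback.snd x.left (U.f j)) (by
    simp only [Z, Over.mk_hom]
    rw [← hj]
    exact (Limits.pullback.condition_assoc X.hom).symm.trans
      (congrArg (fun f => Limits.pullback.fst x.left (U.f j) ≫ f) (Over.w x)))
  have hab : a ≫ x = b ≫ g j := by
    ext1
    simp only [Over.comp_left, hg]
    exact Limits.pullback.condition
  -- The same device as for the overlaps: the piece of `Spec R` that lies over one affine open of
  -- `X` is again tested on its points.
  have : a ≫ x ≫ θ = a ≫ F R x := by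
    refine hom_ext_of_points fun S _ _ z => ?_
    calc z ≫ a ≫ x ≫ θ = z ≫ (a ≫ x) ≫ θ := by simp only [Category.assoc]
      _ = (z ≫ b) ≫ g j ≫ θ := by rw [hab]; simp only [Category.assoc]
      _ = F S (z ≫ a ≫ x) := by rw [hθ, ← hF', hab]; simp only [Category.assoc]
      _ = z ≫ a ≫ F R x := by rw [← Category.assoc, hF', Category.assoc]
  exact congrArg (fun f => f.left) this

/-- Schemes with naturally isomorphic functors of points on `k`-algebras are isomorphic. -/
theorem exists_iso_of_points {X X' : Over (Spec (CommRingCat.of k))}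
    (F : ∀ (R : Type u) [CommRing R] [Algebra k R], (specOver k R ⟶ X) ≃ (specOver k R ⟶ X'))
    (hF : ∀ (R S : Type u) [CommRing R] [Algebra k R] [CommRing S] [Algebra k S] (φ : R →ₐ[k] S)
      (x : specOver k R ⟶ X), F S (specOverMap φ ≫ x) = specOverMap φ ≫ F R x) :
    ∃ θ : X ≅ X', ∀ (R : Type u) [CommRing R] [Algebra k R] (x : specOver k R ⟶ X),
      x ≫ θ.hom = F R x := by
  obtain ⟨θ, hθ⟩ := exists_hom_of_points (fun R _ _ => F R) hF
  obtain ⟨θ', hθ'⟩ := exists_hom_of_points (fun R _ _ => (F R).symm)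
    (fun R S _ _ _ _ φ x => by rw [Equiv.symm_apply_eq, hF, Equiv.apply_symm_apply])
  refine ⟨⟨θ, θ', hom_ext_of_points fun R _ _ x => ?_, hom_ext_of_points fun R _ _ x => ?_⟩, hθ⟩
  · rw [← Category.assoc, hθ, hθ']; simp
  · rw [← Category.assoc, hθ', hθ]; simp

/-- Two points that agree Zariski locally are equal. -/
theorem point_eq_of_locally {X : Over (Spec (CommRingCat.of k))} {R : Type u} [CommRing R]
    [Algebra k R] (s : Set R) (hs : Ideal.span s = ⊤) (x y : specOver k R ⟶ X)
    (h : ∀ f ∈ s, specOverMap (locHom k f) ≫ x = specOverMap (locHom k f) ≫ y) : x = y := by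
  ext1
  refine (Scheme.affineOpenCoverOfSpanRangeEqTop (R := CommRingCat.of R) (ι := s)
    (fun f => f.1) (by simpa using hs)).openCover.hom_ext _ _ fun f => ?_
  exact congrArg (fun g => g.left) (h f.1 f.2)

/-- Points can be glued Zariski locally. -/
theorem exists_point_of_locally {X : Over (Spec (CommRingCat.of k))} {R : Type u} [CommRing R]
    [Algebra k R] (s : Set R) (hs : Ideal.span s = ⊤)
    (x : ∀ f : s, specOver k (Localization.Away f.1) ⟶ X)
    (h : ∀ (f g : s) (S : Type u) [CommRing S] [Algebra k S] (a : Localization.Away f.1 →ₐ[k] S)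
      (b : Localization.Away g.1 →ₐ[k] S), a.comp (locHom k f.1) = b.comp (locHom k g.1) →
      specOverMap a ≫ x f = specOverMap b ≫ x g) :
    ∃ y : specOver k R ⟶ X, ∀ f : s, specOverMap (locHom k f.1) ≫ y = x f := by
  let U := Scheme.affineOpenCoverOfSpanRangeEqTop (R := CommRingCat.of R) (ι := s)
    (fun f => f.1) (by simpa using hs)
  have hcompat : ∀ i j : s, Limits.pullback.fst (U.openCover.f i) (U.openCover.f j) ≫
      (x i).left = Limits.pullback.snd (U.openCover.f i) (U.openCover.f j) ≫ (x j).left := by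
    intro i j
    let Z : Over (Spec (CommRingCat.of k)) := Over.mk
      (Limits.pullback.fst (U.openCover.f i) (U.openCover.f j) ≫
        (specOver k (Localization.Away i.1)).hom)
    let a : Z ⟶ specOver k (Localization.Away i.1) :=
      Over.homMk (Limits.pullback.fst (U.openCover.f i) (U.openCover.f j)) rfl
    let b : Z ⟶ specOver k (Localization.Away j.1) :=
      Over.homMk (Limits.pullback.snd (U.openCover.f i) (U.openCover.f j)) (by
        simp only [Z, Over.mk_hom]
        rw [← Over.w (specOverMap (locHom k i.1)), ← Over.w (specOverMap (locHom k j.1))]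
        exact (Limits.pullback.condition_assoc _).symm)
    have hab : a ≫ specOverMap (locHom k i.1) = b ≫ specOverMap (locHom k j.1) := by
      ext1
      exact Limits.pullback.condition
    have : a ≫ x i = b ≫ x j := by
      refine hom_ext_of_points fun S _ _ z => ?_
      rw [← Category.assoc, ← Category.assoc]
      obtain ⟨φ, hφ⟩ := exists_specOverMap_eq (z ≫ a)
      obtain ⟨ψ, hψ⟩ := exists_specOverMap_eq (z ≫ b)
      rw [hφ, hψ]
      refine h i j S φ ψ (specOverMap_injective ?_)
      rw [specOverMap_comp, specOverMap_comp, ← hφ, ← hψ, Category.assoc, Category.assoc, hab]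
    exact congrArg (fun f => f.left) this
  let y₀ : Spec (CommRingCat.of R) ⟶ X.left :=
    U.openCover.glueMorphisms (fun j => (x j).left) hcompat
  have hy₀ : ∀ j, U.f j ≫ y₀ = (x j).left := fun j => U.openCover.ι_glueMorphisms _ hcompat j
  refine ⟨Over.homMk y₀ ?_, fun f => ?_⟩
  · refine U.openCover.hom_ext _ _ fun (j : U.I₀) => ?_
    change U.f j ≫ y₀ ≫ X.hom = U.f j ≫ (specOver k R).hom
    rw [← Category.assoc, hy₀]
    exact (Over.w (x j)).trans (Over.w (specOverMap (locHom k j.1))).symm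
  · ext1
    exact hy₀ f

end AffinePoints

/-! ### The charts of the projective line -/

section ProjectiveLine

attribute [local instance] MvPolynomial.gradedAlgebra

open HomogeneousLocalization

/-! ### Homomorphisms from the degree zero part of a localization, and the points of `Proj` they
give. -/

section EvalAway

variable {A : Type u} [CommRing A] {σ : Type*} [SetLike σ A] [AddSubgroupClass σ A]
  (𝒜 : ℕ → σ) [GradedRing 𝒜] {R : Type u} [CommRing R]

/-- The homomorphism from the degree zero part of `A_f` given by a homomorphism from `A` that
inverts `f`. -/
def evalAway (f : A) (F : A →+* R) (h : IsUnit (F f)) : Away 𝒜 f →+* R :=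
  (IsLocalization.Away.lift (S := Localization.Away f) f h).comp
    (algebraMap (Away 𝒜 f) (Localization.Away f))

/-- As `F f` is a unit, this multiplied-out formula determines the value, and later computations
need no inverses. -/
theorem evalAway_mk_mul (f : A) (F : A →+* R) (h : IsUnit (F f)) {d : ℕ} (hf : f ∈ 𝒜 d) (n : ℕ)
    (x : A) (hx : x ∈ 𝒜 (n • d)) : evalAway 𝒜 f F h (Away.mk 𝒜 hf n x hx) * F f ^ n = F x := by
  have h1 : IsLocalization.Away.lift (S := Localization.Away f) f h
      (algebraMap A (Localization.Away f) (f ^ n)) = F (f ^ n) := by simp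
  rw [← map_pow, ← h1, evalAway, RingHom.comp_apply, HomogeneousLocalization.algebraMap_apply,
    Away.val_mk, ← map_mul, Localization.mk_eq_mk', IsLocalization.mk'_spec (M := Submonoid.powers f)
      (Localization.Away f) x ⟨f ^ n, n, rfl⟩]
  simp

theorem evalAway_comp_awayMap (f g : A) {x : A} (hx : x = f * g) {e : ℕ} (hg : g ∈ 𝒜 e)
    (F : A →+* R) (hf : IsUnit (F f)) (h : IsUnit (F x)) :
    (evalAway 𝒜 x F h).comp (awayMap 𝒜 hg hx) = evalAway 𝒜 f F hf := by
  ext a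
  simp only [evalAway, RingHom.comp_apply, HomogeneousLocalization.algebraMap_apply, val_awayMap]
  generalize a.val = b
  refine congrArg (fun φ : Localization.Away f →+* R => φ b)
    (IsLocalization.ringHom_ext (M := Submonoid.powers f)
      (j := (IsLocalization.Away.lift x h).comp (Localization.awayLift (algebraMap A _) f _))
      (k := IsLocalization.Away.lift f hf) ?_)
  ext y
  simp [Localization.awayLift]

theorem evalAway_fromZero (f : A) (F : A →+* R) (h : IsUnit (F f)) (a : 𝒜 0) :
    evalAway 𝒜 f F h (fromZeroRingHom 𝒜 _ a) = F a := by
  have : (fromZeroRingHom 𝒜 (Submonoid.powers f) a).val = algebraMap A _ (a : A) := by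
    exact Localization.mk_one_eq_algebraMap (a : A)
  rw [evalAway, RingHom.comp_apply, HomogeneousLocalization.algebraMap_apply, this]
  simp

theorem comp_evalAway {S : Type u} [CommRing S] (f : A) (F : A →+* R) (h : IsUnit (F f))
    (φ : R →+* S) (h' : IsUnit (φ.comp F f)) :
    φ.comp (evalAway 𝒜 f F h) = evalAway 𝒜 f (φ.comp F) h' := by
  rw [evalAway, evalAway, ← RingHom.comp_assoc]
  congr 1
  refine IsLocalization.ringHom_ext (M := Submonoid.powers f) ?_
  ext y
  simp

/-- The morphism to `Proj` given by a homomorphism that inverts a homogeneous element `f`. -/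
def specEval {f : A} {m : ℕ} (hf : f ∈ 𝒜 m) (hm : 0 < m) (F : A →+* R) (h : IsUnit (F f)) :
    Spec (CommRingCat.of R) ⟶ Proj 𝒜 :=
  Spec.map (CommRingCat.ofHom (evalAway 𝒜 f F h)) ≫ Proj.awayι 𝒜 f hf hm

/-- `D₊(fg)` is an open part of `D₊(f)`, so a point does not change when a further homogeneous
factor with unit value is inverted. -/
theorem specEval_mul {f g x : A} (hx : x = f * g) {m e : ℕ} (hf : f ∈ 𝒜 m) (hm : 0 < m)
    (hg : g ∈ 𝒜 e) (F : A →+* R) (h : IsUnit (F f)) (h' : IsUnit (F x)) (hxd : x ∈ 𝒜 (m + e))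
    (hme : 0 < m + e) : specEval 𝒜 hxd hme F h' = specEval 𝒜 hf hm F h := by
  rw [specEval, specEval, ← evalAway_comp_awayMap 𝒜 f g hx hg F h h', CommRingCat.ofHom_comp,
    Spec.map_comp, Category.assoc, Proj.SpecMap_awayMap_awayι]

theorem specEval_injective {f : A} {m : ℕ} {hf : f ∈ 𝒜 m} {hm : 0 < m} {F F' : A →+* R}
    {h : IsUnit (F f)} {h' : IsUnit (F' f)} (he : specEval 𝒜 hf hm F h = specEval 𝒜 hf hm F' h') :
    evalAway 𝒜 f F h = evalAway 𝒜 f F' h' := by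
  rw [specEval, specEval, cancel_mono] at he
  exact congrArg CommRingCat.Hom.hom (Spec.map_injective he)

/-- The intersection of `D₊(f)` and `D₊(g)` is `D₊(fg)`, so a point of both comes from a
homomorphism `γ` on the coordinate ring of the intersection. -/
theorem exists_evalAway_of_specEval_eq {f g x : A} (hx : x = f * g) {m e : ℕ} (hf : f ∈ 𝒜 m)
    (hm : 0 < m) (hg : g ∈ 𝒜 e) (he : 0 < e) (F G : A →+* R) (h : IsUnit (F f)) (h' : IsUnit (G g))
    (hFG : specEval 𝒜 hf hm F h = specEval 𝒜 hg he G h') :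
    ∃ γ : Away 𝒜 x →+* R, γ.comp (awayMap 𝒜 hg hx) = evalAway 𝒜 f F h ∧
      γ.comp (awayMap 𝒜 hf (hx.trans (mul_comm _ _))) = evalAway 𝒜 g G h' := by
  rw [specEval, specEval] at hFG
  let a : Spec (CommRingCat.of R) ⟶ Spec (CommRingCat.of (Away 𝒜 x)) :=
    Limits.pullback.lift _ _ hFG ≫ (Proj.pullbackAwayιIso 𝒜 hf hm hg he hx).hom
  refine ⟨(Spec.preimage a).hom, ?_, ?_⟩
  · have : a ≫ Spec.map (CommRingCat.ofHom (awayMap 𝒜 hg hx)) =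
        Spec.map (CommRingCat.ofHom (evalAway 𝒜 f F h)) := by
      rw [Category.assoc, Proj.pullbackAwayιIso_hom_SpecMap_awayMap_left,
        Limits.pullback.lift_fst]
    rw [← Spec.map_preimage a, ← Spec.map_comp] at this
    exact congrArg CommRingCat.Hom.hom (Spec.map_injective this)
  · have : a ≫ Spec.map (CommRingCat.ofHom (awayMap 𝒜 hf (hx.trans (mul_comm _ _)))) =
        Spec.map (CommRingCat.ofHom (evalAway 𝒜 g G h')) := by
      rw [Category.assoc, Proj.pullbackAwayιIso_hom_SpecMap_awayMap_right,
        Limits.pullback.lift_snd]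
    rw [← Spec.map_preimage a, ← Spec.map_comp] at this
    exact congrArg CommRingCat.Hom.hom (Spec.map_injective this)

end EvalAway

variable {k : Type u} [Field k]

/-- The grading of `k[X₀, X₁]`. -/
abbrev lineGrading (k : Type u) [Field k] : ℕ → Submodule k (MvPolynomial (Fin 2) k) :=
  MvPolynomial.homogeneousSubmodule (Fin 2) k

theorem X_mem_lineGrading (i : Fin 2) : (MvPolynomial.X i : MvPolynomial (Fin 2) k) ∈
    lineGrading k 1 :=
  MvPolynomial.isHomogeneous_X k i

theorem aeval_smul_of_isHomogeneous {R : Type u} [CommRing R] [Algebra k R] {n : ℕ}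
    {F : MvPolynomial (Fin 2) k} (hF : F.IsHomogeneous n) (c : R) (v : Fin 2 → R) :
    MvPolynomial.aeval (c • v) F = c ^ n * MvPolynomial.aeval v F := by
  rw [MvPolynomial.aeval_def, MvPolynomial.aeval_def, MvPolynomial.eval₂_eq,
    MvPolynomial.eval₂_eq, Finset.mul_sum]
  refine Finset.sum_congr rfl fun d hd => ?_
  have hdeg : ∑ i ∈ d.support, d i = n := by
    have := hF (MvPolynomial.mem_support_iff.1 hd)
    simpa [Finsupp.weight_apply, Finsupp.sum] using this
  simp only [Pi.smul_apply, smul_eq_mul, mul_pow, Finset.prod_mul_distrib,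
    Finset.prod_pow_eq_pow_sum, hdeg]
  ring

/-- The numerator and the denominator of a fraction of degree zero scale by the same power of `c`.
-/
theorem evalAway_smul {R : Type u} [CommRing R] [Algebra k R] {f : MvPolynomial (Fin 2) k} {d : ℕ}
    (hf : f ∈ lineGrading k d) (c : R) (hc : IsUnit c) (v : Fin 2 → R)
    (h : IsUnit ((MvPolynomial.aeval v : _ →ₐ[k] R).toRingHom f))
    (h' : IsUnit ((MvPolynomial.aeval (c • v) : _ →ₐ[k] R).toRingHom f)) :
    evalAway (lineGrading k) f (MvPolynomial.aeval (c • v) : _ →ₐ[k] R).toRingHom h' =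
      evalAway (lineGrading k) f (MvPolynomial.aeval v : _ →ₐ[k] R).toRingHom h := by
  ext a
  obtain ⟨n, x, hx, rfl⟩ := Away.mk_surjective (lineGrading k) hf a
  have h1 := evalAway_mk_mul (lineGrading k) f _ h hf n x hx
  have h2 := evalAway_mk_mul (lineGrading k) f _ h' hf n x hx
  have hu : IsUnit (c ^ (n * d)) := hc.pow _
  refine (h'.pow n).mul_left_injective ?_
  beta_reduce
  rw [h2]
  simp only [AlgHom.toRingHom_eq_coe, RingHom.coe_coe] at h1 ⊢
  rw [aeval_smul_of_isHomogeneous hx, aeval_smul_of_isHomogeneous hf, ← h1, mul_pow, ← pow_mul,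
    smul_eq_mul, mul_comm d n]
  ring

/-- The point of the line with one homogeneous coordinate `1` and the other `t`. -/
def linePoint {R : Type u} [CommRing R] (i : Fin 2) (t : R) : Fin 2 → R :=
  Function.update (fun _ => t) i 1

theorem isUnit_aeval_linePoint {R : Type u} [CommRing R] [Algebra k R] (i : Fin 2) (t : R) :
    IsUnit ((MvPolynomial.aeval (linePoint i t) : _ →ₐ[k] R).toRingHom (MvPolynomial.X i)) := by
  simp [linePoint]

/-- The homomorphism from the coordinate ring of a chart given by a point of the chart. -/
def evalChart {R : Type u} [CommRing R] [Algebra k R] (i : Fin 2) (t : R) :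
    Away (lineGrading k) (MvPolynomial.X i) →+* R :=
  evalAway (lineGrading k) (MvPolynomial.X i) _ (isUnit_aeval_linePoint (k := k) i t)

/-- The coordinate of a chart. -/
def chartCoord (k : Type u) [Field k] (i : Fin 2) : Away (lineGrading k) (MvPolynomial.X i) :=
  Away.mk (lineGrading k) (X_mem_lineGrading i) 1 (MvPolynomial.X (1 - i)) (X_mem_lineGrading _)

theorem one_sub_ne (i : Fin 2) : 1 - i ≠ i := by decide +revert

theorem eq_one_sub (i j : Fin 2) (h : j ≠ i) : j = 1 - i := by decide +revert

theorem evalChart_coord {R : Type u} [CommRing R] [Algebra k R] (i : Fin 2) (t : R) :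
    evalChart i t (chartCoord k i) = t := by
  have := evalAway_mk_mul (lineGrading k) (MvPolynomial.X i) _
    (isUnit_aeval_linePoint (k := k) i t) (X_mem_lineGrading i) 1 _ (X_mem_lineGrading (1 - i))
  rw [evalChart, chartCoord]
  simpa [linePoint, one_sub_ne] using this

theorem evalChart_algebraMap {R : Type u} [CommRing R] [Algebra k R] (i : Fin 2) (t : R) (c : k) :
    evalChart i t (fromZeroRingHom (lineGrading k) _ (algebraMap k (lineGrading k 0) c)) =
      algebraMap k R c := by
  rw [evalChart, evalAway_fromZero]
  change MvPolynomial.aeval _ (algebraMap k (MvPolynomial (Fin 2) k) c) = _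
  simp

theorem comp_evalChart {R S : Type u} [CommRing R] [Algebra k R] [CommRing S] [Algebra k S]
    (φ : R →ₐ[k] S) (i : Fin 2) (t : R) :
    (φ : R →+* S).comp (evalChart (k := k) i t) = evalChart i (φ t) := by
  have : (φ : R →+* S).comp (MvPolynomial.aeval (linePoint i t) : _ →ₐ[k] R).toRingHom =
      (MvPolynomial.aeval (linePoint i (φ t)) : _ →ₐ[k] S).toRingHom := by
    have h : φ.comp (MvPolynomial.aeval (linePoint i t)) =
        (MvPolynomial.aeval (linePoint i (φ t)) : _ →ₐ[k] S) := by
      ext j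
      by_cases hj : j = i
      · subst hj; simp [linePoint]
      · simp [linePoint, hj]
    exact congrArg AlgHom.toRingHom h
  rw [evalChart, comp_evalAway]
  · simp only [this]; rfl
  · rw [this]; exact isUnit_aeval_linePoint i _

theorem evalChart_bijective (i : Fin 2) :
    Function.Bijective (evalChart (k := k) i (Polynomial.X : Polynomial k)) := by
  constructor
  · let L := Localization.Away (MvPolynomial.X i : MvPolynomial (Fin 2) k)
    let t : L := (chartCoord k i).val
    -- Evaluation at `t = X_{1-i} / X_i` undoes the chart: multiplied by `X_i`, the point with
    -- coordinates `1` and `t` becomes the tautological point `(X₀, X₁)`. Hence the composite is the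
    -- inclusion of the degree zero part, which is injective.
    have key : (Polynomial.aeval t : Polynomial k →ₐ[k] L).toRingHom.comp
        (evalChart i Polynomial.X) =
        algebraMap (Away (lineGrading k) (MvPolynomial.X i)) L := by
      rw [AlgHom.toRingHom_eq_coe, comp_evalChart]
      have hu : IsUnit (algebraMap (MvPolynomial (Fin 2) k) L (MvPolynomial.X i)) :=
        IsLocalization.Away.algebraMap_isUnit _
      have hXt : algebraMap (MvPolynomial (Fin 2) k) L (MvPolynomial.X i) * t =
          algebraMap (MvPolynomial (Fin 2) k) L (MvPolynomial.X (1 - i)) := by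
        simp only [t, chartCoord, Away.val_mk]
        rw [Localization.mk_eq_mk', mul_comm]
        convert IsLocalization.mk'_spec (M := Submonoid.powers (MvPolynomial.X i :
          MvPolynomial (Fin 2) k)) L (MvPolynomial.X (1 - i)) ⟨MvPolynomial.X i ^ 1, 1, rfl⟩ using 3
        simp
      have hsm : algebraMap (MvPolynomial (Fin 2) k) L (MvPolynomial.X i) • linePoint i t =
          fun j => algebraMap (MvPolynomial (Fin 2) k) L (MvPolynomial.X j) := by
        funext j
        by_cases hj : j = i
        · subst hj; simp [linePoint]
        · have : j = 1 - i := eq_one_sub i j hj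
          subst this
          simpa [linePoint, one_sub_ne] using hXt
      have hal : (MvPolynomial.aeval fun j => algebraMap (MvPolynomial (Fin 2) k) L
          (MvPolynomial.X j) : _ →ₐ[k] L) = IsScalarTower.toAlgHom k _ L := by
        ext j; simp
      simp only [Polynomial.aeval_X]
      rw [evalChart, ← evalAway_smul (X_mem_lineGrading i) _ hu _ _
        (by rw [hsm, hal]; exact hu)]
      ext a
      obtain ⟨n, x, hx, rfl⟩ := Away.mk_surjective (lineGrading k) (X_mem_lineGrading i) a
      refine (hu.pow n).mul_left_injective ?_
      beta_reduce
      have h1 := evalAway_mk_mul (lineGrading k) (MvPolynomial.X i)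
        (MvPolynomial.aeval (algebraMap (MvPolynomial (Fin 2) k) L (MvPolynomial.X i) •
          linePoint i t) : _ →ₐ[k] L).toRingHom (by rw [hsm, hal]; exact hu)
        (X_mem_lineGrading i) n x hx
      simp only [hsm, hal] at h1 ⊢
      refine Eq.trans h1 ?_
      rw [HomogeneousLocalization.algebraMap_apply, Away.val_mk, Localization.mk_eq_mk', ← map_pow]
      exact (IsLocalization.mk'_spec (M := Submonoid.powers (MvPolynomial.X i :
          MvPolynomial (Fin 2) k)) L x ⟨MvPolynomial.X i ^ n, n, rfl⟩).symm
    have hinj : Function.Injective (algebraMap (Away (lineGrading k) (MvPolynomial.X i)) L) :=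
      val_injective _
    rw [← key] at hinj
    exact Function.Injective.of_comp (f := Polynomial.aeval t) hinj
  · intro q
    change q ∈ (evalChart (k := k) i (Polynomial.X : Polynomial k)).range
    induction q using Polynomial.induction_on' with
    | add a b ha hb => exact add_mem ha hb
    | monomial n c =>
      rw [← Polynomial.C_mul_X_pow_eq_monomial]
      exact mul_mem (RingHom.mem_range.2 ⟨_, evalChart_algebraMap i Polynomial.X c⟩)
        (pow_mem (RingHom.mem_range.2 ⟨_, evalChart_coord i Polynomial.X⟩) n)

end ProjectiveLine

/-! ### Points of the projective line -/

section ProjectiveLinePoints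

attribute [local instance] MvPolynomial.gradedAlgebra

open HomogeneousLocalization

variable {k : Type u} [Field k]

/-- The morphism to `Proj` given by the point with homogeneous coordinates `1` and `t`. -/
def lineChartHom {R : Type u} [CommRing R] [Algebra k R] (i : Fin 2) (t : R) :
    Spec (CommRingCat.of R) ⟶ Proj (lineGrading k) :=
  specEval (lineGrading k) (X_mem_lineGrading i) one_pos _ (isUnit_aeval_linePoint (k := k) i t)

theorem lineChartHom_toSpecZero {R : Type u} [CommRing R] [Algebra k R] (i : Fin 2) (t : R) :
    lineChartHom i t ≫ Proj.toSpecZero (lineGrading k) ≫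
        Spec.map (CommRingCat.ofHom (algebraMap k (lineGrading k 0))) =
      Spec.map (CommRingCat.ofHom (algebraMap k R)) := by
  rw [lineChartHom, specEval, Category.assoc, Proj.awayι_toSpecZero_assoc, ← Spec.map_comp,
    ← Spec.map_comp, ← CommRingCat.ofHom_comp, ← CommRingCat.ofHom_comp]
  congr 2
  ext c
  exact evalChart_algebraMap i t c

theorem specMap_comp_lineChartHom {R S : Type u} [CommRing R] [Algebra k R] [CommRing S]
    [Algebra k S] (φ : R →ₐ[k] S) (i : Fin 2) (t : R) :
    Spec.map (CommRingCat.ofHom (φ : R →+* S)) ≫ lineChartHom (k := k) i t =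
      lineChartHom i (φ t) := by
  rw [lineChartHom, specEval, ← Spec.map_comp_assoc, ← CommRingCat.ofHom_comp]
  have := comp_evalChart φ i t
  rw [evalChart] at this
  rw [this]
  rfl

theorem isIso_evalChart (i : Fin 2) :
    IsIso (CommRingCat.ofHom (evalChart (k := k) i (Polynomial.X : Polynomial k))) :=
  (ConcreteCategory.isIso_iff_bijective _).2 (evalChart_bijective i)

instance (i : Fin 2) :
    IsOpenImmersion (lineChartHom (k := k) i (Polynomial.X : Polynomial k)) := by
  have := isIso_evalChart (k := k) i
  change IsOpenImmersion (Spec.map (CommRingCat.ofHom (evalChart i Polynomial.X)) ≫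
    Proj.awayι _ _ _ _)
  infer_instance

theorem opensRange_lineChartHom (i : Fin 2) :
    (lineChartHom (k := k) i (Polynomial.X : Polynomial k)).opensRange =
      Proj.basicOpen (lineGrading k) (MvPolynomial.X i) := by
  have := isIso_evalChart (k := k) i
  exact (Scheme.Hom.opensRange_comp_of_isIso
    (Spec.map (CommRingCat.ofHom (evalChart i (Polynomial.X : Polynomial k)))) _).trans
    (Proj.opensRange_awayι (lineGrading k) (MvPolynomial.X i) (X_mem_lineGrading i) one_pos)

theorem iSup_opensRange_lineChartHom :
    ⨆ i, (lineChartHom (k := k) i (Polynomial.X : Polynomial k)).opensRange = ⊤ := by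
  simp only [opensRange_lineChartHom]
  refine Proj.iSup_basicOpen_eq_top' (lineGrading k)
    (fun i : Fin 2 => (MvPolynomial.X i : MvPolynomial (Fin 2) k))
    (fun i => ⟨1, X_mem_lineGrading i⟩) ?_
  rw [eq_top_iff]
  intro x _
  induction x using MvPolynomial.induction_on with
  | C a => exact Subalgebra.algebraMap_mem _ (algebraMap k (lineGrading k 0) a)
  | add p q hp hq => exact add_mem (hp trivial) (hq trivial)
  | mul_X p i hp => exact mul_mem (hp trivial) (Algebra.subset_adjoin ⟨i, rfl⟩)

theorem lineChartHom_injective {R : Type u} [CommRing R] [Algebra k R] {i : Fin 2} {t s : R}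
    (h : lineChartHom (k := k) i t = lineChartHom i s) : t = s := by
  have h2 := congrArg (fun f => f (chartCoord k i)) (specEval_injective (lineGrading k) h)
  exact (evalChart_coord (k := k) i t).symm.trans (h2.trans (evalChart_coord i s))

/-- The coordinate vectors `(1, t)` and `(s, 1)` differ by the unit `t`. Both points lie in `D₊(X₀
X₁)`, where they can be compared and where scaling has no effect. -/
theorem lineChartHom_eq_of_mul_eq_one {R : Type u} [CommRing R] [Algebra k R] {t s : R}
    (h : t * s = 1) : lineChartHom (k := k) 0 t = lineChartHom 1 s := by
  have hp : linePoint 0 t = t • linePoint 1 s := by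
    funext j
    fin_cases j <;> simp [linePoint, h]
  have ht : IsUnit t := IsUnit.of_mul_eq_one _ h
  have hs : IsUnit s := IsUnit.of_mul_eq_one _ ((mul_comm _ _).trans h)
  have hd : (MvPolynomial.X 0 * MvPolynomial.X 1 : MvPolynomial (Fin 2) k) ∈
      lineGrading k (1 + 1) := (MvPolynomial.isHomogeneous_X k 0).mul
        (MvPolynomial.isHomogeneous_X k 1)
  have hu : IsUnit ((MvPolynomial.aeval (linePoint 0 t) : _ →ₐ[k] R).toRingHom
      (MvPolynomial.X 0 * MvPolynomial.X 1)) := by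
    simpa [linePoint] using ht
  have hu' : IsUnit ((MvPolynomial.aeval (linePoint 1 s) : _ →ₐ[k] R).toRingHom
      (MvPolynomial.X 0 * MvPolynomial.X 1)) := by
    simpa [linePoint] using hs
  have h0 := specEval_mul (lineGrading k) rfl (X_mem_lineGrading 0) one_pos (X_mem_lineGrading 1) _
    (isUnit_aeval_linePoint 0 t) hu hd two_pos
  have h1 := specEval_mul (lineGrading k) (mul_comm _ _) (X_mem_lineGrading 1) one_pos
    (X_mem_lineGrading 0) _ (isUnit_aeval_linePoint 1 s) hu' hd two_pos
  have hc : evalAway (lineGrading k) (MvPolynomial.X 0 * MvPolynomial.X 1) _ hu =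
      evalAway (lineGrading k) (MvPolynomial.X 0 * MvPolynomial.X 1) _ hu' := by
    have := evalAway_smul hd t ht (linePoint 1 s) hu' (by rw [← hp]; exact hu)
    rw [← this]
    congr 1
    rw [hp]
  rw [lineChartHom, lineChartHom, ← h0, ← h1, specEval, specEval, hc]

/-- A common point of the two charts lies in `D₊(X₀ X₁)`, and there the coordinates `X₁ / X₀` and
`X₀ / X₁` are inverse to each other. -/
theorem mul_eq_one_of_lineChartHom_eq {R : Type u} [CommRing R] [Algebra k R] {t s : R}
    (h : lineChartHom (k := k) 0 t = lineChartHom 1 s) : t * s = 1 := by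
  obtain ⟨γ, h0, h1⟩ := exists_evalAway_of_specEval_eq (lineGrading k) rfl
    (X_mem_lineGrading 0) one_pos (X_mem_lineGrading 1) one_pos _ _ _ _ h
  have e0 := congrArg (fun f => f (chartCoord k 0)) h0
  have e1 := congrArg (fun f => f (chartCoord k 1)) h1
  have hmul : awayMap (lineGrading k) (X_mem_lineGrading (k := k) 1) rfl (chartCoord k 0) *
      awayMap (lineGrading k) (X_mem_lineGrading (k := k) 0) (mul_comm _ _) (chartCoord k 1) =
        1 := by
    rw [chartCoord, chartCoord, awayMap_mk, awayMap_mk]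
    apply val_injective
    rw [val_mul, val_one, Away.val_mk, Away.val_mk, Localization.mk_mul,
      ← Localization.mk_one, Localization.mk_eq_mk_iff, Localization.r_iff_exists]
    refine ⟨1, ?_⟩
    simp
    ring
  have e0' := e0.trans (evalChart_coord (k := k) 0 t)
  have e1' := e1.trans (evalChart_coord (k := k) 1 s)
  rw [← e0', ← e1']
  simp only [RingHom.comp_apply]
  rw [← map_mul, hmul, map_one]

/-- The point of the projective line with homogeneous coordinates `1` and `t`. -/
def lineChart {R : Type u} [CommRing R] [Algebra k R] (i : Fin 2) (t : R) :
    specOver k R ⟶ projectiveLine k :=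
  Over.homMk (lineChartHom i t) (lineChartHom_toSpecZero i t)

theorem specOverMap_comp_lineChart {R S : Type u} [CommRing R] [Algebra k R] [CommRing S]
    [Algebra k S] (φ : R →ₐ[k] S) (i : Fin 2) (t : R) :
    specOverMap φ ≫ lineChart i t = lineChart i (φ t) := by
  ext1
  exact specMap_comp_lineChartHom φ i t

theorem isOpenImmersion_lineChart (i : Fin 2) :
    IsOpenImmersion (lineChart (k := k) i (Polynomial.X : Polynomial k)).left :=
  inferInstanceAs (IsOpenImmersion (lineChartHom (k := k) i (Polynomial.X : Polynomial k)))

theorem exists_mem_range_lineChart (z : (projectiveLine k).left) :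
    ∃ i : Fin 2, z ∈ Set.range (lineChart (k := k) i (Polynomial.X : Polynomial k)).left := by
  have hz : (z : Proj (lineGrading k)) ∈ (⊤ : (Proj (lineGrading k)).Opens) := trivial
  rw [← iSup_opensRange_lineChartHom] at hz
  exact TopologicalSpace.Opens.mem_iSup.1 hz

theorem lineChart_eq_iff {R : Type u} [CommRing R] [Algebra k R] {i j : Fin 2} {t s : R} :
    lineChart (k := k) i t = lineChart j s ↔ if i = j then t = s else t * s = 1 := by
  have : lineChart (k := k) i t = lineChart j s ↔ lineChartHom (k := k) i t = lineChartHom j s :=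
    ⟨fun h => congrArg (fun f => f.left) h, fun h => by ext1; exact h⟩
  rw [this]
  split_ifs with hij
  · subst hij
    exact ⟨lineChartHom_injective, fun h => by rw [h]⟩
  · obtain rfl : j = 1 - i := eq_one_sub i j (Ne.symm hij)
    fin_cases i
    · exact ⟨mul_eq_one_of_lineChartHom_eq, lineChartHom_eq_of_mul_eq_one⟩
    · rw [eq_comm, mul_comm]
      exact ⟨mul_eq_one_of_lineChartHom_eq, lineChartHom_eq_of_mul_eq_one⟩

instance : IsReduced (Proj (lineGrading k)) := by
  have (z : Proj (lineGrading k)) : _root_.IsReduced ((Proj (lineGrading k)).presheaf.stalk z) := by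
    have hz : z ∈ (⊤ : (Proj (lineGrading k)).Opens) := trivial
    rw [← iSup_opensRange_lineChartHom] at hz
    obtain ⟨i, y, rfl⟩ := TopologicalSpace.Opens.mem_iSup.1 hz
    have : IsReduced (Spec (CommRingCat.of (Polynomial k))) := inferInstance
    exact isReduced_of_injective
      ((lineChartHom (k := k) i (Polynomial.X : Polynomial k)).stalkMap y).hom
      (ConcreteCategory.bijective_of_isIso _).1
  exact isReduced_of_isReduced_stalk _

instance : IsReduced (projectiveLine k).left :=
  inferInstanceAs (IsReduced (Proj (lineGrading k)))

end ProjectiveLinePoints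

/-! ### Schemes covered by affine lines, and the disjoint union of two projective lines -/

section TwoLines

variable {k : Type u} [Field k]

/-- The sheaf of points of a scheme that is covered by affine lines. -/
def ChartedSheaf.ofScheme (X : Over (Spec (CommRingCat.of k))) {ι : Type}
    (c : ι → (specOver k (Polynomial k) ⟶ X)) (hc : ∀ i, IsOpenImmersion (c i).left)
    (hcov : ∀ z : X.left, ∃ i, z ∈ Set.range (c i).left) : ChartedSheaf.{u, u} k ι where
  obj R _ _ := specOver k R ⟶ X
  map φ x := specOverMap φ ≫ x
  map_comp φ ψ x := by rw [specOverMap_comp, Category.assoc]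
  eq_of_locally s hs x y h := point_eq_of_locally s hs x y h
  exists_glue s _ hs x h := exists_point_of_locally s hs x h
  chart i t := specOverMap (Polynomial.aeval t) ≫ c i
  map_chart φ i t := by
    rw [← Category.assoc, ← specOverMap_comp]
    congr 2
    ext
    simp
  exists_chart {R} _ _ x q hq := by
    let z : PrimeSpectrum R := ⟨q, hq⟩
    obtain ⟨i, hi⟩ := hcov (x.left z)
    have := hc i
    -- A basic open neighbourhood of `q` is mapped into a single chart; over it the point lifts
    -- through the open immersion and is given by one element, the image of the polynomial variable.
    let U : Set (PrimeSpectrum R) := x.left ⁻¹' Set.range (c i).left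
    have hU : IsOpen U := (c i).left.isOpenEmbedding.isOpen_range.preimage x.left.continuous
    obtain ⟨_, ⟨f, rfl⟩, hzf, hfU⟩ :=
      PrimeSpectrum.isTopologicalBasis_basic_opens.exists_subset_of_mem_open
        (show z ∈ U from hi) hU
    let g := specOverMap (locHom k f) ≫ x
    have hg : Set.range g.left ⊆ Set.range (c i).left := by
      rintro _ ⟨y, rfl⟩
      have hy : (specOverMap (locHom k f)).left y ∈ U := by
        apply hfU
        have := PrimeSpectrum.localization_away_comap_range (Localization.Away f) f
        exact (this ▸ Set.mem_range_self _ :)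
      exact hy
    let l : specOver k (Localization.Away f) ⟶ specOver k (Polynomial k) :=
      Over.homMk (IsOpenImmersion.lift (c i).left g.left hg) (by
        rw [← Over.w (c i), IsOpenImmersion.lift_fac_assoc, Over.w])
    have hl : l ≫ c i = g := by
      ext1
      exact IsOpenImmersion.lift_fac _ _ _
    obtain ⟨φ, hφ⟩ := exists_specOverMap_eq l
    refine ⟨f, hzf, i, φ Polynomial.X, ?_⟩
    change g = _
    rw [← hl, hφ]
    congr 2
    ext
    simp

variable (k) in
/-- The disjoint union of two projective lines. -/
def twoLines : Over (Spec (CommRingCat.of k)) :=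
  Over.mk (Limits.Sigma.desc (fun _ : Bool => (projectiveLine k).hom))

variable (k) in
/-- The inclusions of the two projective lines in their disjoint union. -/
def lineIncl (ε : Bool) : projectiveLine k ⟶ twoLines k :=
  Over.homMk (Limits.Sigma.ι (fun _ : Bool => (projectiveLine k).left) ε)
    (Limits.Sigma.ι_desc _ _)

instance (ε : Bool) : IsOpenImmersion (lineIncl k ε).left :=
  inferInstanceAs (IsOpenImmersion (Limits.Sigma.ι (fun _ : Bool => (projectiveLine k).left) ε))

theorem exists_mem_range_lineIncl (z : (twoLines k).left) :
    ∃ ε, z ∈ Set.range (lineIncl k ε).left := by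
  obtain ⟨ε, y, h⟩ := (sigmaOpenCover fun _ : Bool => (projectiveLine k).left).exists_eq z
  exact ⟨ε, y, h⟩

theorem disjoint_range_lineIncl {ε δ : Bool} (h : ε ≠ δ) :
    Disjoint (Set.range (lineIncl k ε).left) (Set.range (lineIncl k δ).left) := by
  rw [Set.disjoint_left]
  rintro _ ⟨y, rfl⟩ ⟨y', h'⟩
  have := (sigmaι_eq_iff (fun _ : Bool => (projectiveLine k).left) δ ε y' y).1 h'
  exact h (congrArg Sigma.fst this).symm

variable (k) in
/-- The charts of the disjoint union of two projective lines. -/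
def twoLinesChart (i : Bool × Fin 2) : specOver k (Polynomial k) ⟶ twoLines k :=
  lineChart i.2 Polynomial.X ≫ lineIncl k i.1

theorem specOverMap_aeval_twoLinesChart {R : Type u} [CommRing R] [Algebra k R] (i : Bool × Fin 2)
    (t : R) : specOverMap (Polynomial.aeval t) ≫ twoLinesChart k i =
      lineChart i.2 t ≫ lineIncl k i.1 := by
  rw [twoLinesChart, ← Category.assoc, specOverMap_comp_lineChart, Polynomial.aeval_X]

variable (k) in
/-- The sheaf of points of the disjoint union of two projective lines. -/
def twoLinesSheaf : ChartedSheaf.{u, u} k (Bool × Fin 2) :=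
  ChartedSheaf.ofScheme (twoLines k) (twoLinesChart k)
    (fun i => by
      have := isOpenImmersion_lineChart (k := k) i.2
      rw [twoLinesChart, Over.comp_left]
      infer_instance)
    (fun z => by
      obtain ⟨ε, y, rfl⟩ := exists_mem_range_lineIncl z
      obtain ⟨i, w, rfl⟩ := exists_mem_range_lineChart y
      exact ⟨(ε, i), w, by simp [twoLinesChart]⟩)

/-- The gluing relation between points of the four charts of two projective lines. -/
def ChartRel {R : Type u} [CommRing R] (i j : Bool × Fin 2) (t s : R) : Prop :=
  if i.1 = j.1 then (if i.2 = j.2 then t = s else t * s = 1) else Subsingleton R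

/-- Points of different lines disagree at every prime of `R`, so they are equal only when there are
no primes. Over the zero ring all points agree, which explains the last branch of `ChartRel`. -/
theorem twoLinesSheaf_chart_eq_iff {R : Type u} [CommRing R] [Algebra k R] (i j : Bool × Fin 2)
    (t s : R) :
    (twoLinesSheaf k).chart i t = (twoLinesSheaf k).chart j s ↔ ChartRel i j t s := by
  change specOverMap (Polynomial.aeval t) ≫ twoLinesChart k i =
    specOverMap (Polynomial.aeval s) ≫ twoLinesChart k j ↔ _
  rw [specOverMap_aeval_twoLinesChart, specOverMap_aeval_twoLinesChart, ChartRel]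
  obtain ⟨ε, i⟩ := i
  obtain ⟨δ, j⟩ := j
  dsimp only
  have h : ∀ a b : specOver k R ⟶ projectiveLine k,
      a ≫ lineIncl k ε = b ≫ lineIncl k ε ↔ a = b := fun a b =>
    ⟨fun h => by
      ext1
      have := congrArg (fun f => f.left) h
      simpa [cancel_mono] using this, fun h => by rw [h]⟩
  split_ifs with hε hi
  · subst hε hi
    rw [h, lineChart_eq_iff, if_pos rfl]
  · subst hε
    rw [h, lineChart_eq_iff, if_neg hi]
  · constructor
    · intro h
      by_contra hR
      rw [not_subsingleton_iff_nontrivial] at hR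
      obtain ⟨z⟩ : Nonempty (PrimeSpectrum R) := inferInstance
      have h1 : (lineIncl k ε).left ((lineChart (k := k) i t).left z) =
          (lineIncl k δ).left ((lineChart (k := k) j s).left z) := by
        exact congrArg (fun f : specOver k R ⟶ twoLines k => f.left z) h
      exact Set.disjoint_left.1 (disjoint_range_lineIncl hε) ⟨_, h1⟩ ⟨_, rfl⟩
    · intro hR
      ext1
      have : IsEmpty (specOver k R).left := inferInstanceAs (IsEmpty (PrimeSpectrum R))
      exact (isInitialOfIsEmpty (X := (specOver k R).left)).hom_ext _ _

end TwoLines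

/-! ### Families of isotropic planes in coordinates -/

section Coordinates

variable {R S T : Type u} [CommRing R] [CommRing S] [CommRing T]

/-- The submodule of `S⁴` generated by the image of a submodule of `R⁴`. -/
def coordExtend (φ : R →+* S) (L : Submodule R (Fin 4 → R)) : Submodule S (Fin 4 → S) :=
  Submodule.span S ((fun v => φ ∘ v) '' L)

theorem coordExtend_le {φ : R →+* S} {L : Submodule R (Fin 4 → R)} {P : Submodule S (Fin 4 → S)} :
    coordExtend φ L ≤ P ↔ ∀ x ∈ L, φ ∘ x ∈ P := by
  rw [coordExtend, Submodule.span_le, Set.image_subset_iff]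
  rfl

theorem mem_coordExtend (φ : R →+* S) {L : Submodule R (Fin 4 → R)} {x : Fin 4 → R} (hx : x ∈ L) :
    φ ∘ x ∈ coordExtend φ L :=
  coordExtend_le.1 le_rfl x hx

theorem coordExtend_comp (φ : R →+* S) (ψ : S →+* T) (L : Submodule R (Fin 4 → R)) :
    coordExtend (ψ.comp φ) L = coordExtend ψ (coordExtend φ L) := by
  apply le_antisymm
  · exact coordExtend_le.2 fun x hx => mem_coordExtend ψ (mem_coordExtend φ hx)
  · rw [coordExtend_le]
    intro y hy
    induction hy using Submodule.span_induction with
    | mem y hy =>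
      obtain ⟨x, hx, rfl⟩ := hy
      exact mem_coordExtend (ψ.comp φ) hx
    | zero =>
      have : ψ ∘ (0 : Fin 4 → S) = 0 := by ext; simp
      rw [this]
      exact zero_mem _
    | add y y' _ _ h h' =>
      have : ψ ∘ (y + y') = ψ ∘ y + ψ ∘ y' := by ext; simp
      rw [this]
      exact add_mem h h'
    | smul a y _ h =>
      have : ψ ∘ (a • y) = ψ a • (ψ ∘ y) := by ext; simp
      rw [this]
      exact Submodule.smul_mem _ _ h

/-- The order of the coordinates in which the `i`-th chart is written. -/
def chartIdx : Bool × Fin 2 → Fin 4 → Fin 4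
  -- With `x` read as the matrix with rows `(x₀, x₁)` and `(x₂, x₃)`, the planes of the family
  -- `true` are given by proportional rows and those of `false` by proportional columns, with ratio
  -- `t`. The second index tells which row or column is the multiple of the other.
  | (true, 0) => ![0, 1, 2, 3]
  | (true, 1) => ![2, 3, 0, 1]
  | (false, 0) => ![0, 2, 1, 3]
  | (false, 1) => ![1, 3, 0, 2]

theorem chartIdx_bijective (i : Bool × Fin 2) : Function.Bijective (chartIdx i) := by
  rw [← Finite.injective_iff_bijective]
  revert i
  decide

/-- The isotropic plane with parameter `t` in the `i`-th chart. -/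
def chartPlane (i : Bool × Fin 2) (t : R) : Submodule R (Fin 4 → R) where
  carrier := {x | x (chartIdx i 2) = t * x (chartIdx i 0) ∧ x (chartIdx i 3) = t * x (chartIdx i 1)}
  add_mem' {x y} hx hy := by
    simp only [Set.mem_ofPred_eq, Pi.add_apply, mul_add] at *
    rw [hx.1, hx.2, hy.1, hy.2]
    exact ⟨rfl, rfl⟩
  zero_mem' := by simp
  smul_mem' c x hx := by
    simp only [Set.mem_ofPred_eq, Pi.smul_apply, smul_eq_mul] at *
    rw [hx.1, hx.2]
    constructor <;> ring

theorem mem_chartPlane {i : Bool × Fin 2} {t : R} {x : Fin 4 → R} :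
    x ∈ chartPlane i t ↔
      x (chartIdx i 2) = t * x (chartIdx i 0) ∧ x (chartIdx i 3) = t * x (chartIdx i 1) :=
  Iff.rfl

/-- The vectors of the plane with parameter `t` in the `i`-th chart, by their first two
coordinates. -/
def chartVec (i : Bool × Fin 2) (t a b : R) : Fin 4 → R :=
  fun n => ![a, b, t * a, t * b] ((Equiv.ofBijective _ (chartIdx_bijective i)).symm n)

theorem chartVec_apply (i : Bool × Fin 2) (t a b : R) (n : Fin 4) :
    chartVec i t a b (chartIdx i n) = ![a, b, t * a, t * b] n := by
  rw [chartVec]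
  congr 1
  exact (Equiv.ofBijective _ (chartIdx_bijective i)).symm_apply_apply n

theorem ext_chartIdx {α : Type*} (i : Bool × Fin 2) {x y : Fin 4 → α}
    (h : ∀ n, x (chartIdx i n) = y (chartIdx i n)) : x = y := by
  ext n
  obtain ⟨m, rfl⟩ := (chartIdx_bijective i).2 n
  exact h m

theorem chartVec_mem (i : Bool × Fin 2) (t a b : R) : chartVec i t a b ∈ chartPlane i t := by
  rw [mem_chartPlane]
  simp [chartVec_apply]

theorem eq_chartVec {i : Bool × Fin 2} {t : R} {x : Fin 4 → R} (hx : x ∈ chartPlane i t) :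
    x = chartVec i t (x (chartIdx i 0)) (x (chartIdx i 1)) := by
  refine ext_chartIdx i fun n => ?_
  rw [chartVec_apply]
  fin_cases n
  · rfl
  · rfl
  · exact hx.1
  · exact hx.2

theorem coordExtend_chartPlane (φ : R →+* S) (i : Bool × Fin 2) (t : R) :
    coordExtend φ (chartPlane i t) = chartPlane i (φ t) := by
  apply le_antisymm
  · rw [coordExtend_le]
    intro x hx
    simp only [mem_chartPlane, Function.comp_apply] at *
    rw [hx.1, hx.2]
    simp
  · intro y hy
    have h : y = y (chartIdx i 0) • (φ ∘ chartVec i t 1 0) +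
        y (chartIdx i 1) • (φ ∘ chartVec i t 0 1) := by
      rw [eq_chartVec hy]
      refine ext_chartIdx i fun n => ?_
      simp only [Pi.add_apply, Pi.smul_apply, Function.comp_apply, chartVec_apply, smul_eq_mul]
      fin_cases n <;> simp [mul_comm]
    rw [h]
    exact add_mem (Submodule.smul_mem _ _ (mem_coordExtend φ (chartVec_mem i t 1 0)))
      (Submodule.smul_mem _ _ (mem_coordExtend φ (chartVec_mem i t 0 1)))

theorem chartPlane_eq_iff (i j : Bool × Fin 2) (t s : R) :
    chartPlane i t = chartPlane j s ↔ ChartRel i j t s := by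
  constructor
  · intro h
    -- Two basis vectors of the first plane must satisfy the equations of the second. Their
    -- coordinates give `t = s` or `t * s = 1`, and for different rulings `0 = 1`.
    have h1 : ∀ a b : R, chartVec i t a b ∈ chartPlane j s := fun a b => h ▸ chartVec_mem i t a b
    have h2 := h1 1 0
    have h3 := h1 0 1
    have e := fun a b n => chartVec_apply i t a b n
    have e1 := e 1 0
    have e2 := e 0 1
    rw [mem_chartPlane] at h2 h3
    generalize chartVec i t 1 0 = x at *
    generalize chartVec i t 0 1 = y at *
    clear h h1 e
    have hsub : (0 : R) = 1 → Subsingleton R := subsingleton_iff_zero_eq_one.1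
    simp only [Fin.forall_fin_succ, IsEmpty.forall_iff] at e1 e2
    obtain ⟨_ | _, i⟩ := i <;> obtain ⟨_ | _, j⟩ := j <;> fin_cases i <;> fin_cases j <;>
      simp [chartIdx] at e1 e2 h2 h3 <;> simp [e1, e2] at h2 h3 <;> simp [ChartRel] <;>
      first
        | exact h2
        | exact (mul_comm t s).trans h2.symm
        | exact hsub h2.1.symm
        | exact hsub h3.1.symm
        | exact hsub h2.2.symm
        | exact hsub h3.2.symm
  · intro h
    ext x
    have hinv : t * s = 1 → ∀ a b : R, a = t * b ↔ b = s * a := fun h a b =>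
      ⟨fun e => by linear_combination (-s) * e - b * h, fun e => by
        linear_combination (-t) * e - a * h⟩
    have htriv : Subsingleton R → ∀ P Q : (Fin 4 → R) → Prop, P 0 → Q 0 → (P x ↔ Q x) :=
      fun h P Q hP hQ => by
        rw [Subsingleton.elim x 0]
        exact iff_of_true hP hQ
    by_cases hsub : i.1 = j.1
    swap
    · rw [ChartRel, if_neg hsub] at h
      exact htriv h (· ∈ chartPlane i t) (· ∈ chartPlane j s) (zero_mem _) (zero_mem _)
    rw [mem_chartPlane, mem_chartPlane]
    obtain ⟨_ | _, i⟩ := i <;> obtain ⟨_ | _, j⟩ := j <;> fin_cases i <;> fin_cases j <;>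
      simp [ChartRel, chartIdx] at h hsub ⊢ <;>
      first
        | rw [h]
        | rw [hinv h, hinv h]

/-! ### Localization of families of planes -/

theorem exists_comp_away (φ : R →+* S) (f : R) (h : IsUnit (φ f)) :
    ∃ ψ : Localization.Away f →+* S, ψ.comp (algebraMap R (Localization.Away f)) = φ :=
  ⟨IsLocalization.Away.lift f h, IsLocalization.Away.lift_comp f h⟩

/-- Elements of the extension are finite combinations of vectors of `L`, so one power of `f` clears
all denominators. -/
theorem exists_of_mem_coordExtend_away (f : R) {L : Submodule R (Fin 4 → R)}
    {y : Fin 4 → Localization.Away f}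
    (hy : y ∈ coordExtend (algebraMap R (Localization.Away f)) L) :
    ∃ n : ℕ, ∃ x ∈ L, algebraMap R (Localization.Away f) ∘ x =
      algebraMap R (Localization.Away f) f ^ n • y := by
  induction hy using Submodule.span_induction with
  | mem y hy =>
    obtain ⟨x, hx, rfl⟩ := hy
    exact ⟨0, x, hx, by simp⟩
  | zero => exact ⟨0, 0, zero_mem _, by ext; simp⟩
  | add y y' _ _ h h' =>
    obtain ⟨n, x, hx, h⟩ := h
    obtain ⟨n', x', hx', h'⟩ := h'
    refine ⟨n + n', f ^ n' • x + f ^ n • x',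
      add_mem (Submodule.smul_mem _ _ hx) (Submodule.smul_mem _ _ hx'), ?_⟩
    ext j
    have e := congrFun h j
    have e' := congrFun h' j
    simp only [Function.comp_apply, Pi.smul_apply, smul_eq_mul, Pi.add_apply, map_add, map_mul,
      map_pow] at *
    rw [e, e']
    ring
  | smul a y _ h =>
    obtain ⟨n, x, hx, h⟩ := h
    obtain ⟨⟨b, _, m, rfl⟩, hb⟩ := IsLocalization.surj (Submonoid.powers f) a
    refine ⟨m + n, b • x, Submodule.smul_mem _ _ hx, ?_⟩
    ext j
    have e := congrFun h j
    simp only [Function.comp_apply, Pi.smul_apply, smul_eq_mul, map_mul, map_pow] at *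
    rw [e, ← hb]
    ring

theorem comp_mem_coordExtend_away_iff (f : R) {L : Submodule R (Fin 4 → R)} {x : Fin 4 → R} :
    algebraMap R (Localization.Away f) ∘ x ∈ coordExtend (algebraMap R (Localization.Away f)) L ↔
      ∃ n : ℕ, f ^ n • x ∈ L := by
  constructor
  · intro h
    obtain ⟨n, x', hx', h⟩ := exists_of_mem_coordExtend_away f h
    have key : ∀ j, ∃ m : ℕ, f ^ m * (f ^ n * x j) = f ^ m * x' j := fun j => by
      have e := congrFun h j
      simp only [Function.comp_apply, Pi.smul_apply, smul_eq_mul, ← map_pow, ← map_mul] at e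
      obtain ⟨⟨_, m, rfl⟩, hm⟩ := IsLocalization.exists_of_eq (M := Submonoid.powers f) e
      exact ⟨m, hm.symm⟩
    choose m hm using key
    refine ⟨(∑ j, m j) + n, ?_⟩
    have : f ^ ((∑ j, m j) + n) • x = f ^ (∑ j, m j) • x' := by
      ext j
      obtain ⟨r, hr⟩ := Nat.exists_eq_add_of_le
        (Finset.single_le_sum (f := m) (fun _ _ => Nat.zero_le _) (Finset.mem_univ j))
      simp only [Pi.smul_apply, smul_eq_mul]
      rw [hr, pow_add, pow_add]
      linear_combination f ^ r * hm j
    rw [this]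
    exact Submodule.smul_mem _ _ hx'
  · rintro ⟨n, h⟩
    have h1 := mem_coordExtend (algebraMap R (Localization.Away f)) h
    obtain ⟨b, hb⟩ := ((IsLocalization.Away.algebraMap_isUnit f :
      IsUnit (algebraMap R (Localization.Away f) f)).pow n).exists_left_inv
    have : algebraMap R (Localization.Away f) ∘ x =
        b • (algebraMap R (Localization.Away f) ∘ (f ^ n • x)) := by
      ext j
      simp only [Function.comp_apply, Pi.smul_apply, smul_eq_mul, map_mul, map_pow]
      rw [← mul_assoc, hb, one_mul]
    rw [this]
    exact Submodule.smul_mem _ _ h1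

theorem le_of_coordExtend_away_le (s : Set R) (hs : Ideal.span s = ⊤)
    {L L' : Submodule R (Fin 4 → R)}
    (h : ∀ f ∈ s, coordExtend (algebraMap R (Localization.Away f)) L ≤
      coordExtend (algebraMap R (Localization.Away f)) L') : L ≤ L' := fun x hx =>
  Submodule.mem_of_span_eq_top_of_smul_pow_mem L' s hs x fun f =>
    (comp_mem_coordExtend_away_iff f.1).1 (h f.1 f.2 (mem_coordExtend _ hx))

/-- The submodule of `R⁴` glued from submodules over a cover by principal open subsets. -/
def glueSubmodule (s : Set R) (L : ∀ f : s, Submodule (Localization.Away f.1)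
    (Fin 4 → Localization.Away f.1)) : Submodule R (Fin 4 → R) where
  carrier := {x | ∀ f : s, algebraMap R (Localization.Away f.1) ∘ x ∈ L f}
  add_mem' {x y} hx hy f := by
    have : algebraMap R (Localization.Away f.1) ∘ (x + y) =
        algebraMap R (Localization.Away f.1) ∘ x + algebraMap R (Localization.Away f.1) ∘ y := by
      ext; simp
    rw [this]
    exact add_mem (hx f) (hy f)
  zero_mem' f := by
    have : algebraMap R (Localization.Away f.1) ∘ (0 : Fin 4 → R) = 0 := by ext; simp
    rw [this]
    exact zero_mem _
  smul_mem' a x hx f := by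
    have : algebraMap R (Localization.Away f.1) ∘ (a • x) =
        algebraMap R (Localization.Away f.1) a • (algebraMap R (Localization.Away f.1) ∘ x) := by
      ext; simp
    rw [this]
    exact Submodule.smul_mem _ _ (hx f)

/-- A vector `y` of the `f`-th piece becomes, after multiplication by a power of `f`, the image of
some `x` in `R⁴`. By compatibility a further power of `f` moves `x` into each of the other pieces,
and since the cover is finite one power works for all of them. -/
theorem coordExtend_glueSubmodule (s : Set R) (hfin : s.Finite)
    (L : ∀ f : s, Submodule (Localization.Away f.1) (Fin 4 → Localization.Away f.1))
    (hL : ∀ f g : s, ∀ a : Localization.Away f.1 →+*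
      Localization.Away (algebraMap R (Localization.Away g.1) f.1),
      a.comp (algebraMap R _) = (algebraMap (Localization.Away g.1)
        (Localization.Away (algebraMap R (Localization.Away g.1) f.1))).comp (algebraMap R _) →
      coordExtend a (L f) ≤ coordExtend (algebraMap _ _) (L g)) (f : s) :
    coordExtend (algebraMap R (Localization.Away f.1)) (glueSubmodule s L) = L f := by
  apply le_antisymm
  · exact coordExtend_le.2 fun x hx => hx f
  · intro y hy
    have key : ∀ j, ∃ (n : ℕ) (b : R), y j * algebraMap R (Localization.Away f.1) f.1 ^ n =
        algebraMap R _ b := fun j => by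
      obtain ⟨⟨b, _, m, rfl⟩, hb⟩ := IsLocalization.surj (Submonoid.powers f.1) (y j)
      exact ⟨m, b, by rw [← map_pow]; exact hb⟩
    choose n b hb using key
    let x : Fin 4 → R := fun j => f.1 ^ (∑ l, n l - n j) * b j
    have hle : ∀ j, n j ≤ ∑ l, n l := fun j =>
      Finset.single_le_sum (f := n) (fun _ _ => Nat.zero_le _) (Finset.mem_univ j)
    have hx : algebraMap R (Localization.Away f.1) ∘ x =
        algebraMap R (Localization.Away f.1) f.1 ^ (∑ l, n l) • y := by
      ext j
      simp only [x, Function.comp_apply, map_mul, map_pow, Pi.smul_apply, smul_eq_mul]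
      rw [← hb]
      conv_rhs => rw [← Nat.sub_add_cancel (hle j), pow_add]
      ring
    have hxf : algebraMap R (Localization.Away f.1) ∘ x ∈ L f := by
      rw [hx]
      exact Submodule.smul_mem _ _ hy
    have hg : ∀ g : s, ∃ m : ℕ, algebraMap R (Localization.Away g.1) ∘ (f.1 ^ m • x) ∈ L g :=
      fun g => by
      let A := algebraMap (Localization.Away g.1)
        (Localization.Away (algebraMap R (Localization.Away g.1) f.1))
      obtain ⟨a, ha⟩ := exists_comp_away (A.comp (algebraMap R (Localization.Away g.1))) f.1
        (IsLocalization.Away.algebraMap_isUnit (algebraMap R (Localization.Away g.1) f.1))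
      have h1 := hL f g a ha (mem_coordExtend a hxf)
      have h2 : a ∘ algebraMap R (Localization.Away f.1) ∘ x =
          A ∘ (algebraMap R (Localization.Away g.1) ∘ x) := by
        ext j
        exact RingHom.congr_fun ha (x j)
      rw [h2, comp_mem_coordExtend_away_iff] at h1
      obtain ⟨m, hm⟩ := h1
      refine ⟨m, ?_⟩
      convert hm using 1
      ext j
      simp
    choose m hm using hg
    have : Fintype s := hfin.fintype
    have hxL : f.1 ^ (∑ g, m g) • x ∈ glueSubmodule s L := fun g => by
      obtain ⟨r, hr⟩ := Nat.exists_eq_add_of_le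
        (Finset.single_le_sum (f := m) (fun _ _ => Nat.zero_le _) (Finset.mem_univ g))
      have : algebraMap R (Localization.Away g.1) ∘ (f.1 ^ (∑ g, m g) • x) =
          algebraMap R (Localization.Away g.1) f.1 ^ r •
            (algebraMap R (Localization.Away g.1) ∘ (f.1 ^ m g • x)) := by
        ext j
        simp only [hr, Function.comp_apply, Pi.smul_apply, smul_eq_mul, map_mul, map_pow, pow_add]
        ring
      rw [this]
      exact Submodule.smul_mem _ _ (hm g)
    have h1 := (comp_mem_coordExtend_away_iff f.1).2 ⟨_, hxL⟩
    rw [hx] at h1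
    have hu : IsUnit (algebraMap R (Localization.Away f.1) f.1 ^ (∑ l, n l)) :=
      (IsLocalization.Away.algebraMap_isUnit f.1).pow _
    exact (Submodule.smul_mem_iff_of_isUnit _ hu).1 h1

/-- A submodule of `R⁴` is locally a chart plane. -/
def IsLocallyChart (L : Submodule R (Fin 4 → R)) : Prop :=
  ∀ q : Ideal R, q.IsPrime → ∃ f ∉ q, ∃ (i : Bool × Fin 2) (t : Localization.Away f),
    coordExtend (algebraMap R (Localization.Away f)) L = chartPlane i t

theorem isLocallyChart_chartPlane (i : Bool × Fin 2) (t : R) : IsLocallyChart (chartPlane i t) :=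
  fun q hq => ⟨1, fun h => hq.ne_top ((Ideal.eq_top_iff_one q).2 h), i, _,
    coordExtend_chartPlane _ i t⟩

theorem IsLocallyChart.coordExtend {L : Submodule R (Fin 4 → R)} (h : IsLocallyChart L)
    (φ : R →+* S) : IsLocallyChart (coordExtend φ L) := fun q hq => by
  obtain ⟨f, hf, i, t, hL⟩ := h (q.comap φ) (hq.comap φ)
  obtain ⟨ψ, hψ⟩ := exists_comp_away
    ((algebraMap S (Localization.Away (φ f))).comp φ) f
    (IsLocalization.Away.algebraMap_isUnit (φ f))
  refine ⟨φ f, hf, i, ψ t, ?_⟩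
  rw [← coordExtend_comp, ← hψ, coordExtend_comp, hL, coordExtend_chartPlane]

/-- A prime `q` that avoids some `f` of the cover comes from a prime `Q` of `R_f`. A chart
neighbourhood of `Q` is given by some `g`; writing `g` with numerator `b` in `R`, the element `f *
b` gives a chart neighbourhood of `q`. -/
theorem isLocallyChart_of_cover (s : Set R) (hs : Ideal.span s = ⊤) {L : Submodule R (Fin 4 → R)}
    (h : ∀ f ∈ s, IsLocallyChart (GLFour.coordExtend (algebraMap R (Localization.Away f)) L)) :
    IsLocallyChart L := fun q hq => by
  obtain ⟨f, hfs, hfq⟩ : ∃ f ∈ s, f ∉ q := by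
    by_contra! hcon
    exact hq.ne_top (top_le_iff.1 (hs ▸ Ideal.span_le.2 hcon))
  obtain ⟨Q, hQ⟩ : (⟨q, hq⟩ : PrimeSpectrum R) ∈
      Set.range (PrimeSpectrum.comap (algebraMap R (Localization.Away f))) := by
    rw [PrimeSpectrum.localization_away_comap_range (Localization.Away f) f]
    exact hfq
  have hQ' : ∀ a, algebraMap R (Localization.Away f) a ∈ Q.asIdeal ↔ a ∈ q := fun a => by
    have := congrArg PrimeSpectrum.asIdeal hQ
    rw [← show Q.asIdeal.comap (algebraMap R (Localization.Away f)) = q from this]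
    rfl
  obtain ⟨g, hg, i, t, hL⟩ := h f hfs Q.asIdeal Q.isPrime
  obtain ⟨⟨b, _, m, rfl⟩, hb⟩ := IsLocalization.surj (Submonoid.powers f) g
  dsimp only at hb
  have hbq : b ∉ q := by
    rw [← hQ', ← hb, map_pow]
    intro hmem
    obtain h | h := Q.isPrime.mem_or_mem hmem
    · exact hg h
    · exact hfq ((hQ' f).1 (Q.isPrime.mem_of_pow_mem _ h))
  have hu : IsUnit (algebraMap R (Localization.Away (f * b)) f) ∧
      IsUnit (algebraMap R (Localization.Away (f * b)) b) := by
    rw [← IsUnit.mul_iff, ← map_mul]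
    exact IsLocalization.Away.algebraMap_isUnit (f * b)
  obtain ⟨ψ, hψ⟩ := exists_comp_away (algebraMap R (Localization.Away (f * b))) f hu.1
  obtain ⟨χ, hχ⟩ := exists_comp_away ψ g (by
    have h1 := congrArg ψ hb
    rw [map_mul] at h1
    refine isUnit_of_mul_isUnit_left (y := ψ (algebraMap R (Localization.Away f) (f ^ m))) ?_
    rw [h1]
    have := RingHom.congr_fun hψ b
    rw [RingHom.comp_apply] at this
    rw [this]
    exact hu.2)
  refine ⟨f * b, fun hmem => (hq.mem_or_mem hmem).elim hfq hbq, i, χ t, ?_⟩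
  rw [← hψ, coordExtend_comp, ← hχ, coordExtend_comp, hL, coordExtend_chartPlane]

variable (k : Type u) [Field k] in
/-- The sheaf of families of isotropic planes, in coordinates. -/
def planeSheaf : ChartedSheaf.{u, u} k (Bool × Fin 2) where
  obj R _ _ := {L : Submodule R (Fin 4 → R) // IsLocallyChart L}
  map φ x := ⟨coordExtend φ.toRingHom x.1, x.2.coordExtend _⟩
  map_comp φ ψ x := Subtype.ext (coordExtend_comp φ.toRingHom ψ.toRingHom x.1)
  eq_of_locally s hs x y h := by
    have h' := fun f hf => congrArg Subtype.val (h f hf)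
    exact Subtype.ext (le_antisymm (le_of_coordExtend_away_le s hs fun f hf => (h' f hf).le)
      (le_of_coordExtend_away_le s hs fun f hf => (h' f hf).ge))
  exists_glue {R} _ _ s hfin hs x h := by
    have key := coordExtend_glueSubmodule s hfin (fun f => (x f).1) (fun f g a ha => by
      let a' : Localization.Away f.1 →ₐ[k]
          Localization.Away (algebraMap R (Localization.Away g.1) f.1) :=
        { a with
          commutes' := fun c => by
            have := RingHom.congr_fun ha (algebraMap k R c)
            simp only [RingHom.comp_apply, ← IsScalarTower.algebraMap_apply] at this
            exact this }
      have := h f g _ a' (locHom k _) (by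
        ext r
        exact RingHom.congr_fun ha r)
      exact (congrArg Subtype.val this).le)
    exact ⟨⟨glueSubmodule s fun f => (x f).1, isLocallyChart_of_cover s hs fun f hf => by
      rw [key ⟨f, hf⟩]
      exact (x ⟨f, hf⟩).2⟩, fun f => Subtype.ext (key f)⟩
  chart i t := ⟨chartPlane i t, isLocallyChart_chartPlane i t⟩
  map_chart φ i t := Subtype.ext (coordExtend_chartPlane φ.toRingHom i t)
  exists_chart x q hq := by
    obtain ⟨f, hf, i, t, h⟩ := x.2 q hq
    exact ⟨f, hf, i, t, Subtype.ext h⟩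

theorem planeSheaf_chart_eq_iff {k : Type u} [Field k] {R : Type u} [CommRing R] [Algebra k R]
    (i j : Bool × Fin 2) (t s : R) :
    (planeSheaf k).chart i t = (planeSheaf k).chart j s ↔ ChartRel i j t s := by
  rw [← chartPlane_eq_iff]
  exact Subtype.ext_iff

end Coordinates

/-! ### Isotropic planes of the hyperbolic form on `R⁴` are locally given by charts -/

section IsotropicPlane

variable {R S : Type u} [CommRing R] [CommRing S]

/-- The hyperbolic bilinear form on `R⁴`. -/
def hypForm (x y : Fin 4 → R) : R := x 0 * y 3 + x 3 * y 0 - x 1 * y 2 - x 2 * y 1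

theorem hypForm_comp (φ : R →+* S) (x y : Fin 4 → R) :
    hypForm (φ ∘ x) (φ ∘ y) = φ (hypForm x y) := by
  simp [hypForm]

theorem hypForm_chartPlane {i : Bool × Fin 2} {t : R} {x y : Fin 4 → R} (hx : x ∈ chartPlane i t)
    (hy : y ∈ chartPlane i t) : hypForm x y = 0 := by
  rw [mem_chartPlane] at hx hy
  obtain ⟨_ | _, i⟩ := i <;> fin_cases i <;> simp [chartIdx] at hx hy <;>
    simp only [hypForm, hx, hy] <;> ring

/-- The minor of two vectors that belongs to the `i`-th chart. -/
def chartMinor (i : Bool × Fin 2) (x y : Fin 4 → R) : R :=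
  x (chartIdx i 0) * y (chartIdx i 1) - x (chartIdx i 1) * y (chartIdx i 0)

theorem chartMinor_comp (φ : R →+* S) (i : Bool × Fin 2) (x y : Fin 4 → R) :
    chartMinor i (φ ∘ x) (φ ∘ y) = φ (chartMinor i x y) := by
  simp [chartMinor]

/-- A totally isotropic submodule of `R⁴`. -/
def IsTotIsotropic (L : Submodule R (Fin 4 → R)) : Prop := ∀ x ∈ L, ∀ y ∈ L, hypForm x y = 0

/-- A biadditive expression that vanishes on a family of vectors vanishes on its extension. -/
theorem eq_zero_of_mem_coordExtend (φ : R →+* S) {L : Submodule R (Fin 4 → R)}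
    (b : LinearMap.BilinForm S (Fin 4 → S)) (h : ∀ x ∈ L, ∀ y ∈ L, b (φ ∘ x) (φ ∘ y) = 0)
    {x y : Fin 4 → S} (hx : x ∈ coordExtend φ L) (hy : y ∈ coordExtend φ L) : b x y = 0 := by
  have h1 : ∀ x ∈ L, coordExtend φ L ≤ LinearMap.ker (b (φ ∘ x)) := fun x hx =>
    coordExtend_le.2 fun y hy => h x hx y hy
  have h2 : coordExtend φ L ≤ LinearMap.ker (b.flip y) :=
    coordExtend_le.2 fun x hx => h1 x hx hy
  exact h2 hx

theorem IsTotIsotropic.coordExtend {L : Submodule R (Fin 4 → R)} (h : IsTotIsotropic L)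
    (φ : R →+* S) : IsTotIsotropic (coordExtend φ L) := fun x hx y hy => by
  refine eq_zero_of_mem_coordExtend φ (LinearMap.mk₂ S hypForm ?_ ?_ ?_ ?_) ?_ hx hy
  iterate 4
    intros
    simp only [hypForm, Pi.add_apply, Pi.smul_apply, smul_eq_mul]
    ring
  intro x hx y hy
  rw [LinearMap.mk₂_apply, hypForm_comp, h x hx y hy, map_zero]

theorem chartMinor_eq_zero_of_mem_coordExtend (φ : R →+* S) {L : Submodule R (Fin 4 → R)}
    (i : Bool × Fin 2) (h : ∀ x ∈ L, ∀ y ∈ L, φ (chartMinor i x y) = 0)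
    {x y : Fin 4 → S} (hx : x ∈ coordExtend φ L) (hy : y ∈ coordExtend φ L) :
    chartMinor i x y = 0 := by
  refine eq_zero_of_mem_coordExtend φ (LinearMap.mk₂ S (chartMinor i) ?_ ?_ ?_ ?_) ?_ hx hy
  iterate 4
    intros
    simp only [chartMinor, Pi.add_apply, Pi.smul_apply, smul_eq_mul]
    ring
  intro x hx y hy
  rw [LinearMap.mk₂_apply, chartMinor_comp, h x hx y hy]

/-- The reordering of coordinates by `chartIdx i` preserves the hyperbolic form up to sign, so
arguments about isotropic vectors can be made uniformly for all four charts. -/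
theorem hypForm_chartIdx (i : Bool × Fin 2) (x y : Fin 4 → R) (h : hypForm x y = 0) :
    x (chartIdx i 0) * y (chartIdx i 3) + x (chartIdx i 3) * y (chartIdx i 0) -
      x (chartIdx i 1) * y (chartIdx i 2) - x (chartIdx i 2) * y (chartIdx i 1) = 0 := by
  rw [hypForm] at h
  obtain ⟨_ | _, i⟩ := i <;> fin_cases i <;> simp [chartIdx] <;>
    first | linear_combination h | linear_combination -h

/-- A totally isotropic submodule with two vectors that are independent in a chart. -/
theorem IsTotIsotropic.eq_chartPlane (h2 : IsUnit (2 : R)) {L : Submodule R (Fin 4 → R)}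
    (hL : IsTotIsotropic L) (i : Bool × Fin 2) {y z : Fin 4 → R} (hy : y ∈ L) (hz : z ∈ L)
    (h : IsUnit (chartMinor i y z)) : ∃ t, L = chartPlane i t := by
  obtain ⟨δ, hδ⟩ := h.exists_right_inv
  have hcancel : ∀ a : R, 2 * a = 0 → a = 0 := fun a ha => (h2.mul_right_eq_zero).1 ha
  -- Cramer's rule with the invertible minor: `u` and `v` have leading chart coordinates `(1, 0)`
  -- and `(0, 1)`.
  let u : Fin 4 → R := (δ * z (chartIdx i 1)) • y - (δ * y (chartIdx i 1)) • z
  let v : Fin 4 → R := (δ * y (chartIdx i 0)) • z - (δ * z (chartIdx i 0)) • y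
  have hu : u ∈ L := sub_mem (L.smul_mem _ hy) (L.smul_mem _ hz)
  have hv : v ∈ L := sub_mem (L.smul_mem _ hz) (L.smul_mem _ hy)
  rw [chartMinor] at hδ
  have hu0 : u (chartIdx i 0) = 1 := by simp [u]; linear_combination hδ
  have hu1 : u (chartIdx i 1) = 0 := by simp [u]; ring
  have hv0 : v (chartIdx i 0) = 0 := by simp [v]; ring
  have hv1 : v (chartIdx i 1) = 1 := by simp [v]; linear_combination hδ
  clear_value u v
  have huu := hypForm_chartIdx i u u (hL u hu u hu)
  have hvv := hypForm_chartIdx i v v (hL v hv v hv)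
  have huv := hypForm_chartIdx i u v (hL u hu v hv)
  -- The self-pairings of `u` and `v` are, up to sign, twice one coordinate each, which is where `2`
  -- has to be a unit. Orthogonality of `u` and `v` then leaves a single free parameter.
  have hu3 : u (chartIdx i 3) = 0 := hcancel _ (by
    rw [hu0, hu1] at huu; linear_combination huu)
  have hv2 : v (chartIdx i 2) = 0 := hcancel _ (by
    rw [hv0, hv1] at hvv; linear_combination -hvv)
  have hv3 : v (chartIdx i 3) = u (chartIdx i 2) := by
    rw [hu0, hu1, hu3, hv0, hv1, hv2] at huv; linear_combination huv
  refine ⟨u (chartIdx i 2), le_antisymm (fun x hx => ?_) (fun x hx => ?_)⟩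
  · have hxu := hypForm_chartIdx i x u (hL x hx u hu)
    have hxv := hypForm_chartIdx i x v (hL x hx v hv)
    rw [hu0, hu1, hu3] at hxu
    rw [hv0, hv1, hv2, hv3] at hxv
    exact ⟨by linear_combination -hxv, by linear_combination hxu⟩
  · have : x = x (chartIdx i 0) • u + x (chartIdx i 1) • v := by
      refine ext_chartIdx i fun n => ?_
      rw [mem_chartPlane] at hx
      fin_cases n <;> simp [*, mul_comm]
    rw [this]
    exact add_mem (L.smul_mem _ hu) (L.smul_mem _ hv)

/-- Over a field, a totally isotropic subspace without any chart is at most a line. -/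
theorem IsTotIsotropic.finrank_le_one {K : Type u} [Field K] {P : Submodule K (Fin 4 → K)}
    (hP : IsTotIsotropic P) (h : ∀ i, ∀ x ∈ P, ∀ y ∈ P, chartMinor i x y = 0) :
    Module.finrank K P ≤ 1 := by
  by_cases hbot : P = ⊥
  · rw [hbot, finrank_bot]
    exact zero_le
  obtain ⟨v, hv, hv0⟩ := P.ne_bot_iff.1 hbot
  obtain ⟨n, hn⟩ := Function.ne_iff.1 hv0
  refine _root_.finrank_le_one (⟨v, hv⟩ : P) fun w => ?_
  obtain ⟨w, hw⟩ := w
  refine ⟨w n / v n, Subtype.ext (funext fun m => ?_)⟩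
  have hvv := hP v hv v hv
  have hww := hP w hw w hw
  have hvw := hP v hv w hw
  have h1 := h (true, 0) v hv w hw
  have h2 := h (true, 1) v hv w hw
  have h3 := h (false, 0) v hv w hw
  have h4 := h (false, 1) v hv w hw
  simp [chartMinor, chartIdx] at h1 h2 h3 h4
  rw [hypForm] at hvv hww hvw
  -- The Plücker relation, in which the four minors of the charts vanish, leaves the product of the
  -- other two.
  have hprod : (v 0 * w 3 - v 3 * w 0) * (v 1 * w 2 - v 2 * w 1) = 0 := by
    linear_combination (v 1 * w 3 - v 3 * w 1) * h3 - (v 2 * w 3 - v 3 * w 2) * h1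
  -- Isotropy makes the two remaining minors agree up to sign. As their product is zero, both
  -- vanish, and `v` and `w` are proportional.
  have hsq : (v 0 * w 3 - v 3 * w 0) ^ 2 = (v 1 * w 2 - v 2 * w 1) ^ 2 := by
    linear_combination (v 0 * w 3 + v 3 * w 0 + v 1 * w 2 + v 2 * w 1) * hvw -
      2 * w 0 * w 3 * hvv - 2 * v 1 * v 2 * hww
  have h5 : v 0 * w 3 - v 3 * w 0 = 0 ∧ v 1 * w 2 - v 2 * w 1 = 0 := by
    rcases mul_eq_zero.1 hprod with h0 | h0
    · exact ⟨h0, by rw [h0] at hsq; simpa using hsq.symm⟩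
    · exact ⟨by rw [h0] at hsq; simpa using hsq, h0⟩
  have hall : v n * w m = v m * w n := by
    fin_cases m <;> fin_cases n <;> simp <;>
      first
        | ring1
        | linear_combination h1
        | linear_combination h2
        | linear_combination h3
        | linear_combination h4
        | linear_combination h5.1
        | linear_combination h5.2
        | linear_combination -h1
        | linear_combination -h2
        | linear_combination -h3
        | linear_combination -h4
        | linear_combination -h5.1
        | linear_combination -h5.2
  have hn' : v n ≠ 0 := hn
  simp only [Submodule.coe_smul, Pi.smul_apply, smul_eq_mul]
  field_simp
  linear_combination -hall

theorem finrank_chartPlane {K : Type u} [Field K] (i : Bool × Fin 2) (t : K) :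
    Module.finrank K (chartPlane i t) = 2 := by
  let e : (Fin 2 → K) ≃ₗ[K] chartPlane i t :=
    { toFun := fun a => ⟨chartVec i t (a 0) (a 1), chartVec_mem i t _ _⟩
      map_add' := fun a b => Subtype.ext (ext_chartIdx i fun n => by
        fin_cases n <;> simp [chartVec_apply, mul_add])
      map_smul' := fun c a => Subtype.ext (ext_chartIdx i fun n => by
        fin_cases n <;> simp [chartVec_apply, mul_left_comm])
      invFun := fun x => ![x.1 (chartIdx i 0), x.1 (chartIdx i 1)]
      left_inv := fun a => by
        ext n
        fin_cases n <;> simp [chartVec_apply]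
      right_inv := fun x => Subtype.ext (eq_chartVec x.2).symm }
  rw [← e.finrank_eq, Module.finrank_fin_fun]

/-- A totally isotropic direct summand of rank two of `R⁴`. -/
structure IsIsotropicPlane (L : Submodule R (Fin 4 → R)) : Prop where
  isotropic : IsTotIsotropic L
  summand : ∃ C : Submodule R (Fin 4 → R), IsCompl L C
  rank : ∀ q : PrimeSpectrum R, Module.rankAtStalk (R := R) L q = 2

theorem projective_of_isCompl {L C : Submodule R (Fin 4 → R)} (h : IsCompl L C) :
    Module.Projective R L ∧ Module.Finite R L :=
  ⟨Module.Projective.of_split L.subtype (L.projectionOnto C h) (by ext x; simp),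
    Module.Finite.of_surjective (L.projectionOnto C h) fun x => ⟨x, by simp⟩⟩

/-- The rank of a direct summand of `R⁴` is the dimension of its extension to the residue field. -/
theorem rankAtStalk_eq_finrank_coordExtend {L C : Submodule R (Fin 4 → R)} (h : IsCompl L C)
    (q : PrimeSpectrum R) :
    Module.rankAtStalk (R := R) L q =
      Module.finrank q.asIdeal.ResidueField
        (coordExtend (algebraMap R q.asIdeal.ResidueField) L) := by
  have := (projective_of_isCompl h).1
  have := (projective_of_isCompl h).2
  rw [Module.rankAtStalk_eq]
  let K := q.asIdeal.ResidueField
  let e := TensorProduct.piScalarRight R K K (Fin 4)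
  let f : K ⊗[R] L →ₗ[K] (Fin 4 → K) := e.toLinearMap ∘ₗ L.subtype.baseChange K
  have hinj : Function.Injective f := by
    refine e.injective.comp ?_
    have hl : (L.projectionOnto C h).baseChange K ∘ₗ L.subtype.baseChange K = LinearMap.id := by
      rw [← LinearMap.baseChange_comp]
      have : L.projectionOnto C h ∘ₗ L.subtype = LinearMap.id := by ext x; simp
      rw [this, LinearMap.baseChange_id]
    exact Function.LeftInverse.injective (fun x => LinearMap.congr_fun hl x)
  have hrange : LinearMap.range f = coordExtend (algebraMap R K) L := by
    have h1 : LinearMap.range f = (L.baseChange K).map e.toLinearMap := LinearMap.range_comp _ _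
    rw [h1, Submodule.baseChange_eq_span, Submodule.map_span, coordExtend]
    congr 1
    ext x
    simp only [Set.mem_image, SetLike.mem_coe, Submodule.mem_map]
    have he : ∀ y : Fin 4 → R, e (1 ⊗ₜ y) = algebraMap R K ∘ y := fun y => by
      ext j
      simp [e, Algebra.algebraMap_eq_smul_one]
    constructor
    · rintro ⟨_, ⟨y, hy, rfl⟩, rfl⟩
      exact ⟨y, hy, (he y).symm⟩
    · rintro ⟨y, hy, rfl⟩
      exact ⟨_, ⟨y, hy, rfl⟩, he y⟩
  rw [← hrange]
  exact (LinearEquiv.ofInjective f hinj).finrank_eq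

/-- If all four chart minors vanished at `q`, the fibre over the residue field would have dimension
at most one, against rank two. A minor that does not vanish at `q` defines the neighbourhood on
which `L` is a chart plane. -/
theorem IsIsotropicPlane.isLocallyChart (h2 : IsUnit (2 : R)) {L : Submodule R (Fin 4 → R)}
    (hL : IsIsotropicPlane L) : IsLocallyChart L := fun q hq => by
  obtain ⟨i, y, hy, z, hz, hyz⟩ : ∃ i, ∃ y ∈ L, ∃ z ∈ L, chartMinor i y z ∉ q := by
    by_contra! hcon
    obtain ⟨C, hC⟩ := hL.summand
    have h1 := hL.rank ⟨q, hq⟩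
    rw [rankAtStalk_eq_finrank_coordExtend hC] at h1
    have h3 := (hL.isotropic.coordExtend (algebraMap R q.ResidueField)).finrank_le_one
      fun i x hx y hy => chartMinor_eq_zero_of_mem_coordExtend _ i (fun x hx y hy =>
        Ideal.algebraMap_residueField_eq_zero.2 (hcon i x hx y hy)) hx hy
    dsimp only at h1
    omega
  let f := chartMinor i y z
  let φ := algebraMap R (Localization.Away f)
  obtain ⟨t, ht⟩ := (hL.isotropic.coordExtend φ).eq_chartPlane
    (by have := h2.map φ; rwa [map_ofNat] at this) i
    (mem_coordExtend φ hy) (mem_coordExtend φ hz) (by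
      rw [chartMinor_comp]
      exact IsLocalization.Away.algebraMap_isUnit f)
  exact ⟨f, hyz, i, t, ht⟩

/-- Pairings vanish over each chart neighbourhood, so the annihilator of a pairing is contained in
no maximal ideal. -/
theorem IsLocallyChart.isTotIsotropic {L : Submodule R (Fin 4 → R)} (hL : IsLocallyChart L) :
    IsTotIsotropic L := fun x hx y hy => by
  have h : ∀ q : Ideal R, q.IsPrime → ∃ f ∉ q, f * hypForm x y = 0 := fun q hq => by
    obtain ⟨f, hf, i, t, h⟩ := hL q hq
    have hz : algebraMap R (Localization.Away f) (hypForm x y) = algebraMap R _ 0 := by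
      rw [← hypForm_comp, map_zero]
      exact hypForm_chartPlane (h ▸ mem_coordExtend _ hx) (h ▸ mem_coordExtend _ hy)
    obtain ⟨⟨_, m, rfl⟩, hm⟩ := IsLocalization.exists_of_eq (M := Submonoid.powers f) hz
    exact ⟨f ^ m, fun hmem => hf (hq.mem_of_pow_mem _ hmem), by simpa using hm⟩
  by_contra hne
  let J : Ideal R := LinearMap.ker (LinearMap.mulRight R (hypForm x y))
  obtain ⟨m, hm, hle⟩ := J.exists_le_maximal (fun h1 => hne (by
    have : (1 : R) ∈ J := h1 ▸ trivial
    simpa [J] using this))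
  obtain ⟨f, hf, hfz⟩ := h m hm.isPrime
  exact hf (hle hfz)

/-- The scalars `r` for which multiplication by `r` on `L` extends to a linear map `R⁴ → L` form an
ideal `J`. Near every prime a power of the chart's denominator lies in `J`, so `1` does, and the
corresponding map is a projection onto `L`. -/
theorem IsLocallyChart.exists_isCompl {L : Submodule R (Fin 4 → R)} (hL : IsLocallyChart L) :
    ∃ C : Submodule R (Fin 4 → R), IsCompl L C := by
  have hiso := hL.isTotIsotropic
  let J : Ideal R :=
    { carrier := {r | ∃ p : (Fin 4 → R) →ₗ[R] L, ∀ x : L, p x = r • x}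
      add_mem' := by
        rintro r r' ⟨p, hp⟩ ⟨p', hp'⟩
        exact ⟨p + p', fun x => by rw [LinearMap.add_apply, hp, hp', add_smul]⟩
      zero_mem' := ⟨0, fun x => by simp⟩
      smul_mem' := by
        rintro c r ⟨p, hp⟩
        exact ⟨c • p, fun x => by rw [LinearMap.smul_apply, hp, smul_smul, smul_eq_mul]⟩ }
  have hJ : J = ⊤ := by
    by_contra hne
    obtain ⟨m, hm, hle⟩ := J.exists_le_maximal hne
    obtain ⟨f, hf, i, t, h⟩ := hL m hm.isPrime
    let φ := algebraMap R (Localization.Away f)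
    obtain ⟨⟨τ, _, n, rfl⟩, hτ⟩ := IsLocalization.surj (Submonoid.powers f) t
    let w : R → R → Fin 4 → R := fun a b j =>
      ![f ^ n * a, f ^ n * b, τ * a, τ * b]
        ((Equiv.ofBijective _ (chartIdx_bijective i)).symm j)
    have hw : ∀ a b j, w a b (chartIdx i j) = ![f ^ n * a, f ^ n * b, τ * a, τ * b] j :=
      fun a b j => by
        change ![f ^ n * a, f ^ n * b, τ * a, τ * b] _ = _
        congr 1
        exact (Equiv.ofBijective _ (chartIdx_bijective i)).symm_apply_apply j
    have hwmem : ∀ a b, ∃ N : ℕ, f ^ N • w a b ∈ L := fun a b => by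
      rw [← comp_mem_coordExtend_away_iff, h, mem_chartPlane]
      simp only [Function.comp_apply, hw]
      simp only [← hτ, map_mul, map_pow, Matrix.cons_val]
      constructor <;> ring
    obtain ⟨N₁, hN₁⟩ := hwmem 1 0
    obtain ⟨N₂, hN₂⟩ := hwmem 0 1
    let u : L := ⟨f ^ N₂ • f ^ N₁ • w 1 0, L.smul_mem _ hN₁⟩
    let v : L := ⟨f ^ N₁ • f ^ N₂ • w 0 1, L.smul_mem _ hN₂⟩
    let M := N₁ + N₂ + n
    -- The map sends `x` to the combination of `u` and `v` with the leading chart coordinates of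
    -- `x`. On `L` it is multiplication by `f ^ M`: in the last two coordinates this is the
    -- orthogonality of `x` to `u` and `v`.
    refine hf (hm.isPrime.mem_of_pow_mem M (hle ⟨(LinearMap.proj (chartIdx i 0)).smulRight u +
      (LinearMap.proj (chartIdx i 1)).smulRight v, fun x => Subtype.ext ?_⟩))
    have hxu := hypForm_chartIdx i x.1 u.1 (hiso _ x.2 _ u.2)
    have hxv := hypForm_chartIdx i x.1 v.1 (hiso _ x.2 _ v.2)
    simp only [u, v, Pi.smul_apply, hw, smul_eq_mul, Matrix.cons_val] at hxu hxv
    refine ext_chartIdx i fun j => ?_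
    simp only [u, v, M, LinearMap.add_apply, LinearMap.smulRight_apply, LinearMap.proj_apply,
      Submodule.coe_add, Submodule.coe_smul, Pi.add_apply, Pi.smul_apply, hw, smul_eq_mul]
    fin_cases j <;> simp [pow_add]
    · ring
    · ring
    · linear_combination hxv
    · linear_combination -hxu
  obtain ⟨p, hp⟩ : (1 : R) ∈ J := hJ ▸ trivial
  exact ⟨_, LinearMap.isCompl_of_proj fun x => by rw [hp, one_smul]⟩

theorem IsLocallyChart.isIsotropicPlane {L : Submodule R (Fin 4 → R)} (hL : IsLocallyChart L) :
    IsIsotropicPlane L where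
  isotropic := hL.isTotIsotropic
  summand := hL.exists_isCompl
  rank q := by
    obtain ⟨C, hC⟩ := hL.exists_isCompl
    obtain ⟨f, hf, i, t, h⟩ := hL q.asIdeal q.isPrime
    obtain ⟨ψ, hψ⟩ := exists_comp_away (algebraMap R q.asIdeal.ResidueField) f
      (isUnit_iff_ne_zero.2 fun h0 => hf (Ideal.algebraMap_residueField_eq_zero.1 h0))
    rw [rankAtStalk_eq_finrank_coordExtend hC, ← hψ, coordExtend_comp, h, coordExtend_chartPlane,
      finrank_chartPlane]

theorem isIsotropicPlane_iff (h2 : IsUnit (2 : R)) {L : Submodule R (Fin 4 → R)} :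
    IsIsotropicPlane L ↔ IsLocallyChart L :=
  ⟨fun h => h.isLocallyChart h2, fun h => h.isIsotropicPlane⟩

end IsotropicPlane

/-! ### The Grassmannian of isotropic planes of a hyperbolic space -/

section Hyperbolic

variable {k : Type u} [Field k] {Om : Type v} [AddCommGroup Om] [Module k Om]
  (E : Module.Basis (Fin 4) k Om)

/-- The coordinates on `R ⊗ Ω` with respect to a basis of `Ω`. -/
def coords (R : Type u) [CommRing R] [Algebra k R] : (R ⊗[k] Om) ≃ₗ[R] (Fin 4 → R) :=
  (E.baseChange R).equivFun

theorem coords_tmul {R : Type u} [CommRing R] [Algebra k R] (a : R) (x : Om) (j : Fin 4) :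
    coords E R (a ⊗ₜ x) j = a * algebraMap k R (E.equivFun x j) := by
  simp [coords, Algebra.smul_def, mul_comm]

theorem coords_map {R S : Type u} [CommRing R] [Algebra k R] [CommRing S] [Algebra k S]
    (f : R →ₐ[k] S) (x : R ⊗[k] Om) :
    coords E S (TensorProduct.map f.toLinearMap (LinearMap.id : Om →ₗ[k] Om) x) =
      f.toRingHom ∘ coords E R x := by
  induction x using TensorProduct.induction_on with
  | zero => ext; simp
  | tmul a x => ext; simp [coords_tmul]
  | add x y hx hy =>
    rw [map_add, map_add, hx, hy, map_add]
    ext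
    simp

theorem map_coords_extend {R S : Type u} [CommRing R] [Algebra k R] [CommRing S] [Algebra k S]
    (f : R →ₐ[k] S) (L : Submodule R (R ⊗[k] Om)) :
    (extend f L).map (coords E S).toLinearMap =
      coordExtend f.toRingHom (L.map (coords E R).toLinearMap) := by
  rw [extend, coordExtend, Submodule.map_span, Submodule.map_coe, Set.image_image, Set.image_image]
  congr 1
  exact Set.image_congr fun x _ => coords_map E f x

variable {E} {B : LinearMap.BilinForm k Om} {c : k} (hc : c ≠ 0)
  (hB : ∀ x y, B x y = c * hypForm (E.equivFun x) (E.equivFun y))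

include hB in
theorem baseChange_eq_hypForm {R : Type u} [CommRing R] [Algebra k R] (x y : R ⊗[k] Om) :
    B.baseChange R x y = algebraMap k R c * hypForm (coords E R x) (coords E R y) := by
  induction x using TensorProduct.induction_on with
  | zero => simp [hypForm]
  | add x x' hx hx' =>
    rw [map_add, LinearMap.add_apply, hx, hx', map_add]
    simp only [hypForm, Pi.add_apply]
    ring
  | tmul a x =>
    induction y using TensorProduct.induction_on with
    | zero => simp [hypForm]
    | add y y' hy hy' =>
      rw [map_add, hy, hy', map_add]
      simp only [hypForm, Pi.add_apply]
      ring
    | tmul b y =>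
      rw [LinearMap.BilinForm.baseChange_tmul, hB]
      simp only [hypForm, coords_tmul, Algebra.smul_def, map_mul, map_sub, map_add]
      ring

include hc hB in
-- The scalar `c` is a unit in every `k`-algebra, so `B` and `hypForm` have the same isotropic
-- submodules; complements and ranks are carried along by the coordinates.
theorem isIsotropicSummand_iff (h2 : (2 : k) ≠ 0) {R : Type u} [CommRing R] [Algebra k R]
    (L : Submodule R (R ⊗[k] Om)) :
    IsIsotropicSummand B 2 R L ↔ IsLocallyChart (L.map (coords E R).toLinearMap) := by
  have h2R : IsUnit (2 : R) := by
    have := (isUnit_iff_ne_zero.2 h2).map (algebraMap k R)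
    rwa [map_ofNat] at this
  have hcR : IsUnit (algebraMap k R c) := (isUnit_iff_ne_zero.2 hc).map _
  rw [← isIsotropicPlane_iff h2R]
  have hrank : Module.rankAtStalk (R := R) L =
      Module.rankAtStalk (R := R) (L.map (coords E R).toLinearMap) :=
    Module.rankAtStalk_eq_of_equiv ((coords E R).submoduleMap L)
  let o := Submodule.orderIsoMapComap (coords E R)
  constructor
  · rintro ⟨hiso, ⟨C, hC⟩, hr⟩
    refine ⟨?_, ⟨o C, o.isCompl hC⟩, fun q => hrank ▸ hr q⟩
    rintro _ ⟨x, hx, rfl⟩ _ ⟨y, hy, rfl⟩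
    have := hiso x hx y hy
    rw [baseChange_eq_hypForm hB] at this
    exact hcR.mul_right_eq_zero.1 this
  · rintro ⟨hiso, ⟨C, hC⟩, hr⟩
    refine ⟨fun x hx y hy => ?_, ⟨o.symm C, (o.isCompl_iff).2 ?_⟩, fun q => hrank ▸ hr q⟩
    · rw [baseChange_eq_hypForm hB]
      have := hiso _ (Submodule.mem_map_of_mem hx) _ (Submodule.mem_map_of_mem hy)
      exact (hcR.mul_right_eq_zero).2 this
    · rw [o.apply_symm_apply]
      exact hC

/-- Isotropic summands in coordinates. -/
def isotropicSummandEquiv (h2 : (2 : k) ≠ 0) (R : Type u) [CommRing R] [Algebra k R] :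
    {L : Submodule R (R ⊗[k] Om) // IsIsotropicSummand B 2 R L} ≃
      {L : Submodule R (Fin 4 → R) // IsLocallyChart L} :=
  (Submodule.orderIsoMapComap (coords E R)).toEquiv.subtypeEquiv
    (fun L => isIsotropicSummand_iff hc hB h2 L)

include hc hB in
/-- The disjoint union of two projective lines is the Grassmannian of isotropic planes. -/
theorem exists_twoLines_points (h2 : (2 : k) ≠ 0) :
    ∃ Y : OrthogonalGrassmannian B 2, ∃ h : Y.X = twoLines k,
      ∀ (R : Type u) [CommRing R] [Algebra k R] (i : Bool × Fin 2) (t : R),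
        ((Y.points R (lineChart i.2 t ≫ lineIncl k i.1 ≫ eqToHom h.symm)).1).map
          (coords E R).toLinearMap = chartPlane i t := by
  -- Both sheaves have the gluing relation `ChartRel` between their four charts.
  obtain ⟨e, he, hchart⟩ := ChartedSheaf.exists_equiv (twoLinesSheaf k) (planeSheaf k)
    (fun R _ _ i j t s =>
      (twoLinesSheaf_chart_eq_iff i j t s).trans (planeSheaf_chart_eq_iff i j t s).symm)
  refine ⟨⟨twoLines k, fun R _ _ => (e R).trans (isotropicSummandEquiv hc hB h2 R).symm,
    fun R S _ _ _ _ f g => ?_⟩, rfl, fun R _ _ i t => ?_⟩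
  · apply Submodule.map_injective_of_injective (coords E S).injective
    have h1 : ∀ (R : Type u) [CommRing R] [Algebra k R] (x : specOver k R ⟶ twoLines k),
        (((isotropicSummandEquiv hc hB h2 R).symm (e R x)).1).map (coords E R).toLinearMap =
          (e R x).1 := fun R _ _ x =>
      congrArg Subtype.val ((isotropicSummandEquiv hc hB h2 R).apply_symm_apply (e R x))
    change (((isotropicSummandEquiv hc hB h2 S).symm (e S (specOverMap f ≫ g))).1).map _ =
      (extend f ((isotropicSummandEquiv hc hB h2 R).symm (e R g)).1).map _
    rw [map_coords_extend]
    refine (h1 S _).trans ?_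
    refine Eq.trans ?_ (congrArg _ (h1 R g).symm)
    exact congrArg Subtype.val (he R S f g)
  · have h1 := congrArg Subtype.val (hchart R i t)
    have h3 := congrArg Subtype.val ((isotropicSummandEquiv hc hB h2 R).apply_symm_apply
      (e R ((twoLinesSheaf k).chart i t)))
    rw [eqToHom_refl, Category.comp_id, ← specOverMap_aeval_twoLinesChart]
    exact h3.trans h1

include hc hB in
/-- Every Grassmannian of isotropic planes is the disjoint union of two projective lines. -/
theorem exists_iso_twoLines (h2 : (2 : k) ≠ 0) (Y : OrthogonalGrassmannian B 2) :
    ∃ θ : twoLines k ≅ Y.X,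
      ∀ (R : Type u) [CommRing R] [Algebra k R] (i : Bool × Fin 2) (t : R),
        ((Y.points R ((lineChart i.2 t ≫ lineIncl k i.1) ≫ θ.hom)).1).map
          (coords E R).toLinearMap = chartPlane i t := by
  obtain ⟨Y₀, h, hY₀⟩ := exists_twoLines_points hc hB h2
  obtain ⟨X₀, points₀, comp₀⟩ := Y₀
  dsimp only at h
  subst h
  -- Two schemes that represent the same functor: the composite of the two bijections is natural and
  -- hence an isomorphism of schemes.
  obtain ⟨θ, hθ⟩ := exists_iso_of_points (fun R _ _ => (points₀ R).trans (Y.points R).symm)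
    (fun R S _ _ _ _ φ x => by
      rw [Equiv.trans_apply, Equiv.symm_apply_eq]
      apply Subtype.ext
      rw [comp₀, Y.points_comp, Equiv.trans_apply, Equiv.apply_symm_apply])
  refine ⟨θ, fun R _ _ i t => ?_⟩
  rw [hθ, Equiv.trans_apply, Equiv.apply_symm_apply]
  have := hY₀ R i t
  simpa using this

end Hyperbolic

/-! ### Flags of isotropic subspaces of the hyperbolic space over a field -/

section Flags

variable {K : Type u} [Field K]

/-- The isometries of determinant one of the hyperbolic form. -/
structure IsHypIsometry (g : (Fin 4 → K) ≃ₗ[K] (Fin 4 → K)) : Prop where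
  form : ∀ x y, hypForm (g x) (g y) = hypForm x y
  det : LinearMap.det (g : (Fin 4 → K) →ₗ[K] (Fin 4 → K)) = 1

theorem IsHypIsometry.trans {g h : (Fin 4 → K) ≃ₗ[K] (Fin 4 → K)} (hg : IsHypIsometry g)
    (hh : IsHypIsometry h) : IsHypIsometry (g.trans h) where
  form x y := by
    rw [LinearEquiv.trans_apply, LinearEquiv.trans_apply, hh.form, hg.form]
  det := by
    rw [LinearEquiv.coe_trans, LinearMap.det_comp, hg.det, hh.det, one_mul]

theorem IsHypIsometry.symm {g : (Fin 4 → K) ≃ₗ[K] (Fin 4 → K)} (hg : IsHypIsometry g) :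
    IsHypIsometry g.symm where
  form x y := by
    rw [← hg.form, g.apply_symm_apply, g.apply_symm_apply]
  det := by
    have h := g.det_symm_mul_det
    rwa [hg.det, mul_one] at h

/-- An isometry of determinant one carries the flag `l ⊂ P` to the flag `l' ⊂ P'`. -/
def FlagCarried (l P l' P' : Submodule K (Fin 4 → K)) : Prop :=
  ∃ g : (Fin 4 → K) ≃ₗ[K] (Fin 4 → K), IsHypIsometry g ∧
    l.map (g : (Fin 4 → K) →ₗ[K] (Fin 4 → K)) = l' ∧
    P.map (g : (Fin 4 → K) →ₗ[K] (Fin 4 → K)) = P'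

theorem FlagCarried.trans {l P l' P' l'' P'' : Submodule K (Fin 4 → K)}
    (h : FlagCarried l P l' P') (h' : FlagCarried l' P' l'' P'') : FlagCarried l P l'' P'' := by
  obtain ⟨g, hg, rfl, rfl⟩ := h
  obtain ⟨g', hg', rfl, rfl⟩ := h'
  exact ⟨g.trans g', hg.trans hg', Submodule.map_comp _ _ _, Submodule.map_comp _ _ _⟩

theorem FlagCarried.symm {l P l' P' : Submodule K (Fin 4 → K)}
    (h : FlagCarried l P l' P') : FlagCarried l' P' l P := by
  obtain ⟨g, hg, rfl, rfl⟩ := h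
  refine ⟨g.symm, hg.symm, ?_, ?_⟩ <;>
    rw [← Submodule.map_comp, LinearEquiv.comp_coe, LinearEquiv.self_trans_symm] <;>
    exact Submodule.map_id _

/-- The exchange of the second and the third coordinate. -/
def swapMid : (Fin 4 → K) ≃ₗ[K] (Fin 4 → K) := LinearEquiv.funCongrLeft K K (Equiv.swap 1 2)

theorem swapMid_apply (x : Fin 4 → K) (j : Fin 4) : swapMid x j = x (Equiv.swap 1 2 j) := rfl

theorem swapMid_swapMid (x : Fin 4 → K) : swapMid (swapMid x) = x := by
  ext j
  simp [swapMid_apply]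

theorem hypForm_swapMid (x y : Fin 4 → K) : hypForm (swapMid x) (swapMid y) = hypForm x y := by
  have h0 : Equiv.swap (1 : Fin 4) 2 0 = 0 := by decide
  have h1 : Equiv.swap (1 : Fin 4) 2 1 = 2 := by decide
  have h2 : Equiv.swap (1 : Fin 4) 2 2 = 1 := by decide
  have h3 : Equiv.swap (1 : Fin 4) 2 3 = 3 := by decide
  simp only [hypForm, swapMid_apply, h0, h1, h2, h3]
  ring

theorem swap_chartIdx (ε : Bool) (j : Fin 2) (n : Fin 4) :
    Equiv.swap 1 2 (chartIdx (ε, j) n) = chartIdx (!ε, j) n := by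
  revert ε j n
  decide

theorem swapMid_mem_chartPlane {ε : Bool} {j : Fin 2} {t : K} {x : Fin 4 → K} :
    swapMid x ∈ chartPlane (ε, j) t ↔ x ∈ chartPlane (!ε, j) t := by
  simp only [mem_chartPlane, swapMid_apply, swap_chartIdx]

theorem map_swapMid_chartPlane (ε : Bool) (j : Fin 2) (t : K) :
    (chartPlane (ε, j) t).map (swapMid : (Fin 4 → K) ≃ₗ[K] (Fin 4 → K)).toLinearMap =
      chartPlane (!ε, j) t := by
  ext x
  constructor
  · rintro ⟨y, hy, rfl⟩
    exact swapMid_mem_chartPlane.2 (by rwa [Bool.not_not])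
  · intro hx
    exact ⟨swapMid x, swapMid_mem_chartPlane.2 hx, swapMid_swapMid x⟩

theorem map_swapMid_map_swapMid (l : Submodule K (Fin 4 → K)) :
    (l.map (swapMid : (Fin 4 → K) ≃ₗ[K] (Fin 4 → K)).toLinearMap).map
      (swapMid : (Fin 4 → K) ≃ₗ[K] (Fin 4 → K)).toLinearMap = l := by
  rw [← Submodule.map_comp]
  convert Submodule.map_id l
  exact LinearMap.ext fun x => swapMid_swapMid x

/-- The exchange of the middle coordinates has determinant `-1`, but conjugation by it preserves
isometries of determinant one. So results for one ruling carry over to the other. -/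
theorem FlagCarried.map_swapMid {l P l' P' : Submodule K (Fin 4 → K)}
    (h : FlagCarried l P l' P') :
    FlagCarried (l.map (swapMid : (Fin 4 → K) ≃ₗ[K] (Fin 4 → K)).toLinearMap)
      (P.map (swapMid : (Fin 4 → K) ≃ₗ[K] (Fin 4 → K)).toLinearMap)
      (l'.map (swapMid : (Fin 4 → K) ≃ₗ[K] (Fin 4 → K)).toLinearMap)
      (P'.map (swapMid : (Fin 4 → K) ≃ₗ[K] (Fin 4 → K)).toLinearMap) := by
  obtain ⟨g, hg, rfl, rfl⟩ := h
  let s : (Fin 4 → K) ≃ₗ[K] (Fin 4 → K) := swapMid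
  have hs : s.symm = s := by
    ext x : 1
    rw [LinearEquiv.symm_apply_eq]
    exact (swapMid_swapMid x).symm
  have key : ∀ Q : Submodule K (Fin 4 → K), (Q.map s.toLinearMap).map
      ((s.symm.trans g).trans s).toLinearMap = (Q.map g.toLinearMap).map s.toLinearMap := fun Q => by
    rw [← Submodule.map_comp, ← Submodule.map_comp]
    congr 1
    exact LinearMap.ext fun x => by simp
  refine ⟨(s.symm.trans g).trans s, ⟨fun x y => ?_, ?_⟩, key _, key _⟩
  · rw [hs]
    exact (hypForm_swapMid _ _).trans ((hg.form _ _).trans (hypForm_swapMid _ _))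
  · have := LinearMap.det_conj (g : (Fin 4 → K) →ₗ[K] (Fin 4 → K)) s
    rw [hg.det] at this
    exact this

/-- The transformation `X ↦ A X Bᵀ` of the space of two by two matrices. -/
def kronMap (A B : Matrix (Fin 2) (Fin 2) K) : Matrix (Fin 4) (Fin 4) K :=
  !![A 0 0 * B 0 0, A 0 0 * B 0 1, A 0 1 * B 0 0, A 0 1 * B 0 1;
     A 0 0 * B 1 0, A 0 0 * B 1 1, A 0 1 * B 1 0, A 0 1 * B 1 1;
     A 1 0 * B 0 0, A 1 0 * B 0 1, A 1 1 * B 0 0, A 1 1 * B 0 1;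
     A 1 0 * B 1 0, A 1 0 * B 1 1, A 1 1 * B 1 0, A 1 1 * B 1 1]

theorem det_kronMap (A B : Matrix (Fin 2) (Fin 2) K) :
    (kronMap A B).det = A.det ^ 2 * B.det ^ 2 := by
  rw [Matrix.det_succ_row_zero]
  simp [Fin.sum_univ_succ, Matrix.det_fin_three, Matrix.det_fin_two, kronMap, Fin.succAbove]
  ring

theorem kronMap_mulVec (A B : Matrix (Fin 2) (Fin 2) K) (x : Fin 4 → K) :
    (kronMap A B).mulVec x =
      ![A 0 0 * (B 0 0 * x 0 + B 0 1 * x 1) + A 0 1 * (B 0 0 * x 2 + B 0 1 * x 3),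
        A 0 0 * (B 1 0 * x 0 + B 1 1 * x 1) + A 0 1 * (B 1 0 * x 2 + B 1 1 * x 3),
        A 1 0 * (B 0 0 * x 0 + B 0 1 * x 1) + A 1 1 * (B 0 0 * x 2 + B 0 1 * x 3),
        A 1 0 * (B 1 0 * x 0 + B 1 1 * x 1) + A 1 1 * (B 1 0 * x 2 + B 1 1 * x 3)] := by
  ext j
  fin_cases j <;> simp [kronMap, Matrix.mulVec, dotProduct, Fin.sum_univ_succ] <;> ring

/-- `hypForm` is the polar form of the determinant on two by two matrices, and the determinant of `A
X Bᵀ` is that of `X`. -/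
theorem exists_kron_isometry (A B : Matrix (Fin 2) (Fin 2) K) (hA : A.det = 1) (hB : B.det = 1) :
    ∃ g : (Fin 4 → K) ≃ₗ[K] (Fin 4 → K), IsHypIsometry g ∧
      ∀ x, g x = (kronMap A B).mulVec x := by
  have hdet : (kronMap A B).det = 1 := by rw [det_kronMap, hA, hB]; ring
  have h' : LinearMap.det (Matrix.toLin' (kronMap A B)) = 1 := by
    rw [LinearMap.det_toLin', hdet]
  let g := LinearEquiv.ofIsUnitDet (f := Matrix.toLin' (kronMap A B))
    (v := Pi.basisFun K (Fin 4)) (v' := Pi.basisFun K (Fin 4)) (by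
      rw [LinearMap.toMatrix_eq_toMatrix', LinearMap.toMatrix'_toLin', hdet]
      exact isUnit_one)
  have hg : ∀ x, g x = (kronMap A B).mulVec x := fun x => Matrix.toLin'_apply _ _
  refine ⟨g, ⟨fun x y => ?_, h'⟩, hg⟩
  rw [Matrix.det_fin_two] at hA hB
  rw [hg, hg, kronMap_mulVec, kronMap_mulVec]
  simp only [hypForm, Matrix.cons_val]
  linear_combination (x 0 * y 3 + x 3 * y 0 - x 1 * y 2 - x 2 * y 1) *
    ((B 0 0 * B 1 1 - B 0 1 * B 1 0) * hA + hB)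

theorem exists_det_one_col {b : Fin 2 → K} (hb : b ≠ 0) :
    ∃ B : Matrix (Fin 2) (Fin 2) K, B.det = 1 ∧ B 0 0 = b 0 ∧ B 1 0 = b 1 := by
  by_cases h0 : b 0 = 0
  · have h1 : b 1 ≠ 0 := fun h1 => hb (by ext j; fin_cases j <;> assumption)
    exact ⟨!![b 0, -(b 1)⁻¹; b 1, 0], by rw [Matrix.det_fin_two]; simp [h1], rfl, rfl⟩
  · exact ⟨!![b 0, 0; b 1, (b 0)⁻¹], by rw [Matrix.det_fin_two]; simp [h0], rfl, rfl⟩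

variable (K) in
/-- The line of the standard flags. -/
def stdLine : Submodule K (Fin 4 → K) := Submodule.span K {Pi.single 0 1}

/-- `X ↦ A X Bᵀ` sends the first elementary matrix to the product of the first columns of `A` and
`B`. The column of `A` is chosen to give the plane of the ruling, that of `B` to give the line `l`
in this plane. -/
theorem flagCarried_std_true {l : Submodule K (Fin 4 → K)} (hl : Module.finrank K l = 1)
    (j : Fin 2) (t : K) (hle : l ≤ chartPlane (true, j) t) :
    FlagCarried (stdLine K) (chartPlane (true, 0) 0) l (chartPlane (true, j) t) := by
  obtain ⟨w, hw0, hw⟩ := finrank_eq_one_iff'.1 hl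
  have hlw : l = Submodule.span K {w.1} := by
    apply le_antisymm
    · intro y hy
      obtain ⟨c, hc⟩ := hw ⟨y, hy⟩
      rw [Submodule.mem_span_singleton]
      exact ⟨c, congrArg Subtype.val hc⟩
    · rw [Submodule.span_singleton_le_iff_mem]
      exact w.2
  have hwm := hle w.2
  have hw1 := eq_chartVec hwm
  have hne : ![w.1 (chartIdx (true, j) 0), w.1 (chartIdx (true, j) 1)] ≠ 0 := fun h => hw0 (by
    have h0 := congrFun h 0
    have h1 := congrFun h 1
    simp at h0 h1
    apply Subtype.ext
    rw [hw1, h0, h1]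
    refine ext_chartIdx (true, j) fun n => ?_
    fin_cases n <;> simp [chartVec_apply])
  obtain ⟨B, hB, hB0, hB1⟩ := exists_det_one_col hne
  obtain ⟨A, hA, hA0, hA1⟩ : ∃ A : Matrix (Fin 2) (Fin 2) K, A.det = 1 ∧
      A 0 0 = ![1, t] j ∧ A 1 0 = ![t, 1] j := by
    refine exists_det_one_col (b := ![![1, t] j, ![t, 1] j]) fun h => ?_
    have h0 := congrFun h 0
    have h1 := congrFun h 1
    fin_cases j <;> simp at h0 h1
  obtain ⟨g, hg, hgx⟩ := exists_kron_isometry A B hA hB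
  have hge : g (Pi.single 0 1) = w.1 := by
    rw [hgx, kronMap_mulVec]
    rw [mem_chartPlane] at hwm
    fin_cases j <;> simp [chartIdx] at hwm hA0 hA1 hB0 hB1 <;> ext n <;> fin_cases n <;>
      simp [hA0, hA1, hB0, hB1, hwm]
  have hle' : (chartPlane (true, 0) (0 : K)).map (g : (Fin 4 → K) →ₗ[K] (Fin 4 → K)) ≤
      chartPlane (true, j) t := by
    rintro _ ⟨x, hx, rfl⟩
    rw [SetLike.mem_coe, mem_chartPlane] at hx
    simp [chartIdx] at hx
    rw [mem_chartPlane, LinearEquiv.coe_coe, hgx, kronMap_mulVec]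
    fin_cases j <;> simp at hA0 hA1 <;> simp [chartIdx, hA0, hA1, hx]
  refine ⟨g, hg, ?_, ?_⟩
  · rw [stdLine, Submodule.map_span, Set.image_singleton, LinearEquiv.coe_coe, hge, ← hlw]
  · refine Submodule.eq_of_le_of_finrank_eq hle' ?_
    rw [LinearEquiv.finrank_map_eq, finrank_chartPlane, finrank_chartPlane]

theorem map_swapMid_stdLine :
    (stdLine K).map (swapMid : (Fin 4 → K) ≃ₗ[K] (Fin 4 → K)).toLinearMap = stdLine K := by
  rw [stdLine, Submodule.map_span, Set.image_singleton]
  congr 2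
  ext j
  rw [LinearEquiv.coe_coe, swapMid_apply]
  fin_cases j <;> rfl

theorem flagCarried_std {l : Submodule K (Fin 4 → K)} (hl : Module.finrank K l = 1)
    (i : Bool × Fin 2) (t : K) (hle : l ≤ chartPlane i t) :
    FlagCarried (stdLine K) (chartPlane (i.1, 0) 0) l (chartPlane i t) := by
  obtain ⟨_ | _, j⟩ := i
  · have h := flagCarried_std_true
      (l := l.map (swapMid : (Fin 4 → K) ≃ₗ[K] (Fin 4 → K)).toLinearMap)
      (by rw [LinearEquiv.finrank_map_eq, hl]) j t (by
        rw [← Bool.not_false, ← map_swapMid_chartPlane]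
        exact Submodule.map_mono hle)
    have h' := h.map_swapMid
    rwa [map_swapMid_map_swapMid, map_swapMid_stdLine, map_swapMid_chartPlane,
      map_swapMid_chartPlane] at h'
  · exact flagCarried_std_true hl j t hle

theorem not_flagCarried_std (h2 : (2 : K) ≠ 0) :
    ¬ FlagCarried (stdLine K) (chartPlane (true, 0) 0) (stdLine K) (chartPlane (false, 0) 0) := by
  rintro ⟨g, hg, hl, hP⟩
  have h0 : g (Pi.single 0 1) ∈ stdLine K := by
    rw [← hl]
    exact Submodule.mem_map_of_mem (Submodule.mem_span_singleton_self _)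
  have h1 : g (Pi.single 1 1) ∈ chartPlane (false, 0) (0 : K) := by
    rw [← hP]
    refine Submodule.mem_map_of_mem ?_
    rw [mem_chartPlane]
    simp [chartIdx]
  obtain ⟨α, hα⟩ := Submodule.mem_span_singleton.1 h0
  rw [mem_chartPlane] at h1
  simp [chartIdx] at h1
  have e03 := hg.form (Pi.single 0 1) (Pi.single 3 1)
  have e02 := hg.form (Pi.single 0 1) (Pi.single 2 1)
  have e12 := hg.form (Pi.single 1 1) (Pi.single 2 1)
  have hdet := hg.det
  rw [← LinearMap.det_toMatrix', Matrix.det_succ_row_zero] at hdet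
  simp [Fin.sum_univ_succ, Matrix.det_fin_three, Fin.succAbove, LinearMap.toMatrix'_apply,
    ← hα, h1] at hdet
  simp [hypForm, ← hα, h1] at e03 e02 e12
  generalize g (Pi.single 1 1) = v at *
  generalize g (Pi.single 2 1) = x at *
  generalize g (Pi.single 3 1) = y at *
  -- The isometry conditions give `α y₃ = 1`, `x₃ = 0` and `v₂ x₁ = 1`, whereas the determinant is
  -- `-α v₂ x₁ y₃`. So the determinant is both `1` and `-1`.
  have hα0 : α ≠ 0 := fun h => by simp [h] at e03
  have hx3 : x 3 = 0 := e02.resolve_left hα0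
  rw [hx3] at e12 hdet
  exact h2 (by linear_combination -hdet + α * y 3 * e12 - e03)

/-- Two flags are in the same component if and only if their planes are in the same family. -/
theorem flagCarried_iff (h2 : (2 : K) ≠ 0) {l l' : Submodule K (Fin 4 → K)}
    (hl : Module.finrank K l = 1) (hl' : Module.finrank K l' = 1) {i i' : Bool × Fin 2} {t t' : K}
    (hle : l ≤ chartPlane i t) (hle' : l' ≤ chartPlane i' t') :
    FlagCarried l (chartPlane i t) l' (chartPlane i' t') ↔ i.1 = i'.1 := by
  have h := flagCarried_std hl i t hle
  have h' := flagCarried_std hl' i' t' hle'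
  constructor
  · intro hc
    have hs := (h.trans hc).trans h'.symm
    by_contra hne
    generalize i.1 = ε at hs hne
    generalize i'.1 = δ at hs hne
    cases ε <;> cases δ
    · exact hne rfl
    · exact not_flagCarried_std h2 hs.symm
    · exact not_flagCarried_std h2 hs
    · exact hne rfl
  · intro hi
    rw [hi] at h
    exact h.symm.trans h'

/-- Two lines of opposite rulings of a quadric surface meet in one point. These charts suffice,
because Frobenius preserves the second index of a chart. -/
theorem finrank_chartPlane_inf (ε : Bool) (j : Fin 2) (t s : K) :
    Module.finrank K
      (chartPlane (ε, j) t ⊓ chartPlane (!ε, j) s : Submodule K (Fin 4 → K)) = 1 := by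
  obtain ⟨v, hv0, hv⟩ : ∃ v : Fin 4 → K, v ≠ 0 ∧
      (chartPlane (ε, j) t ⊓ chartPlane (!ε, j) s : Submodule K (Fin 4 → K)) =
        Submodule.span K {v} := by
    -- The rank one matrix for which `t` and `s` are the ratios of the rows and of the columns, in
    -- the order given by `ε`.
    refine ⟨chartVec (ε, j) t (![1, s] j) (![s, 1] j), fun h => ?_, ?_⟩
    · have h0 := congrFun h (chartIdx (ε, j) 0)
      have h1 := congrFun h (chartIdx (ε, j) 1)
      rw [chartVec_apply] at h0 h1
      fin_cases j <;> simp at h0 h1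
    · ext x
      rw [Submodule.mem_inf, mem_chartPlane, mem_chartPlane, Submodule.mem_span_singleton]
      constructor
      · rintro ⟨⟨e1, e2⟩, e3, e4⟩
        refine ⟨x (chartIdx (ε, j) (![0, 1] j)), ext_chartIdx (ε, j) fun n => ?_⟩
        rw [Pi.smul_apply, chartVec_apply]
        cases ε <;> fin_cases j <;> simp [chartIdx] at e1 e2 e3 e4 <;> fin_cases n <;>
          simp [chartIdx, e1, e2, e3, e4] <;> ring
      · rintro ⟨a, rfl⟩
        have e := fun n => chartVec_apply (ε, j) t (![1, s] j) (![s, 1] j) n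
        simp only [Fin.forall_fin_succ, IsEmpty.forall_iff] at e
        cases ε <;> fin_cases j <;> simp [chartIdx] at e <;> simp [chartIdx, e] <;>
          refine ⟨⟨?_, ?_⟩, ?_, ?_⟩ <;> ring
  rw [hv]
  exact finrank_span_singleton hv0

theorem finrank_chartPlane_sup (ε : Bool) (j : Fin 2) (t s : K) :
    Module.finrank K
      (chartPlane (ε, j) t ⊔ chartPlane (!ε, j) s : Submodule K (Fin 4 → K)) = 3 := by
  have h := Submodule.finrank_sup_add_finrank_inf_eq (chartPlane (ε, j) t) (chartPlane (!ε, j) s)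
  rw [finrank_chartPlane_inf, finrank_chartPlane, finrank_chartPlane] at h
  omega

theorem coordExtend_id (L : Submodule K (Fin 4 → K)) : coordExtend (RingHom.id K) L = L := by
  rw [coordExtend]
  have : (fun v : Fin 4 → K => RingHom.id K ∘ v) = id := rfl
  rw [this, Set.image_id, Submodule.span_eq]

/-- Over a field, an isotropic plane is given by a chart. -/
theorem IsLocallyChart.exists_eq_chartPlane {L : Submodule K (Fin 4 → K)} (h : IsLocallyChart L) :
    ∃ i t, L = chartPlane i t := by
  obtain ⟨f, hf, i, t, hL⟩ := h ⊥ Ideal.isPrime_bot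
  obtain ⟨ψ, hψ⟩ := exists_comp_away (RingHom.id K) f (isUnit_iff_ne_zero.2 fun h => hf h)
  refine ⟨i, ψ t, ?_⟩
  rw [← coordExtend_id L, ← hψ, coordExtend_comp, hL, coordExtend_chartPlane]

theorem IsTotIsotropic.exists_eq_chartPlane (h2 : (2 : K) ≠ 0) {L : Submodule K (Fin 4 → K)}
    (h : IsTotIsotropic L) (hr : Module.finrank K L = 2) : ∃ i t, L = chartPlane i t := by
  obtain ⟨i, y, hy, z, hz, hyz⟩ : ∃ i, ∃ y ∈ L, ∃ z ∈ L, chartMinor i y z ≠ 0 := by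
    by_contra! hcon
    have := h.finrank_le_one hcon
    omega
  obtain ⟨t, ht⟩ := h.eq_chartPlane (isUnit_iff_ne_zero.2 h2) i hy hz (isUnit_iff_ne_zero.2 hyz)
  exact ⟨i, t, ht⟩

theorem chartPlane_family_eq {i j : Bool × Fin 2} {t s : K}
    (h : chartPlane i t = chartPlane j s) : i.1 = j.1 := by
  rw [chartPlane_eq_iff, ChartRel] at h
  by_contra hne
  rw [if_neg hne] at h
  exact not_subsingleton K h

end Flags

/-! ### Components of flags and the Deligne–Lusztig condition in coordinates -/

section Components

variable {k : Type u} [Field k] {Om : Type v} [AddCommGroup Om] [Module k Om]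
  (E : Module.Basis (Fin 4) k Om) {K : Type u} [Field K] [Algebra k K]

theorem map_coords_baseChange (P : Submodule k Om) :
    (P.baseChange K).map (coords E K).toLinearMap =
      coordExtend (algebraMap k K) (P.map E.equivFun.toLinearMap) := by
  rw [Submodule.baseChange_eq_span, Submodule.map_span, coordExtend]
  congr 1
  have he : ∀ x : Om, coords E K (1 ⊗ₜ x) = algebraMap k K ∘ E.equivFun x := fun x => by
    ext j
    rw [coords_tmul, one_mul]
    rfl
  ext x
  simp only [Set.mem_image, SetLike.mem_coe, Submodule.mem_map]
  constructor
  · rintro ⟨_, ⟨y, hy, rfl⟩, rfl⟩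
    exact ⟨_, ⟨y, hy, rfl⟩, (he y).symm⟩
  · rintro ⟨_, ⟨y, hy, rfl⟩, rfl⟩
    exact ⟨_, ⟨y, hy, rfl⟩, he y⟩

theorem finrank_submodule_baseChange (P : Submodule k Om) :
    Module.finrank K (P.baseChange K) = Module.finrank k P := by
  have hinj : Function.Injective (P.subtype.baseChange K) :=
    Module.Flat.lTensor_preserves_injective_linearMap (M := K) P.subtype P.subtype_injective
  exact (LinearMap.finrank_range_of_inj hinj).trans Module.finrank_baseChange

variable {B : LinearMap.BilinForm k Om} {c : k} (hc : c ≠ 0)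
  (hB : ∀ x y, B x y = c * hypForm (E.equivFun x) (E.equivFun y))

include hc hB in
theorem isSpecialOrthogonal_conj_iff (g : (K ⊗[k] Om) ≃ₗ[K] (K ⊗[k] Om)) :
    IsSpecialOrthogonal B K g ↔
      IsHypIsometry (((coords E K).symm.trans g).trans (coords E K)) := by
  have hdet := LinearMap.det_conj (g : (K ⊗[k] Om) →ₗ[K] (K ⊗[k] Om)) (coords E K)
  have hcK : algebraMap k K c ≠ 0 := (map_ne_zero _).2 hc
  constructor
  · rintro ⟨h1, h2⟩
    refine ⟨fun x y => ?_, hdet.trans h2⟩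
    have := h1 ((coords E K).symm x) ((coords E K).symm y)
    rw [baseChange_eq_hypForm hB, baseChange_eq_hypForm hB, LinearEquiv.apply_symm_apply,
      LinearEquiv.apply_symm_apply] at this
    exact mul_left_cancel₀ hcK this
  · rintro ⟨h1, h2⟩
    refine ⟨fun x y => ?_, hdet.symm.trans h2⟩
    have := h1 (coords E K x) (coords E K y)
    rw [baseChange_eq_hypForm hB, baseChange_eq_hypForm hB]
    simp only [LinearEquiv.trans_apply, LinearEquiv.symm_apply_apply] at this
    rw [this]

include hc hB in
theorem carriedTo_iff_flagCarried (F : IsotropicFlag B 2) (l P : Submodule K (K ⊗[k] Om)) :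
    F.CarriedTo K l P ↔ FlagCarried ((F.small.baseChange K).map (coords E K).toLinearMap)
      ((F.big.baseChange K).map (coords E K).toLinearMap)
      (l.map (coords E K).toLinearMap) (P.map (coords E K).toLinearMap) := by
  have key : ∀ (g : (K ⊗[k] Om) ≃ₗ[K] (K ⊗[k] Om)) (Q : Submodule K (K ⊗[k] Om)),
      (Q.map (coords E K).toLinearMap).map
        (((coords E K).symm.trans g).trans (coords E K)).toLinearMap =
      (Q.map g.toLinearMap).map (coords E K).toLinearMap := fun g Q => by
    rw [← Submodule.map_comp, ← Submodule.map_comp]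
    congr 1
    exact LinearMap.ext fun x => by simp
  constructor
  · rintro ⟨g, hg, rfl, rfl⟩
    exact ⟨_, (isSpecialOrthogonal_conj_iff E hc hB g).1 hg, key g _, key g _⟩
  · rintro ⟨h, hh, hl, hP⟩
    let g := ((coords E K).trans h).trans (coords E K).symm
    have hgh : ((coords E K).symm.trans g).trans (coords E K) = h := by
      ext x : 1
      simp [g]
    have hinj := Submodule.map_injective_of_injective (f := (coords E K).toLinearMap)
      (coords E K).injective
    refine ⟨g, (isSpecialOrthogonal_conj_iff E hc hB g).2 (hgh ▸ hh), hinj ?_, hinj ?_⟩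
    · rw [← hl]
      exact (key g _).symm.trans (by rw [hgh])
    · rw [← hP]
      exact (key g _).symm.trans (by rw [hgh])

open Classical in
/-- The family to which the plane of a flag belongs. -/
def IsotropicFlag.family (F : IsotropicFlag B 2) : Bool :=
  decide (∃ (j : Fin 2) (t : k), F.big.map E.equivFun.toLinearMap = chartPlane (true, j) t)

variable {E} in
theorem IsotropicFlag.family_eq {F : IsotropicFlag B 2} {i : Bool × Fin 2} {t : k}
    (h : F.big.map E.equivFun.toLinearMap = chartPlane i t) : F.family E = i.1 := by
  classical
  rw [IsotropicFlag.family]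
  obtain ⟨_ | _, j⟩ := i
  · rw [decide_eq_false_iff_not]
    rintro ⟨j', t', h'⟩
    exact Bool.false_ne_true (chartPlane_family_eq (h.symm.trans h'))
  · rw [decide_eq_true_iff]
    exact ⟨j, t, h⟩

include hc hB in
theorem IsotropicFlag.exists_big_eq (h2 : (2 : k) ≠ 0) (F : IsotropicFlag B 2) :
    ∃ i t, F.big.map E.equivFun.toLinearMap = chartPlane i t := by
  apply IsTotIsotropic.exists_eq_chartPlane h2
  · rintro _ ⟨x, hx, rfl⟩ _ ⟨y, hy, rfl⟩
    have := F.isotropic x hx y hy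
    rw [hB] at this
    exact (mul_eq_zero.1 this).resolve_left hc
  · rw [LinearEquiv.finrank_map_eq, F.finrank_big]

include hc hB in
/-- A flag is carried to every flag of the same family. -/
theorem carriedTo_iff_family (h2 : (2 : k) ≠ 0) (F : IsotropicFlag B 2)
    {l P : Submodule K (K ⊗[k] Om)} {i : Bool × Fin 2} {t : K}
    (hP : P.map (coords E K).toLinearMap = chartPlane i t) (hle : l ≤ P)
    (hl : Module.finrank K l = 1) : F.CarriedTo K l P ↔ F.family E = i.1 := by
  obtain ⟨i', t', h⟩ := F.exists_big_eq E hc hB h2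
  have h2K : (2 : K) ≠ 0 := by
    have := (map_ne_zero (algebraMap k K)).2 h2
    rwa [map_ofNat] at this
  have hbig : (F.big.baseChange K).map (coords E K).toLinearMap =
      chartPlane i' (algebraMap k K t') := by
    rw [map_coords_baseChange, h, coordExtend_chartPlane]
  have hsmall : (F.small.baseChange K).map (coords E K).toLinearMap ≤
      chartPlane i' (algebraMap k K t') := by
    rw [← hbig]
    exact Submodule.map_mono (Submodule.baseChange_mono _ F.small_le)
  rw [carriedTo_iff_flagCarried E hc hB, hbig, hP, IsotropicFlag.family_eq h]
  refine flagCarried_iff h2K ?_ ?_ hsmall (hP ▸ Submodule.map_mono hle)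
  · rw [LinearEquiv.finrank_map_eq, finrank_submodule_baseChange, F.finrank_small]
  · rw [LinearEquiv.finrank_map_eq, hl]

include hc hB in
theorem carriedTo_self_iff_family (h2 : (2 : k) ≠ 0) (F G : IsotropicFlag B 2) :
    F.CarriedTo k (G.small.baseChange k) (G.big.baseChange k) ↔ F.family E = G.family E := by
  obtain ⟨i, t, h⟩ := G.exists_big_eq E hc hB h2
  rw [IsotropicFlag.family_eq h]
  refine carriedTo_iff_family E hc hB h2 F (t := t) ?_ (Submodule.baseChange_mono _ G.small_le) ?_
  · rw [map_coords_baseChange, h, coordExtend_chartPlane]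
    rfl
  · rw [finrank_submodule_baseChange, G.finrank_small]

include hB in
/-- The standard flag in a family. -/
theorem exists_flag_family (ε : Bool) : ∃ F : IsotropicFlag B 2, F.family E = ε := by
  let o := Submodule.orderIsoMapComap E.equivFun
  have hmem : (Pi.single 0 1 : Fin 4 → k) ∈ chartPlane (ε, 0) (0 : k) := by
    rw [mem_chartPlane]
    cases ε <;> simp [chartIdx]
  have hbig : (o.symm (chartPlane (ε, 0) 0)).map E.equivFun.toLinearMap =
      chartPlane (ε, 0) (0 : k) := o.apply_symm_apply _
  have hsmall : (o.symm (stdLine k)).map E.equivFun.toLinearMap = stdLine k :=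
    o.apply_symm_apply _
  let F : IsotropicFlag B 2 :=
    { small := o.symm (stdLine k)
      big := o.symm (chartPlane (ε, 0) 0)
      small_le := o.symm.monotone (by
        rw [stdLine, Submodule.span_singleton_le_iff_mem]
        exact hmem)
      finrank_small := by
        rw [← LinearEquiv.finrank_map_eq E.equivFun, hsmall, stdLine,
          finrank_span_singleton (by simp)]
      finrank_big := by
        rw [← LinearEquiv.finrank_map_eq E.equivFun, hbig, finrank_chartPlane]
      isotropic := fun x hx y hy => by
        rw [hB]
        exact mul_eq_zero_of_right c (hypForm_chartPlane hx hy) }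
  exact ⟨F, IsotropicFlag.family_eq (F := F) hbig⟩

include hc hB in
theorem exists_flagComponent_equiv (h2 : (2 : k) ≠ 0) :
    ∃ e : FlagComponent B 2 ≃ Bool, ∀ F, e (Quot.mk _ F) = F.family E := by
  let f : FlagComponent B 2 → Bool := Quot.lift (fun F => F.family E) fun F G h =>
    (carriedTo_self_iff_family E hc hB h2 F G).1 h
  refine ⟨Equiv.ofBijective f ⟨?_, ?_⟩, fun F => rfl⟩
  · rintro ⟨F⟩ ⟨G⟩ h
    exact Quot.sound ((carriedTo_self_iff_family E hc hB h2 F G).2 h)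
  · intro ε
    obtain ⟨F, hF⟩ := exists_flag_family E hB ε
    exact ⟨Quot.mk _ F, hF⟩

variable (p : ℕ) [Fact p.Prime] [CharP k p] {Φ : Om →ₛₗ[frobenius k p] Om}
  (hΦ : ∀ x j, E.equivFun (Φ x) j = E.equivFun x (Equiv.swap 1 2 j) ^ p)

include hΦ in
-- In coordinates, `Φ̄` raises parameters to the `p`-th power and transposes the matrix, so rows
-- become columns and the ruling changes.
theorem map_coords_phiBar {L : Submodule K (K ⊗[k] Om)} {ε : Bool} {j : Fin 2} {t : K}
    (hL : L.map (coords E K).toLinearMap = chartPlane (ε, j) t) :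
    (phiBar p Φ K L).map (coords E K).toLinearMap = chartPlane (!ε, j) (t ^ p) := by
  have : CharP K p := charP_of_injective_algebraMap (algebraMap k K).injective p
  have hfrob : ∀ z : K ⊗[k] Om, coords E K (frobExt p Φ K z) =
      swapMid (frobenius K p ∘ coords E K z) := fun z => by
    induction z using TensorProduct.induction_on with
    | zero => ext; simp [swapMid_apply]
    | tmul a x =>
      ext n
      rw [frobExt_tmul, coords_tmul, hΦ, swapMid_apply, Function.comp_apply, coords_tmul,
        frobenius_def, mul_pow, map_pow]
    | add x y hx hy =>
      rw [map_add, map_add, hx, hy, map_add]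
      ext
      simp [swapMid_apply]
  have h : (phiBar p Φ K L).map (coords E K).toLinearMap =
      (coordExtend (frobenius K p) (L.map (coords E K).toLinearMap)).map
        (swapMid : (Fin 4 → K) ≃ₗ[K] (Fin 4 → K)).toLinearMap := by
    rw [phiBar, coordExtend, Submodule.map_span, Submodule.map_span, Submodule.map_coe,
      Set.image_image, Set.image_image, Set.image_image]
    congr 1
    exact Set.image_congr fun z _ => hfrob z
  rw [h, hL, coordExtend_chartPlane, map_swapMid_chartPlane, frobenius_def]

include hΦ in
-- Nothing is required of `L` beyond being an isotropic plane: it and its Frobenius image lie in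
-- opposite rulings and span a space of dimension `2 + 2 - 1`.
theorem dlCondition_of_map_coords {L : Submodule K (K ⊗[k] Om)} {i : Bool × Fin 2} {t : K}
    (hL : L.map (coords E K).toLinearMap = chartPlane i t) : DLCondition p Φ 2 K L := by
  rw [DLCondition, ← LinearEquiv.finrank_map_eq (coords E K), Submodule.map_sup, hL,
    map_coords_phiBar E p hΦ hL, finrank_chartPlane_sup]

include hΦ in
theorem finrank_inf_phiBar {L : Submodule K (K ⊗[k] Om)} {i : Bool × Fin 2} {t : K}
    (hL : L.map (coords E K).toLinearMap = chartPlane i t) :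
    Module.finrank K (L ⊓ phiBar p Φ K L : Submodule K (K ⊗[k] Om)) = 1 := by
  rw [← LinearEquiv.finrank_map_eq (coords E K), Submodule.map_inf _ (coords E K).injective, hL,
    map_coords_phiBar E p hΦ hL, finrank_chartPlane_inf]

end Components

/-! ### The Deligne–Lusztig variety of a nonsplit form of a hyperbolic space -/

section DeligneLusztig

variable {k : Type u} [Field k]

/-- A reduced closed subscheme is determined by its points. -/
theorem exists_iso_subscheme_vanishingIdeal {P X : Scheme.{u}} (f : P ⟶ X) [IsClosedImmersion f]
    [IsReduced P] :
    ∃ e : P ≅ (Scheme.IdealSheafData.vanishingIdeal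
        (⟨closure (Set.range f), isClosed_closure⟩ : TopologicalSpace.Closeds X)).subscheme,
      e.hom ≫ Scheme.IdealSheafData.subschemeι _ = f := by
  let I := Scheme.IdealSheafData.vanishingIdeal
    (⟨closure (Set.range f), isClosed_closure⟩ : TopologicalSpace.Closeds X)
  have hker : I.subschemeι.ker = f.ker := by
    -- On the reduced scheme `P` the functions that vanish everywhere are zero, so the kernel of `f`
    -- is the vanishing ideal of its image. The two closed immersions then have the same kernel.
    have h := Scheme.IdealSheafData.map_vanishingIdeal f ⊤
    rw [Scheme.IdealSheafData.vanishingIdeal_top, Scheme.nilradical_eq_bot,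
      Scheme.IdealSheafData.map_bot] at h
    rw [Scheme.IdealSheafData.ker_subschemeι, h]
    refine congrArg Scheme.IdealSheafData.vanishingIdeal (TopologicalSpace.Closeds.ext ?_)
    change closure (Set.range f) = closure (f '' Set.univ)
    rw [Set.image_univ]
  have := IsClosedImmersion.isIso_lift I.subschemeι f hker
  exact ⟨asIso (IsClosedImmersion.lift I.subschemeι f hker.le), IsClosedImmersion.lift_fac _ _ _⟩

theorem nonempty_reducedOn_iso {P X : Over (Spec (CommRingCat.of k))} (f : P ⟶ X)
    [IsClosedImmersion f.left] [IsReduced P.left] :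
    Nonempty (reducedOn X (Set.range f.left) ≅ P) := by
  obtain ⟨e, he⟩ := exists_iso_subscheme_vanishingIdeal f.left
  let φ : P ≅ reducedOn X (Set.range f.left) := Over.isoMk e (by
    exact ((Category.assoc _ _ _).symm.trans (congrArg (· ≫ X.hom) he)).trans (Over.w f))
  exact ⟨φ.symm⟩

/-- Every point of the projective line lies under a field valued point in a chart. -/
theorem exists_lineChart_of_point (z : (projectiveLine k).left) :
    ∃ (K : Type u) (_ : Field K) (_ : Algebra k K) (j : Fin 2) (t : K),
      z ∈ Set.range (lineChart (k := k) j t).left := by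
  obtain ⟨j, y, rfl⟩ := exists_mem_range_lineChart z
  let q : PrimeSpectrum (Polynomial k) := y
  let φ := IsScalarTower.toAlgHom k (Polynomial k) q.asIdeal.ResidueField
  refine ⟨q.asIdeal.ResidueField, inferInstance, inferInstance, j, φ Polynomial.X, ?_⟩
  have hy : y ∈ Set.range (specOverMap φ).left := by
    have h := PrimeSpectrum.residueField_comap q
    exact (h ▸ Set.mem_singleton q :)
  obtain ⟨w, hw⟩ := hy
  refine ⟨w, ?_⟩
  rw [← specOverMap_comp_lineChart, ← hw]
  rfl

variable {Om : Type v} [AddCommGroup Om] [Module k Om] {E : Module.Basis (Fin 4) k Om}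
  {B : LinearMap.BilinForm k Om} {c : k} (hc : c ≠ 0)
  (hB : ∀ x y, B x y = c * hypForm (E.equivFun x) (E.equivFun y))
  (p : ℕ) [Fact p.Prime] [CharP k p] {Φ : Om →ₛₗ[frobenius k p] Om}
  (hΦ : ∀ x j, E.equivFun (Φ x) j = E.equivFun x (Equiv.swap 1 2 j) ^ p)

include hc hB hΦ in
/-- The Deligne–Lusztig variety of the hyperbolic space of dimension four with a Frobenius operator
that exchanges the two families of isotropic planes. -/
theorem deligneLusztig_hyperbolic (h2 : (2 : k) ≠ 0) :
    Nonempty (OrthogonalGrassmannian B 2) ∧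
    Nat.card (FlagComponent B 2) = 2 ∧
    ∀ Y : OrthogonalGrassmannian B 2,
      IsClosed (dlLocus p Φ Y) ∧
      (∀ (k' : Type u) [Field k'] [Algebra k k'] (x : specOver k k' ⟶ Y.X),
        Set.range x.left ⊆ dlLocus p Φ Y ↔ DLCondition p Φ 2 k' (Y.points k' x).1) ∧
      (⋃ c, dlComponentLocus p Φ Y c) = dlLocus p Φ Y ∧
      Pairwise (Function.onFun Disjoint (dlComponentLocus p Φ Y)) ∧
      ∀ c : FlagComponent B 2, IsClosed (dlComponentLocus p Φ Y c) ∧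
        Nonempty (dlComponent p Φ Y c ≅ projectiveLine k) := by
  obtain ⟨e, he⟩ := exists_flagComponent_equiv E hc hB h2
  refine ⟨⟨(exists_twoLines_points hc hB h2).choose⟩, by rw [Nat.card_congr e]; simp,
    fun Y => ?_⟩
  obtain ⟨θ, hθ⟩ := exists_iso_twoLines hc hB h2 Y
  let f : Bool → (projectiveLine k ⟶ Y.X) := fun ε => lineIncl k ε ≫ θ.hom
  let pt (K : Type u) [Field K] [Algebra k K] (i : Bool × Fin 2) (t : K) : specOver k K ⟶ Y.X :=
    (lineChart i.2 t ≫ lineIncl k i.1) ≫ θ.hom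
  have hθiso : IsIso θ.hom.left := inferInstanceAs (IsIso ((Over.forget _).map θ.hom))
  have hfo : ∀ ε, IsOpenImmersion (f ε).left := fun ε => by
    rw [show (f ε).left = (lineIncl k ε).left ≫ θ.hom.left from rfl]
    infer_instance
  have hrange : ∀ ε, Set.range (f ε).left = θ.hom.left '' Set.range (lineIncl k ε).left :=
    fun ε => Set.range_comp θ.hom.left (lineIncl k ε).left
  have hθbij : Function.Bijective θ.hom.left :=
    (Scheme.homeoOfIso (asIso θ.hom.left)).bijective
  have hcover : ∀ z : Y.X.left, ∃ ε, z ∈ Set.range (f ε).left := fun z => by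
    obtain ⟨w, rfl⟩ := hθbij.2 z
    obtain ⟨ε, hw⟩ := exists_mem_range_lineIncl w
    exact ⟨ε, by rw [hrange]; exact ⟨w, hw, rfl⟩⟩
  have hdisj : ∀ ε δ, ε ≠ δ → Disjoint (Set.range (f ε).left) (Set.range (f δ).left) :=
    fun ε δ h => by
      rw [hrange, hrange]
      exact (Set.disjoint_image_iff hθbij.1).2 (disjoint_range_lineIncl h)
  -- Each of the two lines is the complement of the other, and both are open.
  have hclosed : ∀ ε, IsClosed (Set.range (f ε).left) := fun ε => by
    have : Set.range (f ε).left = (Set.range (f !ε).left)ᶜ := by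
      ext z
      constructor
      · exact fun h h' => Set.disjoint_left.1 (hdisj ε (!ε) (by simp)) h h'
      · intro h
        obtain ⟨δ, hδ⟩ := hcover z
        cases ε <;> cases δ <;> first | exact hδ | exact absurd hδ h
    rw [this]
    exact (f !ε).left.isOpenEmbedding.isOpen_range.isClosed_compl
  have hpoint : ∀ (ε : Bool), ∀ z ∈ Set.range (f ε).left, ∃ (K : Type u) (_ : Field K)
      (_ : Algebra k K) (j : Fin 2) (t : K), z ∈ Set.range (pt K (ε, j) t).left := by
    rintro ε _ ⟨y, rfl⟩
    obtain ⟨K, _, _, j, t, w, rfl⟩ := exists_lineChart_of_point y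
    exact ⟨K, _, _, j, t, w, rfl⟩
  -- Over a field a point is an isotropic plane, and such a plane lies in a chart globally; the
  -- point is recovered from its plane.
  have hpt : ∀ (K : Type u) [Field K] [Algebra k K] (x : specOver k K ⟶ Y.X),
      ∃ i t, x = pt K i t := fun K _ _ x => by
    obtain ⟨i, t, h⟩ :=
      ((isIsotropicSummand_iff hc hB h2 _).1 (Y.points K x).2).exists_eq_chartPlane
    refine ⟨i, t, (Y.points K).injective (Subtype.ext ?_)⟩
    exact Submodule.map_injective_of_injective (coords E K).injective (h.trans (hθ K i t).symm)
  have hptrange : ∀ (K : Type u) [Field K] [Algebra k K] (i : Bool × Fin 2) (t : K),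
      Set.range (pt K i t).left ⊆ Set.range (f i.1).left := by
    rintro K _ _ i t _ ⟨w, rfl⟩
    exact ⟨_, rfl⟩
  have hDL : ∀ (K : Type u) [Field K] [Algebra k K] (i : Bool × Fin 2) (t : K),
      DLCondition p Φ 2 K (Y.points K (pt K i t)).1 := fun K _ _ i t =>
    dlCondition_of_map_coords E p hΦ (hθ K i t)
  have hfam : ∀ (K : Type u) [Field K] [Algebra k K] (i : Bool × Fin 2) (t : K)
      (F : IsotropicFlag B 2),
      F.CarriedTo K ((Y.points K (pt K i t)).1 ⊓ phiBar p Φ K (Y.points K (pt K i t)).1)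
        (Y.points K (pt K i t)).1 ↔ F.family E = i.1 := fun K _ _ i t F =>
    carriedTo_iff_family E hc hB h2 F (hθ K i t) inf_le_left
      (finrank_inf_phiBar E p hΦ (hθ K i t))
  -- The dimension condition holds at every point, so the variety is the whole Grassmannian.
  have huniv : dlLocus p Φ Y = Set.univ := by
    refine Set.eq_univ_of_forall fun z => ?_
    obtain ⟨ε, hz⟩ := hcover z
    obtain ⟨K, _, _, j, t, hz⟩ := hpoint ε z hz
    exact ⟨K, _, _, _, hz, hDL K (ε, j) t⟩
  have hcomp : ∀ c, dlComponentLocus p Φ Y c = Set.range (f (e c)).left := fun c => by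
    apply Set.Subset.antisymm
    · rintro z ⟨K, _, _, x, hz, -, F, rfl, hF⟩
      obtain ⟨i, t, rfl⟩ := hpt K x
      rw [he, (hfam K i t F).1 hF]
      exact hptrange K i t hz
    · intro z hz
      obtain ⟨F, rfl⟩ := Quot.exists_rep c
      obtain ⟨K, _, _, j, t, hz⟩ := hpoint _ z hz
      exact ⟨K, _, _, _, hz, hDL K _ t, F, rfl, (hfam K _ t F).2 (he F).symm⟩
  refine ⟨huniv ▸ isClosed_univ, fun K _ _ x => ?_, ?_, fun c d hcd => ?_, fun c => ⟨?_, ?_⟩⟩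
  · obtain ⟨i, t, rfl⟩ := hpt K x
    exact iff_of_true (huniv ▸ Set.subset_univ _) (hDL K i t)
  · rw [huniv]
    refine Set.eq_univ_of_forall fun z => ?_
    obtain ⟨ε, hz⟩ := hcover z
    refine Set.mem_iUnion.2 ⟨e.symm ε, ?_⟩
    rw [hcomp, e.apply_symm_apply]
    exact hz
  · rw [Function.onFun, hcomp, hcomp]
    exact hdisj _ _ (e.injective.ne hcd)
  · rw [hcomp]
    exact hclosed _
  · rw [dlComponent, hcomp]
    have := hfo (e c)
    -- An open immersion with closed image is a closed immersion; its reduced source is then the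
    -- reduced closed subscheme on the image.
    have : IsClosedImmersion (f (e c)).left := .of_isPreimmersion _ (hclosed _)
    exact nonempty_reducedOn_iso (f (e c))

end DeligneLusztig

/-! ### Nonsplit quadratic spaces of dimension four over `𝔽_p` -/

section FiniteQuadraticSpace

variable {p : ℕ} [Fact p.Prime]

/-- Counting: `a s²` and `c - b t²` each take `(p + 1) / 2` values in `𝔽_p`, so they have a value in
common. -/
theorem exists_mul_sq_add_mul_sq_eq (hp : p ≠ 2) {a b : ZMod p} (ha : a ≠ 0) (hb : b ≠ 0)
    (c : ZMod p) : ∃ s t, a * s ^ 2 + b * t ^ 2 = c := by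
  obtain ⟨s, t, h⟩ := FiniteField.exists_root_sum_quadratic (R := ZMod p)
    (f := Polynomial.C a * Polynomial.X ^ 2 + Polynomial.C 0 * Polynomial.X + Polynomial.C 0)
    (g := Polynomial.C b * Polynomial.X ^ 2 + Polynomial.C 0 * Polynomial.X + Polynomial.C (-c))
    (Polynomial.degree_quadratic ha) (Polynomial.degree_quadratic hb) (by
      rw [ZMod.card]
      exact (Fact.out : p.Prime).eq_two_or_odd.resolve_left hp)
  refine ⟨s, t, ?_⟩
  simp at h
  linear_combination h

/-- An isotropic basis of a nondegenerate quadratic space, with everything but the two vectors in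
the middle defined over `𝔽_p`. -/
theorem exists_orthogonal_vectors (hp : p ≠ 2) {U : Type*} [AddCommGroup U] [Module (ZMod p) U]
    (hU : Module.finrank (ZMod p) U = 4) (b : LinearMap.BilinForm (ZMod p) U)
    (hsymm : ∀ x y, b x y = b y x) (hnd : ∀ x, (∀ y, b x y = 0) → x = 0) :
    ∃ (x y u w : U) (m A a : ZMod p), m ≠ 0 ∧ A ≠ 0 ∧ a ≠ 0 ∧
      (b x x = 0 ∧ b y y = 0 ∧ b x y = m) ∧ (b u u = A ∧ b w w = a ∧ b u w = 0) ∧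
      (b x u = 0 ∧ b x w = 0 ∧ b y u = 0 ∧ b y w = 0) := by
  have h2 : (2 : ZMod p) ≠ 0 := by
    have := (Ring.two_ne_zero (R := ZMod p)) (by rwa [ZMod.ringChar_zmod_n])
    exact this
  have : Invertible (2 : ZMod p) := invertibleOfNonzero h2
  have : FiniteDimensional (ZMod p) U := Module.finite_of_finrank_pos (by omega)
  obtain ⟨v', hv⟩ := LinearMap.BilinForm.exists_orthogonal_basis (B := b) ⟨fun x y => hsymm x y⟩
  have hdiag' := hv.not_isOrtho_basis_self_of_separatingLeft (fun x h => hnd x h)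
  let v : Fin 4 → U := fun i => v' (Fin.cast hU.symm i)
  have hoff : ∀ i j, i ≠ j → b (v i) (v j) = 0 := fun i j hij =>
    hv (fun h => hij (Fin.cast_injective _ h))
  have hdiag : ∀ i, b (v i) (v i) ≠ 0 := fun i => hdiag' _
  clear_value v
  -- The vector `s v₀ + t v₁` gets the norm opposite to that of `v₂`, so its sum and difference with
  -- `v₂` are isotropic and span a hyperbolic plane. The orthogonal complement is spanned by `v₃`
  -- and the vector of `⟨v₀, v₁⟩` orthogonal to `s v₀ + t v₁`.
  obtain ⟨s, t, hst⟩ := exists_mul_sq_add_mul_sq_eq hp (hdiag 0) (hdiag 1) (-b (v 2) (v 2))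
  have h01 := hoff 0 1 (by decide)
  have h02 := hoff 0 2 (by decide)
  have h03 := hoff 0 3 (by decide)
  have h10 := hoff 1 0 (by decide)
  have h12 := hoff 1 2 (by decide)
  have h13 := hoff 1 3 (by decide)
  have h20 := hoff 2 0 (by decide)
  have h21 := hoff 2 1 (by decide)
  have h23 := hoff 2 3 (by decide)
  refine ⟨s • v 0 + t • v 1 + v 2, s • v 0 + t • v 1 - v 2,
    (-(b (v 1) (v 1) * t)) • v 0 + (b (v 0) (v 0) * s) • v 1, v 3,
    -2 * b (v 2) (v 2), -(b (v 0) (v 0) * b (v 1) (v 1) * b (v 2) (v 2)), b (v 3) (v 3),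
    mul_ne_zero (neg_ne_zero.2 h2) (hdiag 2),
    neg_ne_zero.2 (mul_ne_zero (mul_ne_zero (hdiag 0) (hdiag 1)) (hdiag 2)), hdiag 3,
    ⟨?_, ?_, ?_⟩, ⟨?_, rfl, ?_⟩, ?_, ?_, ?_, ?_⟩ <;>
  simp only [map_add, map_sub, map_smul, LinearMap.add_apply, LinearMap.sub_apply,
    LinearMap.smul_apply, smul_eq_mul, h01, h02, h03, h10, h12, h13, h20, h21, h23]
  · linear_combination hst
  · linear_combination hst
  · linear_combination hst
  · linear_combination b (v 0) (v 0) * b (v 1) (v 1) * hst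
  all_goals ring

/-- A family of vectors with the Gram matrix of the hyperbolic form is a basis. -/
theorem exists_basis_of_gram {k : Type u} [Field k] {V : Type*} [AddCommGroup V] [Module k V]
    (hV : Module.finrank k V = 4) (B : LinearMap.BilinForm k V) {c : k} (hc : c ≠ 0)
    (e : Fin 4 → V)
    (h : ∀ i j, B (e i) (e j) = c * hypForm (Pi.single i 1) (Pi.single j 1)) :
    ∃ E : Module.Basis (Fin 4) k V, (∀ i, E i = e i) ∧
      ∀ x y, B x y = c * hypForm (E.equivFun x) (E.equivFun y) := by
  have hsum : ∀ a a' : Fin 4 → k, B (∑ i, a i • e i) (∑ i, a' i • e i) = c * hypForm a a' := by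
    intro a a'
    simp only [Fin.sum_univ_four, map_add, map_smul, LinearMap.add_apply, LinearMap.smul_apply,
      smul_eq_mul, h]
    simp [hypForm]
    ring
  have hli : LinearIndependent k e := by
    rw [Fintype.linearIndependent_iff]
    intro a ha
    have h0 : ∀ a', hypForm a a' = 0 := fun a' => by
      have := hsum a a'
      rw [ha, map_zero, LinearMap.zero_apply] at this
      exact (mul_eq_zero.1 this.symm).resolve_left hc
    have e0 := h0 (Pi.single 3 1)
    have e1 := h0 (Pi.single 2 1)
    have e2 := h0 (Pi.single 1 1)
    have e3 := h0 (Pi.single 0 1)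
    simp [hypForm] at e0 e1 e2 e3
    intro i
    fin_cases i <;> assumption
  let E := basisOfLinearIndependentOfCardEqFinrank hli (by rw [hV]; rfl)
  have hE : ∀ i, E i = e i := fun i => by simp [E]
  refine ⟨E, hE, fun x y => ?_⟩
  have hx : ∀ z, ∑ i, E.equivFun z i • e i = z := fun z => by
    simp only [← hE]
    exact E.sum_equivFun z
  rw [← hsum, hx, hx]

variable {k : Type u} [Field k] [IsAlgClosed k] [Algebra (ZMod p) k]

/-- Euler's criterion: `δ ^ (p - 1) = d ^ ((p - 1) / 2) = -1`. -/
theorem exists_sq_eq_of_not_isSquare (hp : p ≠ 2) {d : ZMod p} (hd : ¬ IsSquare d) :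
    ∃ δ : k, δ ^ 2 = algebraMap (ZMod p) k d ∧ δ ^ p = -δ := by
  obtain ⟨δ, hδ⟩ := IsAlgClosed.exists_pow_nat_eq (algebraMap (ZMod p) k d) two_pos
  have hd0 : d ≠ 0 := fun h => hd (h ▸ IsSquare.zero)
  have h1 : d ^ (p / 2) = -1 := (ZMod.pow_div_two_eq_neg_one_or_one p hd0).resolve_left
    fun h => hd ((ZMod.euler_criterion p hd0).2 h)
  refine ⟨δ, hδ, ?_⟩
  have hodd : p = 2 * (p / 2) + 1 := by
    have := (Fact.out : p.Prime).eq_two_or_odd.resolve_left hp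
    omega
  conv_lhs => rw [hodd]
  rw [pow_succ, pow_mul, hδ, ← map_pow, h1]
  simp

/-- Without isotropic planes, the complement `⟨u, w⟩` of the hyperbolic plane `⟨x, y⟩` is
anisotropic over `𝔽_p`. Over `k` it has two isotropic lines, which are conjugate, and Frobenius
exchanges them. -/
theorem exists_hyperbolic_basis [CharP k p] (hp : p ≠ 2) {U : Type v} [AddCommGroup U] [Module (ZMod p) U]
    (hU : Module.finrank (ZMod p) U = 4) (b : LinearMap.BilinForm (ZMod p) U)
    (hsymm : ∀ x y, b x y = b y x) (hnd : ∀ x, (∀ y, b x y = 0) → x = 0)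
    (hplane : ∀ x y, b x x = 0 → b x y = 0 → b y y = 0 →
      ∃ r s : ZMod p, (r ≠ 0 ∨ s ≠ 0) ∧ r • x + s • y = 0)
    (f : U →+ U →+ k) {ν : k} (hν : ν ≠ 0)
    (hf : ∀ x y, f x y = ν * algebraMap (ZMod p) k (b x y)) :
    ∃ (E : Module.Basis (Fin 4) k (k ⊗[ZMod p] U)) (c : k), c ≠ 0 ∧
      (∀ x y, extForm (p := p) f x y = c * hypForm (E.equivFun x) (E.equivFun y)) ∧
      ∀ x j, E.equivFun (extFrob (p := p) k U x) j = E.equivFun x (Equiv.swap 1 2 j) ^ p := by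
  obtain ⟨x, y, u, w, m, A, a, hm, hA, ha, ⟨hxx, hyy, hxy⟩, ⟨huu, hww, huw⟩, hxu, hxw, hyu, hyw⟩ :=
    exists_orthogonal_vectors hp hU b hsymm hnd
  -- If `-A a = r²`, then `r u + A w` is isotropic and orthogonal to `x`, and together they span an
  -- isotropic plane.
  have hd : ¬ IsSquare (-(A * a)) := by
    rintro ⟨r, hr⟩
    obtain ⟨α, β, hne, h⟩ := hplane x (r • u + A • w) hxx
      (by simp only [map_add, map_smul, hxu, hxw, smul_zero, add_zero]) (by
        simp only [map_add, map_smul, LinearMap.add_apply, LinearMap.smul_apply, smul_eq_mul,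
          huu, huw, hsymm w u, hww]
        linear_combination -A * hr)
    have h1 := congrArg (fun z => b z y) h
    have h2 := congrArg (fun z => b z w) h
    simp only [map_add, map_smul, LinearMap.add_apply, LinearMap.smul_apply, smul_eq_mul, hxy,
      hsymm u y, hyu, hsymm w y, hyw, hxw, huw, hww, map_zero, LinearMap.zero_apply, mul_zero,
      add_zero, zero_add, mul_eq_zero, hm, hA, ha, or_false] at h1 h2
    exact hne.elim (fun h => h h1) (fun h => h h2)
  obtain ⟨δ, hδ, hδp⟩ := exists_sq_eq_of_not_isSquare (k := k) hp hd
  let ι := algebraMap (ZMod p) k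
  have hιp : ∀ r, ι r ^ p = ι r := fun r => by rw [← map_pow, ZMod.pow_card]
  have hι0 : ∀ {r}, r ≠ 0 → ι r ≠ 0 := fun h => (map_ne_zero ι).2 h
  have h2 : (2 : k) ≠ 0 := by
    have := (Ring.two_ne_zero (R := k)) (by rwa [ringChar.eq k p])
    exact this
  -- Scales the pairing of the two outer basis vectors to `C = -2 A² a`, apart from the common
  -- factor `ν`. This is minus the pairing of the two middle vectors, as the hyperbolic form
  -- demands.
  let l : ZMod p := -2 * (A * a) * A * m⁻¹
  let C : k := -2 * ι (A * a * A)
  have hl : ι l * ι m = C := by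
    simp only [l, C, map_mul, map_inv₀, map_neg, map_ofNat, ι]
    have : algebraMap (ZMod p) k m ≠ 0 := hι0 hm
    field_simp
  have hC : C ≠ 0 := mul_ne_zero (neg_ne_zero.2 h2) (hι0 (mul_ne_zero (mul_ne_zero hA ha) hA))
  -- The middle vectors `A w ± δ u` are isotropic because `δ² = -A a`, and Frobenius interchanges
  -- them because `δ ^ p = -δ`.
  let e : Fin 4 → k ⊗[ZMod p] U :=
    ![ι l ⊗ₜ x, ι A ⊗ₜ w + δ ⊗ₜ u, ι A ⊗ₜ w - δ ⊗ₜ u, (1 : k) ⊗ₜ y]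
  have hform : ∀ (r r' : k) (z z' : U), extForm (p := p) f (r ⊗ₜ z) (r' ⊗ₜ z') =
      r * r' * (ν * ι (b z z')) := fun r r' z z' => by rw [extForm_tmul, hf]
  have hgram : ∀ i j, extForm (p := p) f (e i) (e j) =
      ν * C * hypForm (Pi.single i 1) (Pi.single j 1) := by
    have hyx := (hsymm y x).trans hxy
    have hux := (hsymm u x).trans hxu
    have hwx := (hsymm w x).trans hxw
    have huy := (hsymm u y).trans hyu
    have hwy := (hsymm w y).trans hyw
    have hwu := (hsymm w u).trans huw
    have hδ' : δ ^ 2 = -(ι A * ι a) := by rw [hδ, map_neg, map_mul]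
    have hC' : C = -2 * (ι A * ι a * ι A) := by rw [← map_mul, ← map_mul]
    have hl' := hl.trans hC'
    intro i j
    rw [hC']
    fin_cases i <;> fin_cases j <;>
      simp only [e, Fin.zero_eta, Fin.mk_one, Fin.reduceFinMk, Matrix.cons_val, map_add, map_sub,
        LinearMap.add_apply, LinearMap.sub_apply, hform, hxx, hyy, hxy, hyx, huu, hww, huw, hwu,
        hxu, hux, hxw, hwx, hyu, huy, hyw, hwy, map_zero, mul_zero, add_zero, sub_zero, sub_self,
        zero_add, zero_sub, hypForm, Pi.single_apply] <;>
      simp <;>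
      first
        | linear_combination ν * hl'
        | linear_combination ν * ι A * hδ'
        | linear_combination -ν * ι A * hδ'
  have hfin : Module.finrank k (k ⊗[ZMod p] U) = 4 := by rw [Module.finrank_baseChange, hU]
  obtain ⟨E, hE, hB⟩ := exists_basis_of_gram hfin (extForm (p := p) f) (mul_ne_zero hν hC) e hgram
  refine ⟨E, ν * C, mul_ne_zero hν hC, hB, fun z j => ?_⟩
  have hΦ : ∀ i, extFrob (p := p) k U (E i) = E (Equiv.swap 1 2 i) := by
    intro i
    rw [hE, hE]
    fin_cases i
    · change extFrob (p := p) k U (ι l ⊗ₜ x) = ι l ⊗ₜ x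
      rw [extFrob_tmul, hιp]
    · change extFrob (p := p) k U (ι A ⊗ₜ w + δ ⊗ₜ u) = ι A ⊗ₜ w - δ ⊗ₜ u
      rw [map_add, extFrob_tmul, extFrob_tmul, hιp, hδp, TensorProduct.neg_tmul, sub_eq_add_neg]
    · change extFrob (p := p) k U (ι A ⊗ₜ w - δ ⊗ₜ u) = ι A ⊗ₜ w + δ ⊗ₜ u
      rw [map_sub, extFrob_tmul, extFrob_tmul, hιp, hδp, TensorProduct.neg_tmul, sub_neg_eq_add]
    · change extFrob (p := p) k U ((1 : k) ⊗ₜ y) = (1 : k) ⊗ₜ y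
      rw [extFrob_tmul, one_pow]
  have hz : extFrob (p := p) k U z =
      ∑ i, (E.equivFun z (Equiv.swap 1 2 i) ^ p) • E i := by
    conv_lhs => rw [← E.sum_equivFun z]
    rw [map_sum, ← Equiv.sum_comp (Equiv.swap (1 : Fin 4) 2)]
    refine Finset.sum_congr rfl fun i _ => ?_
    rw [LinearMap.map_smulₛₗ, hΦ, Equiv.swap_apply_self, frobenius_def]
  have hsymm' := E.equivFun_symm_apply fun i => E.equivFun z (Equiv.swap 1 2 i) ^ p
  rw [hz, ← hsymm', LinearEquiv.apply_symm_apply]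

end FiniteQuadraticSpace

/-! ### Coordinates on `V = ⋀² N` -/

section BiVecCoords

variable (p : ℕ) [Fact p.Prime] (k : Type u) [Field k] [IsAlgClosed k] [CharP k p]
  {N : Type v} [AddCommGroup N] [WittVector.Isocrystal p k N]

omit [IsAlgClosed k] in
theorem natCast_WQ_ne_zero : (p : WQ p k) ≠ 0 := by
  rw [← map_natCast (algebraMap (WittVector p k) (WQ p k)), Ne,
    FaithfulSMul.algebraMap_eq_zero_iff]
  exact WittVector.p_nonzero p k

theorem wedge_mk_mk (m m' : Fin 2 → N) :
    wedge p k N (BiVec.mk p k N m) (BiVec.mk p k N m') =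
      exteriorPower.ιMulti (WQ p k) 4 ![m 0, m 1, m' 0, m' 1] := by
  have hv : ∀ m, ((BiVec.equiv p k N (BiVec.mk p k N m) : ⋀[WQ p k]^2 N) :
      ExteriorAlgebra (WQ p k) N) =
      ExteriorAlgebra.ι (WQ p k) (m 0) * ExteriorAlgebra.ι (WQ p k) (m 1) := fun m => by
    have h0 : ((BiVec.equiv p k N (BiVec.mk p k N m) : ⋀[WQ p k]^2 N) :
      ExteriorAlgebra (WQ p k) N) = ExteriorAlgebra.ιMulti (WQ p k) 2 m := rfl
    rw [h0, ExteriorAlgebra.ιMulti_apply]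
    simp [List.ofFn_succ]
  apply Subtype.ext
  rw [exteriorPower.ιMulti_apply_coe, ExteriorAlgebra.ιMulti_apply]
  simp only [wedge, LinearMap.mk₂_apply, hv]
  simp [List.ofFn_succ, mul_assoc]

variable (e : Module.Basis (Fin 4) (WQ p k) N)

/-- The coordinate on the line `⋀⁴ N` with respect to `e₀ ∧ e₁ ∧ e₂ ∧ e₃`. -/
def volCoord : ⋀[WQ p k]^4 N →ₗ[WQ p k] WQ p k := exteriorPower.alternatingMapLinearEquiv e.det

theorem volCoord_ιMulti (m : Fin 4 → N) :
    volCoord p k e (exteriorPower.ιMulti (WQ p k) 4 m) = e.det m :=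
  exteriorPower.alternatingMapLinearEquiv_apply_ιMulti e.det m

/-- The pairing on `V` with respect to `e₀ ∧ e₁ ∧ e₂ ∧ e₃`. -/
def stdPairing : LinearMap.BilinForm (WQ p k) (BiVec p k N) :=
  (wedge p k N).compr₂ (volCoord p k e)

theorem stdPairing_apply (x y : BiVec p k N) :
    stdPairing p k e x y = volCoord p k e (wedge p k N x y) := rfl

/-- The bivectors `e_i ∧ e_j`. -/
def stdBiVec (i j : Fin 4) : BiVec p k N := BiVec.mk p k N ![e i, e j]

theorem stdBiVec_swap (i j : Fin 4) : stdBiVec p k e j i = -stdBiVec p k e i j := by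
  have := AlternatingMap.map_swap (BiVec.mk p k N) ![e i, e j] (i := 0) (j := 1) (by decide)
  rw [stdBiVec, stdBiVec, ← this]
  congr 1
  ext n
  fin_cases n <;> rfl

theorem stdPairing_stdBiVec (i j l m : Fin 4) :
    stdPairing p k e (stdBiVec p k e i j) (stdBiVec p k e l m) = e.det ![e i, e j, e l, e m] := by
  rw [stdPairing_apply, stdBiVec, stdBiVec, wedge_mk_mk, volCoord_ιMulti]
  rfl

theorem stdPairing_stdBiVec_eq_zero {i j l m : Fin 4} (h : i = l ∨ i = m ∨ j = l ∨ j = m) :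
    stdPairing p k e (stdBiVec p k e i j) (stdBiVec p k e l m) = 0 := by
  rw [stdPairing_stdBiVec]
  rcases h with rfl | rfl | rfl | rfl
  · exact e.det.map_eq_zero_of_eq _ (i := 0) (j := 2) rfl (by decide)
  · exact e.det.map_eq_zero_of_eq _ (i := 0) (j := 3) rfl (by decide)
  · exact e.det.map_eq_zero_of_eq _ (i := 1) (j := 2) rfl (by decide)
  · exact e.det.map_eq_zero_of_eq _ (i := 1) (j := 3) rfl (by decide)

theorem stdPairing_comm (x y : BiVec p k N) :
    stdPairing p k e x y = stdPairing p k e y x := by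
  rw [stdPairing_apply, stdPairing_apply, wedge_comm]

theorem stdPairing_zero_one_two_three :
    stdPairing p k e (stdBiVec p k e 0 1) (stdBiVec p k e 2 3) = 1 := by
  rw [stdPairing_stdBiVec, ← e.det_self]
  congr 1
  ext n
  fin_cases n <;> rfl

theorem stdPairing_zero_two_one_three :
    stdPairing p k e (stdBiVec p k e 0 2) (stdBiVec p k e 1 3) = -1 := by
  rw [← stdPairing_zero_one_two_three p k e, stdPairing_stdBiVec, stdPairing_stdBiVec,
    ← e.det.map_swap _ (i := 1) (j := 2) (by decide)]
  congr 1
  ext n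
  fin_cases n <;> rfl

theorem stdPairing_zero_three_one_two :
    stdPairing p k e (stdBiVec p k e 0 3) (stdBiVec p k e 1 2) = 1 := by
  rw [← stdPairing_zero_one_two_three p k e, stdPairing_stdBiVec, stdPairing_stdBiVec]
  have h1 := e.det.map_swap ![e 0, e 1, e 2, e 3] (i := 1) (j := 3) (by decide)
  have h2 := e.det.map_swap (![e 0, e 1, e 2, e 3] ∘ Equiv.swap 1 3) (i := 2) (j := 3) (by decide)
  rw [h1, neg_neg] at h2
  rw [← h2]
  congr 1
  ext n
  fin_cases n <;> rfl

/-- The pairings of the bivectors `e_i ∧ e_j` with complementary indices. -/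
theorem stdPairing_complementary :
    (stdPairing p k e (stdBiVec p k e 0 1) (stdBiVec p k e 2 3) = 1 ∧
      stdPairing p k e (stdBiVec p k e 2 3) (stdBiVec p k e 0 1) = 1) ∧
    (stdPairing p k e (stdBiVec p k e 0 2) (stdBiVec p k e 1 3) = -1 ∧
      stdPairing p k e (stdBiVec p k e 1 3) (stdBiVec p k e 0 2) = -1) ∧
    stdPairing p k e (stdBiVec p k e 0 3) (stdBiVec p k e 1 2) = 1 ∧
      stdPairing p k e (stdBiVec p k e 1 2) (stdBiVec p k e 0 3) = 1 := by
  refine ⟨⟨?_, ?_⟩, ⟨?_, ?_⟩, ?_, ?_⟩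
  all_goals first
    | exact stdPairing_zero_one_two_three p k e
    | exact stdPairing_zero_two_one_three p k e
    | exact stdPairing_zero_three_one_two p k e
    | rw [stdPairing_comm]
  · exact stdPairing_zero_one_two_three p k e
  · exact stdPairing_zero_two_one_three p k e
  · exact stdPairing_zero_three_one_two p k e

theorem stdPairing_stdBiVec_table {i j l m : Fin 4} (hij : i < j) (hlm : l < m) :
    stdPairing p k e (stdBiVec p k e i j) (stdBiVec p k e l m) =
      if i = l ∨ i = m ∨ j = l ∨ j = m then 0 else
        if (i = 0 ∧ j = 2) ∨ (l = 0 ∧ m = 2) then -1 else 1 := by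
  split_ifs with h h'
  · exact stdPairing_stdBiVec_eq_zero p k e h
  all_goals
    obtain ⟨⟨h1, h2⟩, ⟨h3, h4⟩, h5, h6⟩ := stdPairing_complementary p k e
    fin_cases i <;> fin_cases j <;> (try exact absurd hij (by decide)) <;>
      fin_cases l <;> fin_cases m <;>
      first | exact absurd hlm (by decide) | exact absurd h' (by decide) | exact absurd (by decide) h' | exact absurd (by decide) h | assumption

/-- The coordinates on `V` with respect to the bivectors
`e₀ ∧ e₁, e₂ ∧ e₃, e₀ ∧ e₂, e₁ ∧ e₃, e₀ ∧ e₃, e₁ ∧ e₂`. -/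
def biCoord (i : Fin 6) : BiVec p k N →ₗ[WQ p k] WQ p k :=
  ![stdPairing p k e (stdBiVec p k e 2 3), stdPairing p k e (stdBiVec p k e 0 1),
    -stdPairing p k e (stdBiVec p k e 1 3), -stdPairing p k e (stdBiVec p k e 0 2),
    stdPairing p k e (stdBiVec p k e 1 2), stdPairing p k e (stdBiVec p k e 0 3)] i

/-- The expansion operator `T` fixes every `e_i ∧ e_j` by the table of pairings, and linear maps on
`V` that agree on these bivectors agree. -/
theorem eq_sum_biCoord (x : BiVec p k N) :
    x = biCoord p k e 0 x • stdBiVec p k e 0 1 + biCoord p k e 1 x • stdBiVec p k e 2 3 +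
      biCoord p k e 2 x • stdBiVec p k e 0 2 + biCoord p k e 3 x • stdBiVec p k e 1 3 +
      biCoord p k e 4 x • stdBiVec p k e 0 3 + biCoord p k e 5 x • stdBiVec p k e 1 2 := by
  let T : BiVec p k N →ₗ[WQ p k] BiVec p k N :=
    (biCoord p k e 0).smulRight (stdBiVec p k e 0 1) +
      (biCoord p k e 1).smulRight (stdBiVec p k e 2 3) +
      (biCoord p k e 2).smulRight (stdBiVec p k e 0 2) +
      (biCoord p k e 3).smulRight (stdBiVec p k e 1 3) +
      (biCoord p k e 4).smulRight (stdBiVec p k e 0 3) +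
      (biCoord p k e 5).smulRight (stdBiVec p k e 1 2)
  have hlt : ∀ i j : Fin 4, i < j → stdBiVec p k e i j = T (stdBiVec p k e i j) := by
    intro i j hij
    simp only [T, LinearMap.add_apply, LinearMap.smulRight_apply, biCoord,
      Matrix.cons_val, LinearMap.neg_apply]
    fin_cases i <;> fin_cases j <;> first | exact absurd hij (by decide) | skip
    all_goals
      simp [stdPairing_stdBiVec_table]
  have h : (BiVec.mk p k N) = T.compAlternatingMap (BiVec.mk p k N) := by
    refine e.ext_alternating fun v hv => ?_
    have hb : BiVec.mk p k N (fun i => e (v i)) = stdBiVec p k e (v 0) (v 1) := by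
      rw [stdBiVec]
      congr 1
      ext n
      fin_cases n <;> rfl
    rw [LinearMap.compAlternatingMap_apply, hb]
    rcases lt_trichotomy (v 0) (v 1) with h | h | h
    · exact hlt _ _ h
    · exact absurd (hv h) (by decide)
    · rw [stdBiVec_swap, map_neg, ← hlt _ _ h]
  have h' : LinearMap.id = T := BiVec.hom_ext p k fun m => congrArg (fun f => f m) h
  exact congrArg (fun f => f x) h'

theorem stdPairing_eq (x y : BiVec p k N) :
    stdPairing p k e x y = biCoord p k e 0 x * biCoord p k e 1 y +
      biCoord p k e 1 x * biCoord p k e 0 y - biCoord p k e 2 x * biCoord p k e 3 y -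
      biCoord p k e 3 x * biCoord p k e 2 y + biCoord p k e 4 x * biCoord p k e 5 y +
      biCoord p k e 5 x * biCoord p k e 4 y := by
  conv_lhs => rw [eq_sum_biCoord p k e y]
  simp only [map_add, map_smul, smul_eq_mul]
  simp only [biCoord, Matrix.cons_val, LinearMap.neg_apply, stdPairing_comm p k e x]
  ring

theorem eq_of_biCoord_eq {x y : BiVec p k N} (h : ∀ i, biCoord p k e i x = biCoord p k e i y) :
    x = y := by
  rw [eq_sum_biCoord p k e x, eq_sum_biCoord p k e y]
  simp only [h]

theorem biCoord_sum (a b c d f g : WQ p k) (i : Fin 6) :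
    biCoord p k e i (a • stdBiVec p k e 0 1 + b • stdBiVec p k e 2 3 + c • stdBiVec p k e 0 2 +
      d • stdBiVec p k e 1 3 + f • stdBiVec p k e 0 3 + g • stdBiVec p k e 1 2) =
      ![a, b, c, d, f, g] i := by
  simp only [map_add, map_smul, smul_eq_mul]
  fin_cases i <;>
    simp only [biCoord, Matrix.cons_val, LinearMap.neg_apply,
      Fin.zero_eta, Fin.mk_one, Fin.reduceFinMk] <;>
    simp [stdPairing_stdBiVec_table]

/-- The operator `Φ` in coordinates. -/
theorem biCoord_phi (he0 : frobF p k N (e 0) = e 1) (he1 : frobF p k N (e 1) = (p : WQ p k) • e 0)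
    (he2 : frobF p k N (e 2) = e 3) (he3 : frobF p k N (e 3) = (p : WQ p k) • e 2)
    (x : BiVec p k N) (i : Fin 6) :
    biCoord p k e i (phi p k N x) =
      ![-sigma p k (biCoord p k e 0 x), -sigma p k (biCoord p k e 1 x),
        p * sigma p k (biCoord p k e 3 x), (p : WQ p k)⁻¹ * sigma p k (biCoord p k e 2 x),
        sigma p k (biCoord p k e 5 x), sigma p k (biCoord p k e 4 x)] i := by
  have hp0 : (p : WQ p k) ≠ 0 := natCast_WQ_ne_zero p k
  have hphi : ∀ (i j i' j' : Fin 4) (a b : WQ p k), frobF p k N (e i) = a • e i' →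
      frobF p k N (e j) = b • e j' → phi p k N (stdBiVec p k e i j) =
      ((p : WQ p k)⁻¹ * (a * b)) • stdBiVec p k e i' j' := fun i j i' j' a b ha hb => by
    rw [stdBiVec, phi_mk, mul_smul]
    congr 1
    have : (fun n => frobF p k N (![e i, e j] n)) = fun n => ![a, b] n • ![e i', e j'] n := by
      ext n
      fin_cases n
      · exact ha
      · exact hb
    rw [this, AlternatingMap.map_smul_univ, Fin.prod_univ_two]
    rfl
  have f0 : frobF p k N (e 0) = (1 : WQ p k) • e 1 := by rw [he0, one_smul]
  have f2 : frobF p k N (e 2) = (1 : WQ p k) • e 3 := by rw [he2, one_smul]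
  conv_lhs => rw [eq_sum_biCoord p k e x]
  rw [← biCoord_sum p k e]
  congr 1
  simp only [map_add, map_smulₛₗ]
  rw [hphi 0 1 1 0 _ _ f0 he1, hphi 2 3 3 2 _ _ f2 he3, hphi 0 2 1 3 _ _ f0 f2,
    hphi 1 3 0 2 _ _ he1 he3, hphi 0 3 1 2 _ _ f0 he3, hphi 1 2 0 3 _ _ he1 f2,
    stdBiVec_swap p k e 0 1, stdBiVec_swap p k e 2 3]
  simp only [smul_neg, one_mul, mul_one, smul_smul, neg_smul]
  rw [inv_mul_cancel₀ hp0, inv_mul_cancel_left₀ hp0, mul_one, mul_one, mul_one, mul_one,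
    mul_comm (p : WQ p k) (sigma p k (biCoord p k e 3 x)),
    mul_comm (p : WQ p k)⁻¹ (sigma p k (biCoord p k e 2 x))]
  abel

end BiVecCoords

/-! ### Fixed elements of `W_ℚ` and isotropic vectors of `V^Φ` -/

section FixedIsotropic

variable (p : ℕ) [Fact p.Prime] (k : Type u) [Field k] [IsAlgClosed k] [CharP k p]

theorem sigma_algebraMap (w : WittVector p k) :
    sigma p k (algebraMap _ (WQ p k) w) = algebraMap _ (WQ p k) (WittVector.frobenius w) :=
  IsFractionRing.ringEquivOfRingEquiv_algebraMap _ w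

theorem exists_mul_pow_eq_pow_mul_unit {t : WQ p k} (ht : t ≠ 0) :
    ∃ (m n : ℕ) (w : (WittVector p k)ˣ),
      t * (p : WQ p k) ^ m = (p : WQ p k) ^ n * algebraMap (WittVector p k) (WQ p k) w := by
  obtain ⟨a, b, hb, rfl⟩ := IsFractionRing.div_surjective (A := WittVector p k) t
  have hb0 : b ≠ 0 := nonZeroDivisors.ne_zero hb
  have ha0 : a ≠ 0 := fun h => ht (by rw [h, map_zero, zero_div])
  obtain ⟨n, w, rfl⟩ := WittVector.exists_eq_pow_p_mul' a ha0
  obtain ⟨m, w', rfl⟩ := WittVector.exists_eq_pow_p_mul' b hb0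
  refine ⟨m, n, w * w'⁻¹, ?_⟩
  have hb1 : algebraMap (WittVector p k) (WQ p k) ((p : WittVector p k) ^ m * w') ≠ 0 := fun h =>
    hb0 ((FaithfulSMul.algebraMap_eq_zero_iff _ _).1 h)
  rw [div_mul_eq_mul_div, div_eq_iff hb1, ← map_natCast (algebraMap (WittVector p k) (WQ p k)),
    ← map_pow, ← map_pow, ← map_mul, ← map_mul, ← map_mul]
  congr 1
  rw [Units.val_mul]
  linear_combination (p : WittVector p k) ^ n * w * p ^ m * -Units.inv_mul w'

/-- `σ` preserves the valuation, so `t σ(t)` has even valuation, while `p` has valuation one. -/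
theorem mul_sigma_ne_p (t : WQ p k) : t * sigma p k t ≠ p := by
  intro h
  have hp : Prime (p : WittVector p k) :=
    (WittVector.irreducible p).prime
  have hp0 := natCast_WQ_ne_zero p k
  have ht : t ≠ 0 := fun h0 => hp0 (by rw [← h, h0, zero_mul])
  obtain ⟨m, n, w, hw⟩ := exists_mul_pow_eq_pow_mul_unit p k ht
  have hw' := congrArg (sigma p k) hw
  rw [map_mul, map_mul, map_pow, map_pow, map_natCast, sigma_algebraMap] at hw'
  have key : algebraMap (WittVector p k) (WQ p k) (p ^ (2 * m + 1)) =
      algebraMap (WittVector p k) (WQ p k) (p ^ (2 * n) * (w * WittVector.frobenius (w : WittVector p k))) := by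
    simp only [map_mul, map_pow, map_natCast]
    calc (p : WQ p k) ^ (2 * m + 1) = (t * p ^ m) * (sigma p k t * p ^ m) := by rw [pow_succ, ← h]; ring
      _ = _ := by rw [hw, hw']; ring
  have key' := algebraMap_W_injective p k key
  have hu : IsUnit ((w : WittVector p k) * WittVector.frobenius (w : WittVector p k)) :=
    w.isUnit.mul (w.isUnit.map _)
  rcases lt_or_ge (2 * m + 1) (2 * n) with hlt | hge
  · obtain ⟨r, hr⟩ := Nat.exists_eq_add_of_lt hlt
    rw [hr, add_assoc, pow_add _ (2 * m + 1), mul_assoc] at key'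
    have := mul_left_cancel₀ (pow_ne_zero _ hp.ne_zero) ((mul_one _).trans key')
    rw [pow_succ', mul_assoc] at this
    exact hp.not_isUnit (IsUnit.of_mul_eq_one _ this.symm)
  · obtain ⟨r, hr⟩ := Nat.exists_eq_add_of_le hge
    rw [hr, pow_add] at key'
    have := mul_left_cancel₀ (pow_ne_zero _ hp.ne_zero) key'
    obtain ⟨s, rfl⟩ : ∃ s, r = s + 1 := ⟨r - 1, by omega⟩
    rw [← this, pow_succ'] at hu
    exact hp.not_isUnit (isUnit_of_mul_isUnit_left hu)

/-- If `d ≠ 0`, then `t = f / d` has `t σ(t) = p`. This is the anisotropy that keeps isotropic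
planes out of `V^Φ`. -/
theorem eq_zero_of_mul_sigma_eq {f d : WQ p k}
    (h : f * sigma p k f = p * (d * sigma p k d)) : f = 0 ∧ d = 0 := by
  by_cases hd : d = 0
  · rw [hd, zero_mul, mul_zero, mul_eq_zero, map_eq_zero, or_self] at h
    exact ⟨h, hd⟩
  · exfalso
    refine mul_sigma_ne_p p k (f / d) ?_
    have : sigma p k d ≠ 0 := (map_ne_zero _).2 hd
    rw [map_div₀]
    field_simp
    linear_combination h

variable {k} in
omit [IsAlgClosed k] in
theorem mem_range_castHom_of_pow_eq {x : k} (hx : x ^ p = x) :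
    ∃ n : ZMod p, ZMod.castHom (dvd_refl p) k n = x := by
  have h : x ∈ (ZMod.castHom (dvd_refl p) k).fieldRange := by
    rw [ZMod.fieldRange_castHom_eq_bot]
    exact (Subfield.mem_bot_iff_pow_eq_self k (p := p)).2 hx
  exact h

variable {k} in
-- The Witt coefficients of a fixed vector are fixed by the `p`-th power map, hence lie in `𝔽_p`.
theorem exists_zpToW_eq {w : WittVector p k} (hw : WittVector.frobenius w = w) :
    ∃ c : ℤ_[p], zpToW p k c = w := by
  have h : ∀ n, ∃ m : ZMod p, ZMod.castHom (dvd_refl p) k m = w.coeff n := fun n =>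
    mem_range_castHom_of_pow_eq p (by rw [← WittVector.coeff_frobenius_charP, hw])
  choose m hm using h
  refine ⟨WittVector.equiv p (WittVector.mk p m), ?_⟩
  ext n
  simp [zpToW, WittVector.map_coeff, ← hm n]

variable {k} in
-- Since `W` is a valuation ring, `x` or its inverse is integral. Either is enough for comparing two
-- proportional vectors.
theorem exists_zpToWQ_eq {x : WQ p k} (hx : sigma p k x = x) :
    ∃ c : ℤ_[p], zpToWQ p k c = x ∨ zpToWQ p k c = x⁻¹ := by
  have key : ∀ y : WQ p k, sigma p k y = y → IsLocalization.IsInteger (WittVector p k) y →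
      ∃ c : ℤ_[p], zpToWQ p k c = y := by
    rintro _ hy ⟨w, rfl⟩
    rw [sigma_algebraMap] at hy
    obtain ⟨c, hc⟩ := exists_zpToW_eq p (algebraMap_W_injective p k hy)
    exact ⟨c, by rw [← hc]; rfl⟩
  rcases ValuationRing.isInteger_or_isInteger (WittVector p k) x with h | h
  · obtain ⟨c, hc⟩ := key x hx h
    exact ⟨c, .inl hc⟩
  · obtain ⟨c, hc⟩ := key x⁻¹ (by rw [map_inv₀, hx]) h
    exact ⟨c, .inr hc⟩

variable {p k}
variable {N : Type v} [AddCommGroup N] [WittVector.Isocrystal p k N]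

/-- A basis of the isocrystal of a supersingular `p`-divisible group adapted to `F`. -/
structure IsSupersingularBasis (e : Module.Basis (Fin 4) (WQ p k) N) : Prop where
  frob_zero : frobF p k N (e 0) = e 1
  frob_one : frobF p k N (e 1) = (p : WQ p k) • e 0
  frob_two : frobF p k N (e 2) = e 3
  frob_three : frobF p k N (e 3) = (p : WQ p k) • e 2

variable {e : Module.Basis (Fin 4) (WQ p k) N}

theorem IsSupersingularBasis.biCoord_fixed (he : IsSupersingularBasis e)
    {x : BiVec p k N} (hx : x ∈ fixedVectors p k N) :
    sigma p k (biCoord p k e 0 x) = -biCoord p k e 0 x ∧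
    sigma p k (biCoord p k e 1 x) = -biCoord p k e 1 x ∧
    biCoord p k e 2 x = p * sigma p k (biCoord p k e 3 x) ∧
    sigma p k (biCoord p k e 2 x) = p * biCoord p k e 3 x ∧
    biCoord p k e 5 x = sigma p k (biCoord p k e 4 x) ∧
    sigma p k (biCoord p k e 5 x) = biCoord p k e 4 x := by
  have hp0 := natCast_WQ_ne_zero p k
  have h := biCoord_phi p k e he.1 he.2 he.3 he.4 x
  have hx' : phi p k N x = x := hx
  rw [hx'] at h
  have h0 := h 0
  have h1 := h 1
  have h3 := h 3
  simp only [Matrix.cons_val] at h0 h1 h3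
  refine ⟨by linear_combination h0, by linear_combination h1, h 2, ?_, h 5, (h 4).symm⟩
  rw [h3, mul_inv_cancel_left₀ hp0]

/-- On fixed vectors `σ` changes the sign of the first two coordinates and exchanges the members of
the other two pairs, up to factors of `p` that cancel in the form. -/
theorem IsSupersingularBasis.sigma_stdPairing (he : IsSupersingularBasis e)
    {x y : BiVec p k N} (hx : x ∈ fixedVectors p k N)
    (hy : y ∈ fixedVectors p k N) :
    sigma p k (stdPairing p k e x y) = stdPairing p k e x y := by
  obtain ⟨h0, h1, h2, h2', h5, h5'⟩ := he.biCoord_fixed hx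
  obtain ⟨g0, g1, g2, g2', g5, g5'⟩ := he.biCoord_fixed hy
  rw [stdPairing_eq]
  simp only [map_add, map_sub, map_mul, h0, h1, h2', g0, g1, g2', h5', g5', ← h5, ← g5]
  rw [h2, g2]
  ring

/-- If the coordinate `0` vanishes, half of the self-pairing is `f σ(f) - p d σ(d)` with `f` and `d`
the coordinates `4` and `3`. By anisotropy only the coordinate `1` survives. -/
theorem IsSupersingularBasis.biCoord_eq_zero (he : IsSupersingularBasis e)
    (h2 : (2 : WQ p k) ≠ 0) {x : BiVec p k N}
    (hx : x ∈ fixedVectors p k N) (h0 : biCoord p k e 0 x = 0) (hxx : stdPairing p k e x x = 0)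
    (i : Fin 6) (hi : i ≠ 1) : biCoord p k e i x = 0 := by
  obtain ⟨-, -, g2, -, g5, -⟩ := he.biCoord_fixed hx
  rw [stdPairing_eq, h0, g2, g5] at hxx
  obtain ⟨g4, g3⟩ := eq_zero_of_mul_sigma_eq p k (f := biCoord p k e 4 x) (d := biCoord p k e 3 x)
    (mul_left_cancel₀ h2 (by linear_combination hxx))
  rw [g3, map_zero, mul_zero] at g2
  rw [g4, map_zero] at g5
  fin_cases i
  exacts [h0, absurd rfl hi, g2, g3, g4, g5]

/-- Subtracting from `y` the multiple of `x` with the same coordinate `0` leaves an isotropic fixed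
vector that is supported in the coordinate `1`. Orthogonality to `x` makes that coordinate vanish
too. -/
theorem IsSupersingularBasis.eq_smul_of_ne_zero (he : IsSupersingularBasis e)
    (h2 : (2 : WQ p k) ≠ 0) {x y : BiVec p k N}
    (hx : x ∈ fixedVectors p k N) (hy : y ∈ fixedVectors p k N)
    (hxx : stdPairing p k e x x = 0) (hxy : stdPairing p k e x y = 0)
    (hyy : stdPairing p k e y y = 0) (h0 : biCoord p k e 0 x ≠ 0) :
    ∃ r, sigma p k r = r ∧ y = r • x := by
  set r := biCoord p k e 0 y / biCoord p k e 0 x with hr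
  have hσ : sigma p k r = r := by
    rw [hr, map_div₀, (he.biCoord_fixed hx).1, (he.biCoord_fixed hy).1, neg_div_neg_eq]
  refine ⟨r, hσ, ?_⟩
  have hz : y - r • x ∈ fixedVectors p k N := by
    have hx' : phi p k N x = x := hx
    have hy' : phi p k N y = y := hy
    change phi p k N (y - r • x) = y - r • x
    rw [map_sub, map_smulₛₗ, hx', hy', hσ]
  have hz0 : biCoord p k e 0 (y - r • x) = 0 := by
    rw [map_sub, map_smul, smul_eq_mul, hr, div_mul_cancel₀ _ h0, sub_self]
  have hzz : stdPairing p k e (y - r • x) (y - r • x) = 0 := by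
    simp only [map_sub, map_smul, LinearMap.sub_apply, LinearMap.smul_apply, smul_eq_mul, hxx, hyy,
      hxy, stdPairing_comm p k e y x]
    ring
  have hc := he.biCoord_eq_zero h2 hz hz0 hzz
  have hxz : stdPairing p k e x (y - r • x) = 0 := by
    rw [map_sub, map_smul, hxx, hxy, smul_zero, sub_zero]
  rw [stdPairing_eq, hz0, hc 2 (by decide), hc 3 (by decide), hc 4 (by decide),
    hc 5 (by decide)] at hxz
  have h1 : biCoord p k e 1 (y - r • x) = 0 :=
    (mul_eq_zero.1 (by linear_combination hxz)).resolve_left h0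
  refine sub_eq_zero.1 (eq_of_biCoord_eq p k e fun i => ?_)
  rw [map_zero]
  by_cases hi : i = 1
  · rw [hi, h1]
  · exact hc i hi

/-- The quadratic space `V^Φ` contains no isotropic plane. -/
theorem IsSupersingularBasis.eq_smul_or_eq_smul (he : IsSupersingularBasis e)
    (h2 : (2 : WQ p k) ≠ 0) {x y : BiVec p k N}
    (hx : x ∈ fixedVectors p k N) (hy : y ∈ fixedVectors p k N)
    (hxx : stdPairing p k e x x = 0) (hxy : stdPairing p k e x y = 0)
    (hyy : stdPairing p k e y y = 0) :
    ∃ c : ℤ_[p], y = c • x ∨ x = c • y := by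
  have key : (∃ r, sigma p k r = r ∧ y = r • x) ∨ ∃ r, sigma p k r = r ∧ x = r • y := by
    by_cases h0 : biCoord p k e 0 x = 0
    · by_cases h0' : biCoord p k e 0 y = 0
      · have hcx := he.biCoord_eq_zero h2 hx h0 hxx
        have hcy := he.biCoord_eq_zero h2 hy h0' hyy
        by_cases h1 : biCoord p k e 1 x = 0
        · refine .inr ⟨0, map_zero _, eq_of_biCoord_eq p k e fun i => ?_⟩
          rw [zero_smul, map_zero]
          by_cases hi : i = 1
          · rw [hi, h1]
          · exact hcx i hi
        · refine .inl ⟨biCoord p k e 1 y / biCoord p k e 1 x, ?_, eq_of_biCoord_eq p k e fun i => ?_⟩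
          · rw [map_div₀, (he.biCoord_fixed hx).2.1, (he.biCoord_fixed hy).2.1, neg_div_neg_eq]
          · rw [map_smul, smul_eq_mul]
            by_cases hi : i = 1
            · rw [hi, div_mul_cancel₀ _ h1]
            · rw [hcx i hi, hcy i hi, mul_zero]
      · exact .inr (he.eq_smul_of_ne_zero h2 hy hx hyy
          (by rw [stdPairing_comm, hxy]) hxx h0')
    · exact .inl (he.eq_smul_of_ne_zero h2 hx hy hxx hxy hyy h0)
  have fin : ∀ {x y : BiVec p k N}, (∃ r, sigma p k r = r ∧ y = r • x) →
      ∃ c : ℤ_[p], y = c • x ∨ x = c • y := by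
    rintro x _ ⟨r, hr, rfl⟩
    obtain ⟨c, hc | hc⟩ := exists_zpToWQ_eq p hr
    · exact ⟨c, .inl (by rw [zp_smul_def, hc])⟩
    · by_cases hr0 : r = 0
      · exact ⟨0, .inl (by rw [hr0, zero_smul, zero_smul])⟩
      · exact ⟨c, .inr (by rw [zp_smul_def, hc, inv_smul_smul₀ hr0])⟩
  rcases key with h | h
  · exact fin h
  · obtain ⟨c, hc⟩ := fin h
    exact ⟨c, hc.symm⟩

end FixedIsotropic

/-! ### Lifting isotropic vectors over `ℤ_p` -/

section Hensel

variable {p : ℕ} [Fact p.Prime]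

theorem isUnit_add_of_dvd {a u : ℤ_[p]} (hu : IsUnit u) (ha : (p : ℤ_[p]) ∣ a) :
    IsUnit (u + a) := by
  rw [PadicInt.isUnit_iff, PadicInt.norm_add_eq_max_of_ne, PadicInt.isUnit_iff.1 hu, max_eq_left]
  · exact PadicInt.norm_le_one a
  · rw [PadicInt.isUnit_iff.1 hu]
    exact ((PadicInt.norm_lt_one_iff_dvd a).2 ha).ne'

/-- Hensel's lemma for `a + b X + c X ^ 2`. -/
theorem exists_root_quadratic {a b c : ℤ_[p]} (ha : (p : ℤ_[p]) ∣ a) (hb : IsUnit b) :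
    ∃ s, (p : ℤ_[p]) ∣ s ∧ a + b * s + c * s ^ 2 = 0 := by
  let F : Polynomial ℤ_[p] := .C a + .C b * .X + .C c * .X ^ 2
  have hF : ∀ s, F.aeval s = a + b * s + c * s ^ 2 := fun s => by simp [F]
  have hF' : F.derivative.aeval (0 : ℤ_[p]) = b := by simp [F]
  have ha' := (PadicInt.norm_lt_one_iff_dvd a).2 ha
  obtain ⟨s, hs, hs', -⟩ := hensels_lemma (F := F) (a := (0 : ℤ_[p])) (by
    rw [hF, hF', PadicInt.isUnit_iff.1 hb]
    simpa using ha')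
  refine ⟨s, ?_, by rw [← hF, hs]⟩
  rw [← PadicInt.norm_lt_one_iff_dvd]
  rwa [hF', PadicInt.isUnit_iff.1 hb, sub_zero] at hs'

variable {L : Type*} [AddCommGroup L] [Module ℤ_[p] L]

/-- In `s` this is a quadratic equation whose constant term is divisible by `p` and whose linear
coefficient `2 β(x, z)` is a unit. -/
theorem exists_isotropic_lift (h2 : IsUnit (2 : ℤ_[p])) (β : LinearMap.BilinForm ℤ_[p] L)
    (hsymm : ∀ x y, β x y = β y x) {x z : L} (hx : (p : ℤ_[p]) ∣ β x x) (hz : IsUnit (β x z)) :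
    ∃ s, (p : ℤ_[p]) ∣ s ∧ β (x + s • z) (x + s • z) = 0 := by
  obtain ⟨s, hs, h⟩ := exists_root_quadratic (c := β z z) hx (h2.mul hz)
  refine ⟨s, hs, ?_⟩
  simp only [map_add, map_smul, LinearMap.add_apply, LinearMap.smul_apply, smul_eq_mul,
    hsymm z x]
  linear_combination h

/-- A totally isotropic plane modulo `p` on which the form is nondegenerate lifts. -/
theorem exists_isotropic_pair_lift (h2 : IsUnit (2 : ℤ_[p])) (β : LinearMap.BilinForm ℤ_[p] L)
    (hsymm : ∀ x y, β x y = β y x) {x y z t : L} (hxx : (p : ℤ_[p]) ∣ β x x)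
    (hxy : (p : ℤ_[p]) ∣ β x y) (hyy : (p : ℤ_[p]) ∣ β y y) (hxz : IsUnit (β x z))
    (hxt : (p : ℤ_[p]) ∣ β x t) (hyt : IsUnit (β y t)) :
    ∃ x' y' : L, β (x + (p : ℤ_[p]) • x') (x + (p : ℤ_[p]) • x') = 0 ∧
      β (x + (p : ℤ_[p]) • x') (y + (p : ℤ_[p]) • y') = 0 ∧
      β (y + (p : ℤ_[p]) • y') (y + (p : ℤ_[p]) • y') = 0 := by
  obtain ⟨_, ⟨s, rfl⟩, hX⟩ := exists_isotropic_lift h2 β hsymm hxx hxz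
  rw [mul_smul] at hX
  set X := x + (p : ℤ_[p]) • s • z with hXdef
  have hXv : ∀ v, β X v = β x v + p * (s * β z v) := fun v => by simp [hXdef]
  have hXz : IsUnit (β X z) := by
    rw [hXv]
    exact isUnit_add_of_dvd hxz (Dvd.intro _ rfl)
  obtain ⟨w, hw⟩ := hXz
  obtain ⟨q, hq⟩ : (p : ℤ_[p]) ∣ β X y := by
    rw [hXv]; exact dvd_add hxy (Dvd.intro _ rfl)
  obtain ⟨r, hr⟩ : (p : ℤ_[p]) ∣ β X t := by
    rw [hXv]; exact dvd_add hxt (Dvd.intro _ rfl)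
  -- Subtracting `p`-multiples of `z` makes `y` and `t` orthogonal to `X` without changing them
  -- modulo `p`. The Hensel correction of `y₁` along `t₁` then preserves orthogonality to `X`.
  set y₁ := y - (p : ℤ_[p]) • ((q * ↑w⁻¹) • z) with hy₁
  set t₁ := t - (p : ℤ_[p]) • ((r * ↑w⁻¹) • z) with ht₁
  have hXy : β X y₁ = 0 := by
    simp only [hy₁, map_sub, map_smul, smul_eq_mul, hq, ← hw]
    linear_combination -(p : ℤ_[p]) * q * w.inv_mul
  have hXt : β X t₁ = 0 := by
    simp only [ht₁, map_sub, map_smul, smul_eq_mul, hr, ← hw]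
    linear_combination -(p : ℤ_[p]) * r * w.inv_mul
  have hyy₁ : (p : ℤ_[p]) ∣ β y₁ y₁ := by
    simp only [hy₁, map_sub, map_smul, LinearMap.sub_apply, LinearMap.smul_apply, smul_eq_mul]
    exact dvd_sub (dvd_sub hyy (Dvd.intro _ rfl)) (Dvd.intro _ rfl)
  have hyt₁ : IsUnit (β y₁ t₁) := by
    have : β y₁ t₁ = β y t + p * -(r * ↑w⁻¹ * β y z + q * ↑w⁻¹ * β z t₁) := by
      simp only [hy₁, ht₁, map_sub, map_smul, LinearMap.sub_apply, LinearMap.smul_apply, smul_eq_mul]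
      ring
    rw [this]
    exact isUnit_add_of_dvd hyt (Dvd.intro _ rfl)
  obtain ⟨_, ⟨s', rfl⟩, hY⟩ := exists_isotropic_lift h2 β hsymm hyy₁ hyt₁
  have hY' : y₁ + ((p : ℤ_[p]) * s') • t₁ = y + (p : ℤ_[p]) • (s' • t₁ - (q * ↑w⁻¹) • z) := by
    rw [hy₁, mul_smul (p : ℤ_[p]) s', smul_sub (p : ℤ_[p]) (s' • t₁), sub_add_eq_add_sub, add_sub_assoc]
  refine ⟨s • z, s' • t₁ - (q * ↑w⁻¹) • z, hX, ?_, hY' ▸ hY⟩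
  rw [← hY', map_add, map_smul, hXy, hXt, smul_zero, add_zero]

end Hensel

/-! ### Dual vectors for an independent pair in a nondegenerate space. -/

section DualPair

variable {F : Type*} [Field F] {U : Type*} [AddCommGroup U] [Module F U]

theorem exists_dual_pair (b : LinearMap.BilinForm F U)
    (hnd : ∀ x, (∀ y, b x y = 0) → x = 0) {x y : U}
    (h : ∀ r s : F, r • x + s • y = 0 → r = 0 ∧ s = 0) :
    ∃ z t, b x z = 1 ∧ b x t = 0 ∧ b y t = 1 := by
  have key : ∀ x, x ≠ 0 → ∃ z, b x z = 1 := fun x hx => by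
    by_contra! hne
    refine hx (hnd x fun z => ?_)
    by_contra hz
    exact hne ((b x z)⁻¹ • z) (by simp [hz])
  obtain ⟨z, hz⟩ := key x fun h0 => one_ne_zero (h 1 0 (by simp [h0])).1
  -- The vector `y - b(y, z) x` is orthogonal to `z` and nonzero by independence. Correcting a
  -- vector dual to it by a multiple of `z` makes it orthogonal to `x` and leaves this pairing
  -- unchanged.
  obtain ⟨t, ht⟩ := key (y - b y z • x) fun h0 => by
    have := h (-b y z) 1 (by rw [one_smul, neg_smul, neg_add_eq_sub, h0])
    exact one_ne_zero this.2
  rw [map_sub, map_smul, LinearMap.sub_apply, LinearMap.smul_apply, smul_eq_mul] at ht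
  have h3 : b y (t - b x t • z) = 1 := by
    rw [map_sub, map_smul, smul_eq_mul]
    linear_combination ht
  have h4 : b x (t - b x t • z) = 0 := by
    rw [map_sub, map_smul, smul_eq_mul, hz, mul_one, sub_self]
  exact ⟨z, t - b x t • z, hz, h4, h3⟩

end DualPair

/-! ### The quadratic space `Ω₀` over `𝔽_p` -/

section ResidueMap

variable (p : ℕ) [Fact p.Prime] (k : Type u) [Field k] [IsAlgClosed k] [CharP k p]

/-- Reduction modulo `p`, `ℤ_p → 𝔽_p`. -/
def zpRes : ℤ_[p] →+* ZMod p :=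
  WittVector.constantCoeff.comp (WittVector.equiv p).symm.toRingHom

theorem zpRes_eq_zero_iff (c : ℤ_[p]) : zpRes p c = 0 ↔ (p : ℤ_[p]) ∣ c := by
  have h : zpRes p c = ((WittVector.equiv p).symm c).coeff 0 := rfl
  rw [h, ← WittVector.mem_span_p_iff_coeff_zero_eq_zero, Ideal.mem_span_singleton,
    ← map_natCast (WittVector.equiv p).symm, map_dvd_iff]

theorem isUnit_of_zpRes_ne_zero {c : ℤ_[p]} (h : zpRes p c ≠ 0) : IsUnit c := by
  rw [Ne, zpRes_eq_zero_iff, ← PadicInt.norm_lt_one_iff_dvd, not_lt] at h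
  exact PadicInt.isUnit_iff.2 (le_antisymm (PadicInt.norm_le_one c) h)

theorem exists_nat_zpRes (c : ℤ_[p]) : ∃ (n : ℕ) (d : ℤ_[p]), c = n + p * d ∧ zpRes p c = n := by
  have hn : zpRes p c = ((zpRes p c).val : ℕ) := (ZMod.natCast_zmod_val _).symm
  have : zpRes p (c - ((zpRes p c).val : ℕ)) = 0 := by
    rw [map_sub, map_natCast, ← hn, sub_self]
  obtain ⟨d, hd⟩ := (zpRes_eq_zero_iff p _).1 this
  exact ⟨_, d, by rw [← hd]; ring, hn⟩

theorem zpToWQ_injective : Function.Injective (zpToWQ p k) := by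
  refine (algebraMap_W_injective p k).comp ?_
  refine Function.Injective.comp ?_ (WittVector.equiv p).symm.injective
  exact WittVector.map_injective _ (ZMod.castHom (dvd_refl p) k).injective

theorem reduction_algebraMap (w : WittVector p k) (h : algebraMap _ (WQ p k) w ∈ integers p k) :
    reduction p k ⟨algebraMap _ (WQ p k) w, h⟩ = w.coeff 0 := by
  have : (RingEquiv.ofBijective (algebraMap (WittVector p k) (WQ p k)).rangeRestrict
      ⟨fun _ _ h => algebraMap_W_injective p k (congrArg Subtype.val h),
        RingHom.rangeRestrict_surjective _⟩).symm ⟨algebraMap _ (WQ p k) w, h⟩ = w :=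
    (RingEquiv.symm_apply_eq _).2 rfl
  exact congrArg WittVector.constantCoeff this

omit [IsAlgClosed k] in
theorem zpToW_coeff_zero (c : ℤ_[p]) :
    (zpToW p k c).coeff 0 = ZMod.castHom (dvd_refl p) k (zpRes p c) := rfl

theorem two_WQ_ne_zero : (2 : WQ p k) ≠ 0 := by
  intro h
  have h2 : (zpToWQ p k) 2 = zpToWQ p k 0 := by rw [map_ofNat, map_zero, h]
  exact two_ne_zero (zpToWQ_injective p k h2)

end ResidueMap

/-! ### The `ℤ_p`-valued form of a vertex lattice and its reduction modulo `p`. -/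

section Lattice

variable {p : ℕ} [Fact p.Prime] {k : Type u} [Field k] [IsAlgClosed k] [CharP k p]
  {N : Type v} [AddCommGroup N] [WittVector.Isocrystal p k N]

/-- A `W`-basis of `M` spans `N` because `M` does, so it is a basis of `N` and its determinant with
respect to `e` is nonzero. -/
theorem IsVolumeGenerator.volCoord_ne_zero [Module (WittVector p k) N]
    [IsScalarTower (WittVector p k) (WQ p k) N] {M : Submodule (WittVector p k) N}
    (hM : Submodule.span (WQ p k) (M : Set N) = ⊤) {ω : ⋀[WQ p k]^4 N}
    (hω : IsVolumeGenerator p k M ω) (e : Module.Basis (Fin 4) (WQ p k) N) :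
    volCoord p k e ω ≠ 0 := by
  obtain ⟨m, rfl⟩ := hω
  rw [volCoord_ιMulti]
  refine IsUnit.ne_zero ((e.is_basis_iff_det).1 ?_)
  have hspan : Submodule.span (WQ p k) (Set.range fun i => (m i : N)) = ⊤ := by
    rw [← top_le_iff, ← hM, Submodule.span_le]
    intro x hx
    change ((⟨x, hx⟩ : M) : N) ∈ _
    rw [← m.sum_repr ⟨x, hx⟩, AddSubmonoidClass.coe_finsetSum]
    refine sum_mem fun i _ => ?_
    rw [Submodule.coe_smul, ← algebraMap_smul (WQ p k)]
    exact Submodule.smul_mem _ _ (Submodule.subset_span ⟨i, rfl⟩)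
  exact ⟨linearIndependent_of_top_le_span_of_card_eq_finrank hspan.ge
    (Module.finrank_eq_card_basis e).symm, hspan⟩

theorem pairing_mul_volCoord {ω : ⋀[WQ p k]^4 N} {e : Module.Basis (Fin 4) (WQ p k) N}
    (hω : volCoord p k e ω ≠ 0) (x y : BiVec p k N) :
    pairing p k ω x y * volCoord p k e ω = stdPairing p k e x y := by
  have hω0 : ω ≠ 0 := fun h => hω (by rw [h, map_zero])
  have hN : Module.finrank (WQ p k) N = 4 := by
    rw [Module.finrank_eq_card_basis e, Fintype.card_fin]
  rw [stdPairing_apply, ← pairing_smul p k hN ω hω0 x y, map_smul, smul_eq_mul]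

variable {e : Module.Basis (Fin 4) (WQ p k) N} {ω : ⋀[WQ p k]^4 N}

/-- Up to a unit of `W`, the form `p [x, y]` on a vertex lattice comes from a `ℤ_p`-valued form
that is proportional to the standard one. -/
theorem IsSupersingularBasis.exists_padicForm (he : IsSupersingularBasis e)
    (hω : volCoord p k e ω ≠ 0) (Λ : VertexLattice p k ω) :
    ∃ (β : LinearMap.BilinForm ℤ_[p] Λ.carrier) (w : (WittVector p k)ˣ) (κ : WQ p k), κ ≠ 0 ∧
      (∀ x y : Λ.carrier, zpToWQ p k (β x y) = κ * stdPairing p k e x y) ∧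
      ∀ x y : Λ.carrier, (p : WQ p k) * pairing p k ω x y =
        algebraMap (WittVector p k) (WQ p k) w * zpToWQ p k (β x y) := by
  have hp0 := natCast_WQ_ne_zero p k
  obtain ⟨m, n, w, hw⟩ := exists_mul_pow_eq_pow_mul_unit p k hω
  -- The power of `p` contained in the volume of `ω`, together with the extra `p` of the form `p [x,
  -- y]`, is fixed by `σ` and goes into `κ`. The unit `w` need not be fixed and is split off. So `κ`
  -- times the standard pairing is integral and fixed, hence in `ℤ_p`.
  set κ : WQ p k := (p : WQ p k) ^ (m + 1) / (p : WQ p k) ^ n with hκ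
  have hκ0 : κ ≠ 0 := div_ne_zero (pow_ne_zero _ hp0) (pow_ne_zero _ hp0)
  have hκσ : sigma p k κ = κ := by rw [hκ, map_div₀, map_pow, map_pow, map_natCast]
  have hww : algebraMap (WittVector p k) (WQ p k) ((w⁻¹ : (WittVector p k)ˣ) : WittVector p k) *
      algebraMap (WittVector p k) (WQ p k) w = 1 := by
    rw [← map_mul, Units.inv_mul, map_one]
  have hpair : ∀ x y : BiVec p k N, κ * stdPairing p k e x y =
      algebraMap (WittVector p k) (WQ p k) w * (p * pairing p k ω x y) := fun x y => by
    rw [← pairing_mul_volCoord hω, hκ, div_mul_eq_mul_div, div_eq_iff (pow_ne_zero _ hp0)]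
    linear_combination p * pairing p k ω x y * hw
  have hex : ∀ x y : Λ.carrier, ∃ c : ℤ_[p], zpToWQ p k c = κ * stdPairing p k e x y := by
    intro x y
    obtain ⟨v, hv⟩ := p_mul_pairing_mem Λ x y
    have hint : κ * stdPairing p k e x y = algebraMap (WittVector p k) (WQ p k) (w * v) := by
      rw [hpair, ← hv, map_mul]
    have hσ : sigma p k (κ * stdPairing p k e x y) = κ * stdPairing p k e x y := by
      rw [map_mul, hκσ, he.sigma_stdPairing (Λ.le_fixedVectors x.2) (Λ.le_fixedVectors y.2)]
    rw [hint, sigma_algebraMap] at hσ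
    obtain ⟨c, hc⟩ := exists_zpToW_eq p (algebraMap_W_injective p k hσ)
    exact ⟨c, by rw [hint, ← hc]; rfl⟩
  choose β hβ using hex
  have inj := zpToWQ_injective p k
  refine ⟨LinearMap.mk₂ ℤ_[p] β ?_ ?_ ?_ ?_, w⁻¹, κ, hκ0, hβ, fun x y => ?_⟩
  · exact fun x x' y => inj (by simp [hβ, mul_add])
  · exact fun c x y => inj (by simp [hβ, zp_smul_def]; ring)
  · exact fun x x' y => inj (by simp [hβ, mul_add])
  · exact fun c x y => inj (by simp [hβ, zp_smul_def]; ring)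
  · rw [LinearMap.mk₂_apply, hβ, hpair, ← mul_assoc, hww, one_mul]

theorem Omega0.mk_zp_smul (Λ : VertexLattice p k ω) (c : ℤ_[p]) (x : Λ.carrier) :
    Omega0.mk Λ (c • x) = zpRes p c • Omega0.mk Λ x := by
  obtain ⟨n, d, hc, hn⟩ := exists_nat_zpRes p c
  rw [hn, hc, add_smul, map_add, Nat.cast_smul_eq_nsmul, Nat.cast_smul_eq_nsmul, map_nsmul,
    mul_smul, Nat.cast_smul_eq_nsmul, map_nsmul, p_nsmul_Omega0, add_zero]

theorem Omega0.mk_add_p_smul (Λ : VertexLattice p k ω) (x y : Λ.carrier) :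
    Omega0.mk Λ (x + (p : ℤ_[p]) • y) = Omega0.mk Λ x := by
  rw [map_add, Nat.cast_smul_eq_nsmul, map_nsmul, p_nsmul_Omega0, add_zero]

/-- The form of `Ω₀` comes from a nondegenerate quadratic space over `𝔽_p` without totally
isotropic planes. -/
theorem IsSupersingularBasis.exists_zmodForm [Algebra (ZMod p) k] (hp : p ≠ 2)
    (he : IsSupersingularBasis e) (hω : volCoord p k e ω ≠ 0) (Λ : VertexLattice p k ω) :
    ∃ (b : LinearMap.BilinForm (ZMod p) (Omega0 Λ)) (ν : k), ν ≠ 0 ∧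
      (∀ x y, form0 Λ x y = ν * algebraMap (ZMod p) k (b x y)) ∧ (∀ x y, b x y = b y x) ∧
      (∀ x, (∀ y, b x y = 0) → x = 0) ∧
      ∀ x y, b x x = 0 → b x y = 0 → b y y = 0 →
        ∃ r s : ZMod p, (r ≠ 0 ∨ s ≠ 0) ∧ r • x + s • y = 0 := by
  obtain ⟨β, w, κ, hκ, hβ, hpair⟩ := he.exists_padicForm hω Λ
  have hcast : ZMod.castHom (dvd_refl p) k = algebraMap (ZMod p) k := Subsingleton.elim _ _
  have inj := zpToWQ_injective p k
  have hβs : ∀ x y, β x y = β y x := fun x y => inj (by rw [hβ, hβ, stdPairing_comm])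
  set ν : k := (w : WittVector p k).coeff 0 with hν
  have hν0 : ν ≠ 0 := (w.isUnit.map WittVector.constantCoeff).ne_zero
  have hform : ∀ X Y : Λ.carrier, form0 Λ (Omega0.mk Λ X) (Omega0.mk Λ Y) =
      ν * algebraMap (ZMod p) k (zpRes p (β X Y)) := fun X Y => by
    have h1 : (p : WQ p k) * pairing p k ω X Y =
        algebraMap (WittVector p k) (WQ p k) (w * zpToW p k (β X Y)) := by
      rw [hpair, map_mul]; rfl
    have h2 : algebraMap (WittVector p k) (WQ p k) (w * zpToW p k (β X Y)) ∈ integers p k :=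
      ⟨_, rfl⟩
    rw [form0_mk]
    have h3 : (⟨(p : WQ p k) * pairing p k ω X Y, p_mul_pairing_mem Λ X Y⟩ : integers p k) =
      ⟨_, h2⟩ := Subtype.ext h1
    rw [h3, reduction_algebraMap, WittVector.mul_coeff_zero, zpToW_coeff_zero, hcast]
  have hex : ∀ x y : Omega0 Λ, ∃ n : ZMod p, form0 Λ x y = ν * algebraMap (ZMod p) k n := by
    intro x y
    obtain ⟨X, rfl⟩ := Omega0.mk_surjective Λ x
    obtain ⟨Y, rfl⟩ := Omega0.mk_surjective Λ y
    exact ⟨_, hform X Y⟩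
  choose b₀ hb₀ using hex
  have injν : ∀ {m n : ZMod p}, ν * algebraMap (ZMod p) k m = ν * algebraMap (ZMod p) k n → m = n :=
    fun h => (algebraMap (ZMod p) k).injective (mul_left_cancel₀ hν0 h)
  have hsmul : ∀ (c : ZMod p) (x y : Omega0 Λ), form0 Λ (c • x) y = algebraMap _ k c * form0 Λ x y :=
    fun c x y => by
      have := congrArg (fun f => f y) (map_smul (zmodBilin (p := p) (form0 Λ)) c x)
      exact this.trans (Algebra.smul_def c _)
  have hsmul' : ∀ (c : ZMod p) (x y : Omega0 Λ), form0 Λ x (c • y) = algebraMap _ k c * form0 Λ x y :=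
    fun c x y => (map_smul (zmodBilin (p := p) (form0 Λ) x) c y).trans (Algebra.smul_def c _)
  let b : LinearMap.BilinForm (ZMod p) (Omega0 Λ) := LinearMap.mk₂ (ZMod p) b₀
    (fun x x' y => injν (by rw [← hb₀, map_add, map_add, AddMonoidHom.add_apply, hb₀, hb₀, mul_add]))
    (fun c x y => injν (by rw [← hb₀, hsmul, hb₀, smul_eq_mul, map_mul]; ring))
    (fun x y y' => injν (by rw [← hb₀, map_add, map_add, hb₀, hb₀, mul_add]))
    (fun c x y => injν (by rw [← hb₀, hsmul', hb₀, smul_eq_mul, map_mul]; ring))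
  have hb : ∀ x y, form0 Λ x y = ν * algebraMap (ZMod p) k (b x y) := hb₀
  have hbmk : ∀ X Y, b (Omega0.mk Λ X) (Omega0.mk Λ Y) = zpRes p (β X Y) := fun X Y =>
    injν (by rw [← hb, hform])
  have hbs : ∀ x y, b x y = b y x := fun x y => by
    obtain ⟨X, rfl⟩ := Omega0.mk_surjective Λ x
    obtain ⟨Y, rfl⟩ := Omega0.mk_surjective Λ y
    rw [hbmk, hbmk, hβs]
  -- If `p [x, y]` is divisible by `p` for all `y` in `Λ`, then `[x, y]` is integral and `x` lies in
  -- the dual lattice, which is zero in `Ω₀`.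
  have hnd : ∀ x, (∀ y, b x y = 0) → x = 0 := fun x hx => by
    obtain ⟨X, rfl⟩ := Omega0.mk_surjective Λ x
    rw [Omega0.mk_eq_zero]
    refine ⟨Λ.le_fixedVectors X.2, fun y hy => ?_⟩
    have h := hx (Omega0.mk Λ ⟨y, hy⟩)
    rw [hbmk, zpRes_eq_zero_iff] at h
    obtain ⟨c, hc⟩ := h
    have h2 := hpair X ⟨y, hy⟩
    rw [hc, map_mul, map_natCast, mul_left_comm] at h2
    have h3 := mul_left_cancel₀ (natCast_WQ_ne_zero p k) h2
    exact ⟨w * zpToW p k c, by rw [map_mul]; exact h3.symm⟩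
  refine ⟨b, ν, hν0, hb, hbs, hnd, fun x y hxx hxy hyy => ?_⟩
  -- An isotropic plane of `Ω₀` lifts by Hensel's lemma, with a dual pair providing the units. The
  -- lifted vectors are isotropic in `V^Φ`, hence proportional over `ℤ_p`, and reducing this
  -- relation contradicts independence.
  by_contra! hne
  obtain ⟨z, t, hxz, hxt, hyt⟩ := exists_dual_pair b hnd (x := x) (y := y) fun r s h => by
    by_contra hrs
    exact hne r s (by tauto) h
  obtain ⟨X, rfl⟩ := Omega0.mk_surjective Λ x
  obtain ⟨Y, rfl⟩ := Omega0.mk_surjective Λ y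
  obtain ⟨Z, rfl⟩ := Omega0.mk_surjective Λ z
  obtain ⟨T, rfl⟩ := Omega0.mk_surjective Λ t
  rw [hbmk] at hxx hxy hyy hxz hxt hyt
  rw [zpRes_eq_zero_iff] at hxx hxy hyy hxt
  have h2 : IsUnit (2 : ℤ_[p]) := by
    refine isUnit_of_zpRes_ne_zero p ?_
    rw [map_ofNat]
    exact fun h => hp ((Nat.prime_dvd_prime_iff_eq Fact.out Nat.prime_two).1
      ((ZMod.natCast_eq_zero_iff 2 p).1 h))
  obtain ⟨X', Y', h1, h3, h4⟩ := exists_isotropic_pair_lift h2 β hβs hxx hxy hyy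
    (isUnit_of_zpRes_ne_zero p (hxz ▸ one_ne_zero)) hxt (isUnit_of_zpRes_ne_zero p (hyt ▸ one_ne_zero))
  have hstd : ∀ A C : Λ.carrier, β A C = 0 → stdPairing p k e A C = 0 := fun A C h => by
    have := hβ A C
    rw [h, map_zero] at this
    exact (mul_eq_zero.1 this.symm).resolve_left hκ
  obtain ⟨c, hc | hc⟩ := he.eq_smul_or_eq_smul (two_WQ_ne_zero p k)
    (Λ.le_fixedVectors (X + (p : ℤ_[p]) • X').2) (Λ.le_fixedVectors (Y + (p : ℤ_[p]) • Y').2)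
    (hstd _ _ h1) (hstd _ _ h3) (hstd _ _ h4)
  · have hc' : Y + (p : ℤ_[p]) • Y' = c • (X + (p : ℤ_[p]) • X') := Subtype.ext hc
    have := congrArg (Omega0.mk Λ) hc'
    rw [Omega0.mk_zp_smul, Omega0.mk_add_p_smul, Omega0.mk_add_p_smul] at this
    exact hne (zpRes p c) (-1) (.inr (neg_ne_zero.2 one_ne_zero)) (by
      rw [← this, neg_one_smul, add_neg_cancel])
  · have hc' : X + (p : ℤ_[p]) • X' = c • (Y + (p : ℤ_[p]) • Y') := Subtype.ext hc
    have := congrArg (Omega0.mk Λ) hc'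
    rw [Omega0.mk_zp_smul, Omega0.mk_add_p_smul, Omega0.mk_add_p_smul] at this
    exact hne (-1) (zpRes p c) (.inl (neg_ne_zero.2 one_ne_zero)) (by
      rw [← this, neg_one_smul, neg_add_cancel])

end Lattice

end GLFour

end

theorem proposition5p2 (p : ℕ) [Fact p.Prime] (hp : p ≠ 2)
    (k : Type u) [Field k] [IsAlgClosed k] [CharP k p] [Algebra (ZMod p) k]
    (N : Type v) [AddCommGroup N] [WittVector.Isocrystal p k N]
    [Module (WittVector p k) N] [IsScalarTower (WittVector p k) (GLFour.WQ p k) N]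
    (hN : GLFour.IsSupersingular p k N)
    (M : Submodule (WittVector p k) N) (hM : GLFour.IsDieudonneLattice p k M)
    (ω : ⋀[GLFour.WQ p k]^4 N) (hω : GLFour.IsVolumeGenerator p k M ω)
    (Λ : GLFour.VertexLattice p k ω) (hΛ : Λ.type = 4) :
    Nonempty (GLFour.OrthogonalGrassmannian (GLFour.form Λ) 2) ∧
    Nat.card (GLFour.FlagComponent (GLFour.form Λ) 2) = 2 ∧
    ∀ Y : GLFour.OrthogonalGrassmannian (GLFour.form Λ) 2,
      IsClosed (GLFour.dlLocus p (GLFour.frobOmega Λ) Y) ∧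
      (∀ (k' : Type u) [Field k'] [Algebra k k'] (x : GLFour.specOver k k' ⟶ Y.X),
        Set.range x.left ⊆ GLFour.dlLocus p (GLFour.frobOmega Λ) Y ↔
          GLFour.DLCondition p (GLFour.frobOmega Λ) 2 k' (Y.points k' x).1) ∧
      (⋃ c, GLFour.dlComponentLocus p (GLFour.frobOmega Λ) Y c) =
        GLFour.dlLocus p (GLFour.frobOmega Λ) Y ∧
      Pairwise (Function.onFun Disjoint (GLFour.dlComponentLocus p (GLFour.frobOmega Λ) Y)) ∧
      ∀ c : GLFour.FlagComponent (GLFour.form Λ) 2,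
        IsClosed (GLFour.dlComponentLocus p (GLFour.frobOmega Λ) Y c) ∧
        Nonempty (GLFour.dlComponent p (GLFour.frobOmega Λ) Y c ≅ GLFour.projectiveLine k) := by
  obtain ⟨e, h0, h1, h2, h3⟩ := hN
  have he : GLFour.IsSupersingularBasis e := ⟨h0, h1, h2, h3⟩
  -- The arithmetic of the isocrystal enters only through this nonsplit form on `Ω₀`; the rest is
  -- geometry of the hyperbolic space with its Frobenius.
  obtain ⟨b, ν, hν, hf, hsymm, hnd, hplane⟩ :=
    he.exists_zmodForm hp (hω.volCoord_ne_zero hM.span_eq_top e) Λ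
  obtain ⟨E, c, hc, hB, hΦ⟩ := GLFour.exists_hyperbolic_basis hp hΛ b hsymm hnd hplane
    (GLFour.form0 Λ) hν hf
  have h2' : (2 : k) ≠ 0 := fun h => hp ((Nat.prime_dvd_prime_iff_eq Fact.out Nat.prime_two).1
    ((CharP.cast_eq_zero_iff k p 2).1 (by exact_mod_cast h)))
  exact GLFour.deligneLusztig_hyperbolic hc hB p hΦ h2'
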